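/- A house allocation instance consists of a finite set $N$ of $n$ agents, a finite set $O$ of objects, and for each agent $i$ a preference list, i.e. a set of acceptable objects with a weak order $\succ_i$ (ties allowed); being unmatched is worse than any acceptable object. Let $m$ be the number of acceptable agent-object pairs. A matching gives each agent at most one acceptable object and each object to at most one agent. A matching $M$ is $k$-stable if there is no other matching $M'$ with $|\{i\in N : M'(i)\succ_i M(i)\}|\ge k$; it is majority stable if it is $\frac{n+1}{2}$-stable. A list is dichotomous if it has at most two ties (good and bad objects), and complete if all objects are acceptable. Theorem. 1. If each agent's preference list is a single tie, then every maximum size matching is majority stable; in particular a majority stable matching exists. One can be found in $O(\sqrt n\,m)$ time. 2. If each agent's preference list is dichotomous and complete and $|O|\ge|N|$, then every maximum size matching $F$ of the graph of first-choice edges can be extended to a matching that matches all agents, and every such extension of $F$ is majority stable; in particular a majority stable matching exists. One can be found in $O(\sqrt n\,m)$ time. 3. If each agent's preference list is dichotomous and complete and $|O|<|N|$, then a $\left(\frac{2n}{3}+1\right)$-stable matching exists, and one can be found in $O(\sqrt n\,m)$ time. Running times are for a random access machine with unit-cost instructions (constants, addition, subtraction, indirect load and store, jumps) on words of $O(\log(n+|O|+m))$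 bits and zero-initialised memory, which is given $n$, $|O|$, $m$ and the $m$ acceptable pairs with the positions of their ties, listed in any order; the bound is $C(\sqrt n\,m+1)$ steps for a constant $C$, where the $+1$ matters only if $m=0$. -/

import Mathlib

universe u v

/-! ### House allocation with ties and possibly incomplete preference lists -/

/-- A house allocation instance with agents `N` and objects `O`. The preference list of agent `i`
consists of the objects in `acc i`, arranged in consecutive ties; `rank i o` is the position
(starting from `0`) of the tie that contains the acceptable object `o`. No position is skipped.
The value of `rank i o` is irrelevant if `o` is not acceptable to `i`. -/
structure HAInstance (N : Type*) (O : Type*) where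
  acc : N → Finset O
  rank : N → O → ℕ
  rank_dense : ∀ i, ∀ o ∈ acc i, ∀ r < rank i o, ∃ o' ∈ acc i, rank i o' = r

namespace HAInstance

/-- The number of matched agents. -/
def matchingSize {N O : Type*} [Fintype N] (M : N → Option O) : ℕ :=
  (Finset.univ.filter fun i => (M i).isSome = true).card

section

variable {N O : Type*} (I : HAInstance N O)

/-- `o ≻ᵢ o'`, for acceptable objects `o` and `o'`. -/
def Prefers (i : N) (o o' : O) : Prop :=
  o ∈ I.acc i ∧ o' ∈ I.acc i ∧ I.rank i o < I.rank i o'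

/-- Comparison of outcomes for an agent, `none` meaning being unmatched: being unmatched is worse
than every acceptable object. -/
def PrefersOutcome (i : N) : Option O → Option O → Prop
  | some o, some o' => I.Prefers i o o'
  | some o, none => o ∈ I.acc i
  | none, _ => False

/-- Each agent gets at most one object, which is acceptable, and each object is given to at most
one agent. -/
def IsMatching (M : N → Option O) : Prop :=
  (∀ i o, M i = some o → o ∈ I.acc i) ∧
    ∀ i j o, M i = some o → M j = some o → i = j

open Classical in
/-- The number of agents `i` with `M' i ≻ᵢ M i`. -/
noncomputable def numImproving [Fintype N] (M M' : N → Option O) : ℕ :=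
  (Finset.univ.filter fun i => I.PrefersOutcome i (M' i) (M i)).card

/-- `M` is a `k`-stable matching. -/
def KStable [Fintype N] (k : ℝ) (M : N → Option O) : Prop :=
  I.IsMatching M ∧
    ¬ ∃ M' : N → Option O, I.IsMatching M' ∧ M' ≠ M ∧ k ≤ (I.numImproving M M' : ℝ)

/-- `M` is a majority stable matching. -/
def MajorityStable [Fintype N] (M : N → Option O) : Prop :=
  I.KStable (((Fintype.card N : ℝ) + 1) / 2) M

/-- A matching of maximum size in the acceptability graph. -/
def IsMaximumMatching [Fintype N] (M : N → Option O) : Prop :=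
  I.IsMatching M ∧ ∀ M', I.IsMatching M' → matchingSize M' ≤ matchingSize M

/-- `o` is a most preferred acceptable object of `i`. -/
def IsFirstChoice (i : N) (o : O) : Prop :=
  o ∈ I.acc i ∧ ∀ o' ∈ I.acc i, ¬ I.Prefers i o' o

/-- A matching in the graph that contains only the first-choice edges of each agent. -/
def IsFirstChoiceMatching (M : N → Option O) : Prop :=
  I.IsMatching M ∧ ∀ i o, M i = some o → I.IsFirstChoice i o

/-- A matching of maximum size in the graph of first-choice edges. -/
def IsMaximumFirstChoiceMatching [Fintype N] (M : N → Option O) : Prop :=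
  I.IsFirstChoiceMatching M ∧
    ∀ M', I.IsFirstChoiceMatching M' → matchingSize M' ≤ matchingSize M

/-- `M` is obtained from the matching `F` by giving an object to every agent unmatched in `F`. -/
def IsCompletionOf (M F : N → Option O) : Prop :=
  I.IsMatching M ∧ (∀ i o, F i = some o → M i = some o) ∧ ∀ i, M i ≠ none

/-- Every preference list is a single tie. -/
def SingleTie : Prop :=
  ∀ i, ∀ o ∈ I.acc i, ∀ o' ∈ I.acc i, I.rank i o = I.rank i o'

/-- Every agent classifies the acceptable objects as good (position `0`) or bad (position `1`). -/
def Dichotomous : Prop :=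
  ∀ i, ∀ o ∈ I.acc i, I.rank i o ≤ 1

/-- Every agent finds every object acceptable. -/
def CompleteLists : Prop :=
  ∀ i o, o ∈ I.acc i

/-- The number `m` of acceptable agent-object pairs. -/
def numPairs [Fintype N] : ℕ :=
  ∑ i, (I.acc i).card

/-- `e` lists every acceptable agent-object pair exactly once, in any order. -/
def IsListing (e : List (N × O)) : Prop :=
  e.Nodup ∧ ∀ p : N × O, p ∈ e ↔ p.2 ∈ I.acc p.1

end

end HAInstance

/-! ### Random access machines -/

/-- The instructions of a random access machine with registers `0, 1, 2, …` and an
array of memory cells, all holding natural numbers. -/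
inductive RAMInstr where
  /-- `r := c` -/
  | const (r c : ℕ)
  /-- `r := s + t` -/
  | add (r s t : ℕ)
  /-- `r := s - t`, truncated at `0` -/
  | sub (r s t : ℕ)
  /-- `r := mem[s]` -/
  | load (r s : ℕ)
  /-- `mem[r] := s` -/
  | store (r s : ℕ)
  /-- go to instruction `l` -/
  | jump (l : ℕ)
  /-- go to instruction `l` if `s < t` -/
  | jumpLt (s t l : ℕ)

/-- A program; execution starts at instruction `0` and halts when the program counter leaves the
program. -/
abbrev RAMProgram := List RAMInstr

structure RAMConfig where
  pc : ℕ
  reg : ℕ → ℕ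
  mem : ℕ → ℕ

namespace RAMConfig

/-- The effect of a single instruction. -/
def exec (c : RAMConfig) : RAMInstr → RAMConfig
  | .const r v => ⟨c.pc + 1, Function.update c.reg r v, c.mem⟩
  | .add r s t => ⟨c.pc + 1, Function.update c.reg r (c.reg s + c.reg t), c.mem⟩
  | .sub r s t => ⟨c.pc + 1, Function.update c.reg r (c.reg s - c.reg t), c.mem⟩
  | .load r s => ⟨c.pc + 1, Function.update c.reg r (c.mem (c.reg s)), c.mem⟩
  | .store r s => ⟨c.pc + 1, c.reg, Function.update c.mem (c.reg r) (c.reg s)⟩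
  | .jump l => ⟨l, c.reg, c.mem⟩
  | .jumpLt s t l => ⟨if c.reg s < c.reg t then l else c.pc + 1, c.reg, c.mem⟩

/-- One step of the program `P`; a halted configuration is left unchanged. -/
def step (P : RAMProgram) (c : RAMConfig) : RAMConfig :=
  match P[c.pc]? with
  | some ins => c.exec ins
  | none => c

/-- No register and no memory cell holds a number larger than `B`. -/
def BoundedBy (B : ℕ) (c : RAMConfig) : Prop :=
  (∀ r, c.reg r ≤ B) ∧ ∀ a, c.mem a ≤ B

end RAMConfig

namespace HAInstance

/-- The initial configuration for an instance with `n` agents, `q` objects and the listing `e` of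
the `m` acceptable pairs. Registers `0, 1, 2` hold `n, q, m`. Cells `3 j, 3 j + 1, 3 j + 2`
hold the agent, the object and the rank of the `j`-th listed pair, for `j < m`. Everything else
is `0`. -/
def initialConfig {n q : ℕ} (I : HAInstance (Fin n) (Fin q)) (e : List (Fin n × Fin q)) :
    RAMConfig where
  pc := 0
  reg := fun r => if r = 0 then n else if r = 1 then q else if r = 2 then e.length else 0
  mem := fun a =>
    match e[a / 3]? with
    | none => 0
    | some (i, o) =>
        if a % 3 = 0 then (i : ℕ) else if a % 3 = 1 then (o : ℕ) else I.rank i o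

/-- The `n` cells after the `3 m` input cells hold the matching `M`: the cell of agent `i` is `0`
if `i` is unmatched and `o + 1` if `i` is matched to `o`. -/
def Outputs {n q : ℕ} (c : RAMConfig) (m : ℕ) (M : Fin n → Option (Fin q)) : Prop :=
  ∀ i : Fin n, c.mem (3 * m + i) =
    match M i with
    | none => 0
    | some o => (o : ℕ) + 1

/-- There is one program that, for every instance satisfying `Restriction` with `n` agents, `q`
objects and `m` acceptable pairs, presented by any listing of these pairs, halts after
`O(√n m)` steps (a constant number of steps if there are no acceptable pairs) with an output
matching `M` satisfying `Goal`; all numbers occurring are at most `C (n + q + m + 1)`, so that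
words of `O(log (n + q + m))` bits suffice. -/
def FoundInSqrtTime
    (Restriction : ∀ {n q : ℕ}, HAInstance (Fin n) (Fin q) → Prop)
    (Goal : ∀ {n q : ℕ}, HAInstance (Fin n) (Fin q) → (Fin n → Option (Fin q)) → Prop) : Prop :=
  ∃ (P : RAMProgram) (C : ℕ), ∀ (n q : ℕ) (I : HAInstance (Fin n) (Fin q))
    (e : List (Fin n × Fin q)), I.IsListing e → Restriction I →
      ∃ (t : ℕ) (M : Fin n → Option (Fin q)),
        (t : ℝ) ≤ C * (Real.sqrt n * I.numPairs + 1) ∧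
        P.length ≤ ((RAMConfig.step P)^[t] (I.initialConfig e)).pc ∧
        (∀ s ≤ t, ((RAMConfig.step P)^[s] (I.initialConfig e)).BoundedBy
          (C * (n + q + I.numPairs + 1))) ∧
        Outputs ((RAMConfig.step P)^[t] (I.initialConfig e)) I.numPairs M ∧
        Goal I M

end HAInstance

/-! Stability. Let `x` be the number of agents that prefer `M'` to `M`. For single ties, an
improving agent is unmatched in `M` and matched in `M'`. So `x ≤ n - |M|`, and `x ≤ |M|` because `M`
is maximum; hence `2x ≤ n`. For dichotomous lists, let `M` extend a maximum first-choice matching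
`F`, and let `b` count the improving agents that hold an object in `M`. They receive first choices
in `M'`, so `b ≤ |F|`; no agent matched by `F` can improve, so `b ≤ |M| - |F|`. Hence `2b ≤ |M|` and
`x ≤ n - |M| + b` (`numImproving_le_of_dichotomous`). If `M` matches all agents, this gives `2x ≤
n`. If `M` gives away all objects, then also `x ≤ |O| ≤ |M|`, and together `3x ≤ 2n`. With complete
lists, an inclusion-maximal extension of `F` is of the first kind if `|O| ≥ |N|` and of the second
kind otherwise. So a single algorithm serves all three parts: find a maximum first-choice matching
and extend it greedily (`IsSolution`).

Algorithm. Let `K` be about `√n` with `K² ≥ n`. An auction comes first: an agent at level `l` takes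
a good object of price `l` from its owner and raises the price to `l + 1`; at the end of its list it
moves up one level, and it gives up at level `K`. An edge is looked at once per level, so this costs
`O(K m)`. Comparing a rival matching with the auction at each level `t < K` and summing shows that
at most `K` edges are missing (`Matchable.mul_card_le`). At most `K + 1` depth-first passes for
augmenting paths, of cost `O(m)` each, remove this deficit; the failure of the last pass proves
maximality (`Matchable.card_le_size`).

Machine. The algorithm is written in a small structured language with a weakest-precondition
calculus that counts steps; loops are paid for by potentials (`wp_loop`). A compiler carries the
result to the random access machine with a constant factor in time and word size (`simulation`). -/

namespace HAInstance

/-! ### Stability of maximal extensions of maximum first-choice matchings -/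

section Stability

/-- The objects of `M` that are kept when only the agents of `S` keep their object. -/
def keep {N O : Type*} (S : N → Prop) [DecidablePred S] (M : N → Option O) : N → Option O :=
  fun i => if S i then M i else none

theorem keep_eq_some {N O : Type*} {S : N → Prop} [DecidablePred S] {M : N → Option O} {i : N}
    {o : O} : keep S M i = some o ↔ S i ∧ M i = some o := by
  unfold keep
  split_ifs with h <;> simp [h]

variable {N O : Type*} (I : HAInstance N O)

theorem IsMatching.keep {M : N → Option O} (hM : I.IsMatching M) (S : N → Prop)
    [DecidablePred S] : I.IsMatching (keep S M) := by
  refine ⟨fun i o h => hM.1 i o (keep_eq_some.1 h).2, fun i j o hi hj => ?_⟩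
  exact hM.2 i j o (keep_eq_some.1 hi).2 (keep_eq_some.1 hj).2

/-- As no position is skipped, a nonempty list has an object of rank `0`. The program can therefore
recognise a first-choice edge by looking at its rank alone. -/
theorem isFirstChoice_iff {i : N} {o : O} :
    I.IsFirstChoice i o ↔ o ∈ I.acc i ∧ I.rank i o = 0 := by
  constructor
  · rintro ⟨h, h'⟩
    refine ⟨h, ?_⟩
    by_contra hne
    obtain ⟨o', ho', hr⟩ := I.rank_dense i o h 0 (Nat.pos_of_ne_zero hne)
    exact h' o' ho' ⟨ho', h, by omega⟩
  · rintro ⟨h, h'⟩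
    exact ⟨h, fun o' _ hp => by have := hp.2.2; omega⟩

theorem SingleTie.isFirstChoice (h : I.SingleTie) {i : N} {o : O} (ho : o ∈ I.acc i) :
    I.IsFirstChoice i o :=
  ⟨ho, fun o' ho' hp => by have := hp.2.2; have := h i o ho o' ho'; omega⟩

variable [Fintype N]

/-- Restricting `M'` to the agents of `S` gives a first-choice matching, which cannot be larger than
`F`. -/
theorem card_le_of_firstChoice {F M' : N → Option O} (hF : I.IsMaximumFirstChoiceMatching F)
    (hM' : I.IsMatching M') (S : Finset N)
    (hS : ∀ i ∈ S, ∃ o, M' i = some o ∧ I.IsFirstChoice i o) : S.card ≤ matchingSize F := by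
  classical
  refine le_trans ?_ (hF.2 (HAInstance.keep (· ∈ S) M') ⟨hM'.keep I _, ?_⟩)
  · refine Finset.card_le_card fun i hi => ?_
    obtain ⟨o, ho, -⟩ := hS i hi
    refine Finset.mem_filter.2 ⟨Finset.mem_univ _, ?_⟩
    rw [keep_eq_some.2 ⟨hi, ho⟩]
    rfl
  · intro i o h
    obtain ⟨hi, h⟩ := keep_eq_some.1 h
    obtain ⟨o', ho', hf⟩ := hS i hi
    rw [h, Option.some_inj] at ho'
    exact ho' ▸ hf

theorem kStable_of_numImproving_lt {k : ℝ} {M : N → Option O} (hM : I.IsMatching M)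
    (h : ∀ M', I.IsMatching M' → (I.numImproving M M' : ℝ) < k) : I.KStable k M :=
  ⟨hM, fun ⟨M', hM', _, hk⟩ => absurd hk (not_le.2 (h M' hM'))⟩

theorem card_unmatched (M : N → Option O) :
    (Finset.univ.filter fun i => ¬ (M i).isSome = true).card + matchingSize M
      = Fintype.card N := by
  unfold matchingSize
  rw [add_comm, Finset.card_filter_add_card_filter_not, Finset.card_univ]

/-- The agents matched in `M` but not in the matching `F` contained in `M`. -/
theorem card_extension {F M : N → Option O} (h : ∀ i o, F i = some o → M i = some o) :
    (Finset.univ.filter fun i => (M i).isSome = true ∧ F i = none).card + matchingSize F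
      = matchingSize M := by
  classical
  unfold matchingSize
  rw [← Finset.card_union_of_disjoint]
  · congr 1
    ext i
    cases hF : F i with
    | none => simp [hF]
    | some o => simp [hF, h i o hF]
  · refine Finset.disjoint_left.2 fun i hi hi' => ?_
    simp only [Finset.mem_filter, Finset.mem_univ, true_and] at hi hi'
    simp [hi.2] at hi'

/-- With one tie, improving means passing from no object to some object. The improving agents are
thus among the unmatched ones, and `M'` restricted to them is no larger than `M`; twice their number
is at most `n`. -/
theorem SingleTie.majorityStable (h : I.SingleTie) {M : N → Option O}
    (hM : I.IsMaximumFirstChoiceMatching M) : I.MajorityStable M := by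
  classical
  refine I.kStable_of_numImproving_lt hM.1.1 fun M' hM' => ?_
  have himp : ∀ i, I.PrefersOutcome i (M' i) (M i) → M i = none ∧ ∃ o, M' i = some o := by
    intro i hi
    cases h1 : M' i with
    | none => simp [h1, PrefersOutcome] at hi
    | some o =>
      cases h2 : M i with
      | none => simp
      | some o' =>
        rw [h1, h2] at hi
        have := hi.2.2
        have := h i o hi.1 o' hi.2.1
        omega
  have h1 : I.numImproving M M' ≤ matchingSize M := by
    refine I.card_le_of_firstChoice hM hM' _ fun i hi => ?_
    obtain ⟨-, o, ho⟩ := himp i (Finset.mem_filter.1 hi).2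
    exact ⟨o, ho, h.isFirstChoice I (hM'.1 i o ho)⟩
  have h2 : I.numImproving M M' ≤
      (Finset.univ.filter fun i => ¬ (M i).isSome = true).card := by
    refine Finset.card_le_card fun i hi => ?_
    have := (himp i (Finset.mem_filter.1 hi).2).1
    simp [this]
  have h3 := card_unmatched M
  have h4 : 2 * I.numImproving M M' ≤ Fintype.card N := by omega
  have h5 : 2 * (I.numImproving M M' : ℝ) ≤ Fintype.card N := by exact_mod_cast h4
  linarith

/-- With dichotomous lists, every improving agent is unmatched in `M`, or gets a first choice
instead of another object. -/
theorem numImproving_le_of_dichotomous (hd : I.Dichotomous) {F M M' : N → Option O}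
    (hF : I.IsMaximumFirstChoiceMatching F) (hext : ∀ i o, F i = some o → M i = some o)
    (hM' : I.IsMatching M') :
    ∃ b, I.numImproving M M' + matchingSize M ≤ Fintype.card N + b ∧ b ≤ matchingSize F ∧
      b + matchingSize F ≤ matchingSize M := by
  classical
  -- The witness `b` counts the improving agents that already hold an object in `M`.
  refine ⟨(Finset.univ.filter fun i => I.PrefersOutcome i (M' i) (M i) ∧
    (M i).isSome = true).card, ?_, ?_, ?_⟩
  · rw [← card_unmatched M]
    suffices I.numImproving M M' ≤ (Finset.univ.filter fun i => ¬ (M i).isSome = true).card +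
        (Finset.univ.filter fun i => I.PrefersOutcome i (M' i) (M i) ∧
          (M i).isSome = true).card by omega
    refine le_trans (Finset.card_le_card fun i hi => ?_) (Finset.card_union_le _ _)
    have := (Finset.mem_filter.1 hi).2
    by_cases hs : (M i).isSome = true
    · exact Finset.mem_union_right _ (Finset.mem_filter.2 ⟨Finset.mem_univ _, this, hs⟩)
    · exact Finset.mem_union_left _ (Finset.mem_filter.2 ⟨Finset.mem_univ _, hs⟩)
  -- With ranks at most `1`, such an agent moves from rank `1` to rank `0`, hence to a first choice.
  · refine I.card_le_of_firstChoice hF hM' _ fun i hi => ?_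
    obtain ⟨hp, hs⟩ := (Finset.mem_filter.1 hi).2
    obtain ⟨o', ho'⟩ := Option.isSome_iff_exists.1 hs
    cases h1 : M' i with
    | none => simp [h1, PrefersOutcome] at hp
    | some o =>
      rw [h1, ho'] at hp
      refine ⟨o, rfl, I.isFirstChoice_iff.2 ⟨hp.1, ?_⟩⟩
      have := hp.2.2
      have := hd i o' hp.2.1
      omega
  -- An agent matched by `F` keeps its first choice in `M` and cannot improve, so `b` counts only
  -- agents added by the extension.
  · rw [← card_extension hext]
    refine Nat.add_le_add_right (Finset.card_le_card fun i hi => ?_) _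
    obtain ⟨hp, hs⟩ := (Finset.mem_filter.1 hi).2
    refine Finset.mem_filter.2 ⟨Finset.mem_univ _, hs, ?_⟩
    cases h1 : F i with
    | none => rfl
    | some o' =>
      rw [hext i o' h1] at hp
      cases h2 : M' i with
      | none => simp [h2, PrefersOutcome] at hp
      | some o =>
        rw [h2] at hp
        exact absurd hp ((hF.1.2 i o' h1).2 o hp.1)

theorem IsCompletionOf.majorityStable (hd : I.Dichotomous) {F M : N → Option O}
    (hF : I.IsMaximumFirstChoiceMatching F) (hM : I.IsCompletionOf M F) :
    I.MajorityStable M := by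
  refine I.kStable_of_numImproving_lt hM.1 fun M' hM' => ?_
  obtain ⟨b, h1, h2, h3⟩ := I.numImproving_le_of_dichotomous hd hF hM.2.1 hM'
  have h4 : matchingSize M = Fintype.card N := by
    unfold matchingSize
    rw [Finset.filter_true_of_mem fun i _ => Option.isSome_iff_ne_none.2 (hM.2.2 i),
      Finset.card_univ]
  have h5 : 2 * I.numImproving M M' ≤ Fintype.card N := by omega
  have h6 : 2 * (I.numImproving M M' : ℝ) ≤ Fintype.card N := by exact_mod_cast h5
  linarith

/-- Improving agents hold distinct objects in `M'`. This bound takes effect when there are fewer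
objects than agents. -/
theorem numImproving_le_card [Fintype O] {M M' : N → Option O} (hM' : I.IsMatching M') :
    I.numImproving M M' ≤ Fintype.card O := by
  classical
  have hex : ∀ i, I.PrefersOutcome i (M' i) (M i) → ∃ o, M' i = some o := by
    intro i hi
    cases h1 : M' i with
    | none => simp [h1, PrefersOutcome] at hi
    | some o => exact ⟨o, rfl⟩
  choose f hf using hex
  unfold numImproving
  rw [← Finset.card_attach, ← Finset.card_univ]
  refine Finset.card_le_card_of_injOn
    (fun i => f i.1 (Finset.mem_filter.1 i.2).2) (fun _ _ => Finset.mem_coe.2 (Finset.mem_univ _))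
    fun i _ j _ hij => Subtype.ext ?_
  refine hM'.2 i.1 j.1 _ (hf i.1 (Finset.mem_filter.1 i.2).2) ?_
  exact (hf j.1 (Finset.mem_filter.1 j.2).2).trans (congrArg some hij.symm)

/-- A matching that contains `F` and gives away all objects. -/
theorem kStable_of_saturating [Fintype O] (hd : I.Dichotomous) {F M : N → Option O}
    (hF : I.IsMaximumFirstChoiceMatching F) (hM : I.IsMatching M)
    (hext : ∀ i o, F i = some o → M i = some o) (hsat : ∀ o, ∃ i, M i = some o) :
    I.KStable (2 * (Fintype.card N : ℝ) / 3 + 1) M := by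
  classical
  refine I.kStable_of_numImproving_lt hM fun M' hM' => ?_
  obtain ⟨b, h1, h2, h3⟩ := I.numImproving_le_of_dichotomous hd hF hext hM'
  have h4 : Fintype.card O ≤ matchingSize M := by
    choose g hg using hsat
    rw [← Finset.card_univ]
    refine Finset.card_le_card_of_injOn g (fun o _ => ?_) fun o _ o' _ h => ?_
    · simp [hg]
    · have := hg o
      rw [h, hg o', Option.some_inj] at this
      exact this.symm
  have h5 := I.numImproving_le_card (M := M) hM'
  -- With `x` improving agents: `h2` and `h3` give `2b ≤ |M|`, so `h1` gives `2x + |M| ≤ 2n`; now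
  -- use `x ≤ |O| ≤ |M|`.
  have h6 : 3 * I.numImproving M M' ≤ 2 * Fintype.card N := by omega
  have h7 : 3 * (I.numImproving M M' : ℝ) ≤ 2 * Fintype.card N := by exact_mod_cast h6
  linarith

theorem exists_maximum [Finite O] (p : (N → Option O) → Prop) (M₀ : N → Option O) (h : p M₀) :
    ∃ M, p M ∧ ∀ M', p M' → matchingSize M' ≤ matchingSize M :=
  Set.exists_max_image {M | p M} matchingSize (Set.toFinite _) ⟨M₀, h⟩

theorem exists_isMaximumFirstChoiceMatching [Finite O] :
    ∃ F, I.IsMaximumFirstChoiceMatching F :=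
  exists_maximum I.IsFirstChoiceMatching (fun _ => none)
    (by simp [IsFirstChoiceMatching, IsMatching])

/-- Every matching is contained in one that no acceptable pair can be added to. -/
theorem exists_maximal_extension [Finite O] {F : N → Option O} (hF : I.IsMatching F) :
    ∃ M, I.IsMatching M ∧ (∀ i o, F i = some o → M i = some o) ∧
      ∀ i, ∀ o ∈ I.acc i, M i ≠ none ∨ ∃ j, M j = some o := by
  classical
  -- A matching of maximum size among those containing `F` will do: a free acceptable pair could be
  -- added to it.
  obtain ⟨M, ⟨hM, hext⟩, hmax⟩ := exists_maximum
    (fun M => I.IsMatching M ∧ ∀ i o, F i = some o → M i = some o) F ⟨hF, fun _ _ h => h⟩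
  refine ⟨M, hM, hext, fun i o ho => ?_⟩
  by_contra! hcon
  obtain ⟨hi, hfree⟩ := hcon
  have hval : ∀ j x, Function.update M i (some o) j = some x ↔
      (j = i ∧ o = x) ∨ (j ≠ i ∧ M j = some x) := by
    intro j x
    by_cases hj : j = i <;> simp [hj]
  have := hmax (Function.update M i (some o)) ⟨⟨?_, ?_⟩, ?_⟩
  · refine absurd this (not_le.2 (Finset.card_lt_card (Finset.ssubset_iff_of_subset ?_ |>.2
      ⟨i, by simp, by simp [hi]⟩)))
    intro j hj
    by_cases hji : j = i
    · simp [hji]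
    · simpa [Function.update_apply, hji] using hj
  · intro j x hx
    rcases (hval j x).1 hx with ⟨rfl, rfl⟩ | ⟨-, h⟩
    · exact ho
    · exact hM.1 j x h
  · intro j k x hj hk
    rcases (hval j x).1 hj with ⟨rfl, rfl⟩ | ⟨-, h⟩ <;>
      rcases (hval k _).1 hk with ⟨rfl, h2⟩ | ⟨-, h'⟩
    · rfl
    · exact absurd h' (hfree k)
    · exact absurd h (h2 ▸ hfree j)
    · exact hM.2 j k x h h'
  · intro j x hx
    refine (hval j x).2 (Or.inr ⟨?_, hext j x hx⟩)
    rintro rfl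
    simp [hext j x hx] at hi

/-- If some agent were free, maximality and complete lists would force every object to be taken.
Sending objects to their holders would be an injection into a set that is not larger, hence onto,
and the free agent would hold an object. -/
theorem isCompletionOf_of_maximal [Fintype O] (hc : I.CompleteLists)
    (hcard : Fintype.card N ≤ Fintype.card O) {F M : N → Option O} (hM : I.IsMatching M)
    (hext : ∀ i o, F i = some o → M i = some o)
    (hmax : ∀ i, ∀ o ∈ I.acc i, M i ≠ none ∨ ∃ j, M j = some o) : I.IsCompletionOf M F := by
  classical
  refine ⟨hM, hext, fun i hi => ?_⟩
  have hall : ∀ o, ∃ j, M j = some o := fun o => (hmax i o (hc i o)).resolve_left (· hi)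
  choose g hg using hall
  have hinj : Function.Injective g := fun o o' h => by
    have := hg o
    rw [h, hg o', Option.some_inj] at this
    exact this.symm
  have hs : Function.Surjective g :=
    ((Fintype.bijective_iff_injective_and_card g).2
      ⟨hinj, le_antisymm (Fintype.card_le_of_injective g hinj) hcard⟩).2
  obtain ⟨o, rfl⟩ := hs i
  simp [hg] at hi

/-- There are too few objects for all agents, so some agent is free; it accepts every object, so by
maximality no object is left. -/
theorem saturating_of_maximal [Fintype O] (hc : I.CompleteLists)
    (hcard : Fintype.card O < Fintype.card N) {M : N → Option O} (hM : I.IsMatching M)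
    (hmax : ∀ i, ∀ o ∈ I.acc i, M i ≠ none ∨ ∃ j, M j = some o) (o : O) :
    ∃ i, M i = some o := by
  have : ∃ i, M i = none := by
    by_contra! h
    have hex : ∀ i, ∃ o, M i = some o := fun i => Option.ne_none_iff_exists'.1 (h i)
    choose f hf using hex
    refine absurd (Fintype.card_le_of_injective f fun i j h => ?_) (not_le.2 hcard)
    exact hM.2 i j _ (hf i) (h ▸ hf j)
  obtain ⟨i, hi⟩ := this
  exact (hmax i o (hc i o)).resolve_left (· hi)

/-- The program returns an extension of a maximum first-choice matching. With single ties every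
acceptable pair is a first choice, so the extension is itself such a maximum matching. -/
theorem SingleTie.isMaximumFirstChoiceMatching_of_extension (h : I.SingleTie)
    {F M : N → Option O} (hF : I.IsMaximumFirstChoiceMatching F) (hM : I.IsMatching M)
    (hext : ∀ i o, F i = some o → M i = some o) : I.IsMaximumFirstChoiceMatching M :=
  ⟨⟨hM, fun i o ho => h.isFirstChoice I (hM.1 i o ho)⟩, fun M' hM' =>
    (hF.2 M' hM').trans (by rw [← card_extension hext]; omega)⟩

theorem SingleTie.isMaximumFirstChoiceMatching_iff (h : I.SingleTie) {M : N → Option O} :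
    I.IsMaximumFirstChoiceMatching M ↔ I.IsMaximumMatching M := by
  have : ∀ M, I.IsFirstChoiceMatching M ↔ I.IsMatching M := fun M =>
    ⟨fun h => h.1, fun hM => ⟨hM, fun i o ho => h.isFirstChoice I (hM.1 i o ho)⟩⟩
  simp [IsMaximumFirstChoiceMatching, IsMaximumMatching, this]

end Stability

end HAInstance

/-! ### Structured programs for the random access machine -/

namespace RAMCode

/-- The variables of structured programs. -/
inductive Var
  | n | q | m | zero | one | cap | sq | e | lim | c | p | o | i | g | l | top | fnd
  deriving DecidableEq

/-- The register that holds a variable; registers `3, 4, 5, 6` are kept for address computations. -/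
def Var.reg : Var → ℕ
  | n => 0 | q => 1 | m => 2 | zero => 7 | one => 8 | cap => 9 | sq => 10 | e => 11 | lim => 12
  | c => 13 | p => 14 | o => 15 | i => 16 | g => 17 | l => 18 | top => 19 | fnd => 20

/-- The arrays of structured programs. -/
inductive Arr
  | agt | obj | nxt | hd | ptr | lvl | prc | mate | own | mrk | stk
  deriving DecidableEq

def Arr.idx : Arr → ℕ
  | agt => 0 | obj => 1 | nxt => 2 | hd => 3 | ptr => 4 | lvl => 5 | prc => 6 | mate => 7
  | own => 8 | mrk => 9 | stk => 10

theorem Var.reg_inj {x y : Var} : x.reg = y.reg ↔ x = y := by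
  cases x <;> cases y <;> simp [Var.reg]

theorem Var.reg_ne (x : Var) : x.reg ≠ 3 ∧ x.reg ≠ 4 ∧ x.reg ≠ 5 ∧ x.reg ≠ 6 := by
  cases x <;> simp [Var.reg]

theorem Arr.idx_inj {x y : Arr} : x.idx = y.idx ↔ x = y := by
  cases x <;> cases y <;> simp [Arr.idx]

theorem Arr.idx_lt (x : Arr) : x.idx < 16 := by
  cases x <;> simp [Arr.idx]

/-- Structured programs. -/
inductive Cmd
  /-- `r := c` -/
  | const (r : Var) (c : ℕ)
  /-- `r := s + t` -/
  | add (r s t : Var)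
  /-- `r := s - t` -/
  | sub (r s t : Var)
  /-- `r := k[s]` -/
  | load (r : Var) (k : Arr) (s : Var)
  /-- `k[r] := s` -/
  | store (k : Arr) (r s : Var)
  /-- `r` becomes entry `col` of the input triple number `s` -/
  | inp (r : Var) (col : Fin 3) (s : Var)
  /-- output cell number `r` becomes `s` -/
  | out (r s : Var)
  | seq (a b : Cmd)
  /-- if `s < t` then `a` else `b` -/
  | ite (s t : Var) (a b : Cmd)
  /-- while `s < t` do `a` -/
  | loop (s t : Var) (a : Cmd)

instance : Append Cmd := ⟨Cmd.seq⟩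

/-- States of structured programs. -/
structure St where
  v : Var → ℕ
  a : Arr → ℕ → ℕ
  out : ℕ → ℕ

namespace St

def setV (s : St) (r : Var) (x : ℕ) : St := { s with v := Function.update s.v r x }

def setA (s : St) (k : Arr) (j x : ℕ) : St :=
  { s with a := Function.update s.a k (Function.update (s.a k) j x) }

def setOut (s : St) (j x : ℕ) : St := { s with out := Function.update s.out j x }

variable (s : St) (r r' : Var) (k k' : Arr) (j x : ℕ)

theorem setV_v : (s.setV r x).v r' = if r' = r then x else s.v r' := by
  simp [setV, Function.update_apply]
theorem setV_a : (s.setV r x).a k = s.a k := rfl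
theorem setV_out : (s.setV r x).out = s.out := rfl
theorem setA_v : (s.setA k j x).v r = s.v r := rfl
theorem setA_a : (s.setA k j x).a k' = if k' = k then Function.update (s.a k) j x else s.a k' := by
  unfold setA
  by_cases h : k' = k
  · subst h; simp
  · simp [h]
theorem setA_out : (s.setA k j x).out = s.out := rfl
theorem setOut_v : (s.setOut j x).v r = s.v r := rfl
theorem setOut_a : (s.setOut j x).a k = s.a k := rfl
theorem setOut_out : (s.setOut j x).out = Function.update s.out j x := rfl

end St

/-- The data that a run depends on: the sizes `n` and `m`, the input triples, and a bound for the
numbers that occur. -/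
structure Env where
  n : ℕ
  m : ℕ
  B : ℕ
  inp : Fin 3 → ℕ → ℕ
  sixteen_le : 16 ≤ B
  base_le : 3 * m + n ≤ 4 * B
  inp_le : ∀ col j, j < m → inp col j ≤ B

/-- `Runs E a s s' t`: started in `s`, the program `a` ends in `s'` after `t` steps, and no number
that is computed exceeds the bound. -/
inductive Runs (E : Env) : Cmd → St → St → ℕ → Prop
  | const (r c s) : c ≤ E.B → Runs E (.const r c) s (s.setV r c) 1
  | add (r x y s) : s.v x + s.v y ≤ E.B → Runs E (.add r x y) s (s.setV r (s.v x + s.v y)) 1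
  | sub (r x y s) : Runs E (.sub r x y) s (s.setV r (s.v x - s.v y)) 1
  | load (r k x s) : Runs E (.load r k x) s (s.setV r (s.a k (s.v x))) 1
  | store (k r x s) : Runs E (.store k r x) s (s.setA k (s.v r) (s.v x)) 1
  | inp (r col x s) : s.v x < E.m → Runs E (.inp r col x) s (s.setV r (E.inp col (s.v x))) 1
  | out (r x s) : s.v r < E.n → Runs E (.out r x) s (s.setOut (s.v r) (s.v x)) 1
  | seq {a b s s' s'' t t'} : Runs E a s s' t → Runs E b s' s'' t' →
      Runs E (.seq a b) s s'' (t + t')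
  | ite_true {x y a b s s' t} : s.v x < s.v y → Runs E a s s' t → Runs E (.ite x y a b) s s' (t + 1)
  | ite_false {x y a b s s' t} : ¬ s.v x < s.v y → Runs E b s s' t →
      Runs E (.ite x y a b) s s' (t + 1)
  | loop_false {x y a s} : ¬ s.v x < s.v y → Runs E (.loop x y a) s s 1
  | loop_true {x y a s s' s'' t t'} : s.v x < s.v y → Runs E a s s' t →
      Runs E (.loop x y a) s' s'' t' → Runs E (.loop x y a) s s'' (t + t' + 1)

/-- The weakest precondition for termination in a state and after a time that satisfy `Q`. -/
def wp (E : Env) (a : Cmd) (Q : St → ℕ → Prop) (s : St) : Prop :=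
  ∃ s' t, Runs E a s s' t ∧ Q s' t

section wp

variable {E : Env} {Q : St → ℕ → Prop} {s : St}

/-- The rules are equivalences, so that `simp` can reduce the precondition of a loop-free command to
a statement about explicitly updated states. -/
theorem wp_const {r c} : wp E (.const r c) Q s ↔ c ≤ E.B ∧ Q (s.setV r c) 1 :=
  ⟨fun ⟨_, _, h, hQ⟩ => by cases h; exact ⟨‹_›, hQ⟩, fun h => ⟨_, _, .const _ _ _ h.1, h.2⟩⟩

theorem wp_add {r x y} :
    wp E (.add r x y) Q s ↔ s.v x + s.v y ≤ E.B ∧ Q (s.setV r (s.v x + s.v y)) 1 :=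
  ⟨fun ⟨_, _, h, hQ⟩ => by cases h; exact ⟨‹_›, hQ⟩, fun h => ⟨_, _, .add _ _ _ _ h.1, h.2⟩⟩

theorem wp_sub {r x y} : wp E (.sub r x y) Q s ↔ Q (s.setV r (s.v x - s.v y)) 1 :=
  ⟨fun ⟨_, _, h, hQ⟩ => by cases h; exact hQ, fun h => ⟨_, _, .sub _ _ _ _, h⟩⟩

theorem wp_load {r k x} : wp E (.load r k x) Q s ↔ Q (s.setV r (s.a k (s.v x))) 1 :=
  ⟨fun ⟨_, _, h, hQ⟩ => by cases h; exact hQ, fun h => ⟨_, _, .load _ _ _ _, h⟩⟩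

theorem wp_store {k r x} : wp E (.store k r x) Q s ↔ Q (s.setA k (s.v r) (s.v x)) 1 :=
  ⟨fun ⟨_, _, h, hQ⟩ => by cases h; exact hQ, fun h => ⟨_, _, .store _ _ _ _, h⟩⟩

theorem wp_inp {r col x} :
    wp E (.inp r col x) Q s ↔ s.v x < E.m ∧ Q (s.setV r (E.inp col (s.v x))) 1 :=
  ⟨fun ⟨_, _, h, hQ⟩ => by cases h; exact ⟨‹_›, hQ⟩, fun h => ⟨_, _, .inp _ _ _ _ h.1, h.2⟩⟩

theorem wp_out {r x} :
    wp E (.out r x) Q s ↔ s.v r < E.n ∧ Q (s.setOut (s.v r) (s.v x)) 1 :=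
  ⟨fun ⟨_, _, h, hQ⟩ => by cases h; exact ⟨‹_›, hQ⟩, fun h => ⟨_, _, .out _ _ _ h.1, h.2⟩⟩

theorem wp_seq {a b} :
    wp E (a ++ b) Q s ↔ wp E a (fun s' t => wp E b (fun s'' t' => Q s'' (t + t')) s') s :=
  ⟨fun ⟨_, _, (h : Runs E (.seq a b) _ _ _), hQ⟩ => by
    cases h with | seq h h' => exact ⟨_, _, h, _, _, h', hQ⟩,
    fun ⟨_, _, h, _, _, h', hQ⟩ => ⟨_, _, .seq h h', hQ⟩⟩

theorem wp_ite {x y a b} : wp E (.ite x y a b) Q s ↔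
    if s.v x < s.v y then wp E a (fun s' t => Q s' (t + 1)) s
    else wp E b (fun s' t => Q s' (t + 1)) s := by
  split_ifs with hc
  · exact ⟨fun ⟨_, _, h, hQ⟩ => by
      cases h with
      | ite_true _ h => exact ⟨_, _, h, hQ⟩
      | ite_false h' _ => exact absurd hc h', fun ⟨_, _, h, hQ⟩ => ⟨_, _, .ite_true hc h, hQ⟩⟩
  · exact ⟨fun ⟨_, _, h, hQ⟩ => by
      cases h with
      | ite_true h' _ => exact absurd h' hc
      | ite_false _ h => exact ⟨_, _, h, hQ⟩, fun ⟨_, _, h, hQ⟩ => ⟨_, _, .ite_false hc h, hQ⟩⟩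

theorem wp_mono {a} {Q' : St → ℕ → Prop} (h : wp E a Q s) (hQ : ∀ s' t, Q s' t → Q' s' t) :
    wp E a Q' s := by
  obtain ⟨s', t, hr, hq⟩ := h
  exact ⟨s', t, hr, hQ _ _ hq⟩

/-- The rule for loops, with an invariant `I` and a potential `Φ` that pays for the steps. -/
theorem wp_loop {x y a} (I : St → Prop) (Φ : St → ℕ) (hs : I s)
    (hbody : ∀ s, I s → s.v x < s.v y → wp E a (fun s' t => I s' ∧ t + 1 + Φ s' ≤ Φ s) s)
    (hQ : ∀ s' t, I s' → ¬ s'.v x < s'.v y → t + Φ s' ≤ Φ s + 1 → Q s' t) :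
    wp E (.loop x y a) Q s := by
  -- Induction on a bound for the potential, which drops by at least one in each round. The extra
  -- `1` in the total pays for the last, failing test.
  suffices h : ∀ N s, Φ s ≤ N → I s →
      wp E (.loop x y a) (fun s' t => I s' ∧ ¬ s'.v x < s'.v y ∧ t + Φ s' ≤ Φ s + 1) s from
    wp_mono (h _ s le_rfl hs) fun s' t h => hQ s' t h.1 h.2.1 h.2.2
  intro N
  induction N with
  | zero =>
    intro s hN hI
    by_cases hc : s.v x < s.v y
    · obtain ⟨_, _, -, -, h⟩ := hbody s hI hc
      omega
    · exact ⟨s, 1, .loop_false hc, hI, hc, by omega⟩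
  | succ N ih =>
    intro s hN hI
    by_cases hc : s.v x < s.v y
    · obtain ⟨s₁, t₁, h₁, hI₁, hΦ⟩ := hbody s hI hc
      obtain ⟨s₂, t₂, h₂, hI₂, hc₂, hΦ₂⟩ := ih s₁ (by omega) hI₁
      exact ⟨s₂, _, .loop_true hc h₁ h₂, hI₂, hc₂, by omega⟩
    · exact ⟨s, 1, .loop_false hc, hI, hc, by omega⟩

end wp

/-! ### Compilation -/

open RAMInstr RAMConfig

/-- Code that computes the address of the cell `s` of the array `k` into register `3`. -/
def addrCode (k : Arr) (s : Var) : RAMProgram :=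
  -- The arrays are interleaved with stride 16, so no array needs a length. Four doublings multiply
  -- the index by 16; register `5` holds the base `3m + n`.
  [add 3 s.reg s.reg, add 3 3 3, add 3 3 3, add 3 3 3, const 4 k.idx, add 3 3 4, add 3 3 5]

/-- The machine code of a structured program that is placed at position `k`. -/
def compile : ℕ → Cmd → RAMProgram
  | _, .const r c => [const r.reg c]
  | _, .add r x y => [add r.reg x.reg y.reg]
  | _, .sub r x y => [sub r.reg x.reg y.reg]
  | _, .load r k x => addrCode k x ++ [load r.reg 3]
  | _, .store k r x => addrCode k r ++ [store 3 x.reg]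
  | _, .inp r col x =>
      [add 3 x.reg x.reg, add 3 3 x.reg, const 4 col, add 3 3 4, load r.reg 3]
  | _, .out r x => [add 3 6 r.reg, store 3 x.reg]
  | k, .seq a b => compile k a ++ compile (k + (compile k a).length) b
  -- The code of `b` directly follows the test and ends with a jump over the code of `a`; the offset
  -- 2 accounts for the test and this jump.
  | k, .ite x y a b =>
      let cb := compile (k + 1) b
      let ca := compile (k + 2 + cb.length) a
      jumpLt x.reg y.reg (k + 2 + cb.length) :: (cb ++ jump (k + 2 + cb.length + ca.length) :: ca)
  -- A failing test falls through to the exit jump; the body starts behind it and ends with a jump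
  -- back to the test.
  | k, .loop x y a =>
      let ca := compile (k + 2) a
      jumpLt x.reg y.reg (k + 2) :: jump (k + 3 + ca.length) :: (ca ++ [jump k])

/-- The program `P` contains the code `l` at position `k`. -/
def CodeAt (P : RAMProgram) (k : ℕ) (l : RAMProgram) : Prop :=
  ∀ j ins, l[j]? = some ins → P[k + j]? = some ins

theorem CodeAt.cons {P k x l} (h : CodeAt P k (x :: l)) :
    P[k]? = some x ∧ CodeAt P (k + 1) l :=
  ⟨h 0 x rfl, fun j ins hj => by
    have := h (j + 1) ins (by simpa using hj)
    rwa [show k + 1 + j = k + (j + 1) by omega]⟩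

theorem CodeAt.append {P k l l'} (h : CodeAt P k (l ++ l')) :
    CodeAt P k l ∧ CodeAt P (k + l.length) l' := by
  refine ⟨fun j ins hj => h j ins ?_, fun j ins hj => ?_⟩
  · rw [List.getElem?_append_left (List.getElem?_eq_some_iff.1 hj).1]
    exact hj
  · rw [add_assoc]
    refine h _ ins ?_
    rw [List.getElem?_append_right (by omega)]
    simpa using hj

/-- `c'` is reached from `c` in `t` steps through configurations bounded by `b`. -/
def Reach (P : RAMProgram) (b : ℕ) (c : RAMConfig) (t : ℕ) (c' : RAMConfig) : Prop :=
  (step P)^[t] c = c' ∧ ∀ s ≤ t, BoundedBy b ((step P)^[s] c)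

section Reach

variable {P : RAMProgram} {b : ℕ} {c c' c'' : RAMConfig} {t t' : ℕ}

theorem Reach.refl (h : BoundedBy b c) : Reach P b c 0 c :=
  ⟨rfl, fun s hs => by obtain rfl : s = 0 := by omega
                       exact h⟩

theorem Reach.trans (h : Reach P b c t c') (h' : Reach P b c' t' c'') :
    Reach P b c (t + t') c'' := by
  refine ⟨by rw [add_comm, Function.iterate_add_apply, h.1, h'.1], fun s hs => ?_⟩
  rcases le_total s t with hst | hst
  · exact h.2 s hst
  · obtain ⟨d, rfl⟩ := Nat.exists_eq_add_of_le hst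
    rw [add_comm, Function.iterate_add_apply, h.1]
    exact h'.2 d (by omega)

theorem Reach.bounded (h : Reach P b c t c') : BoundedBy b c' := h.1 ▸ h.2 t le_rfl

theorem Reach.step {ins} (h : BoundedBy b c) (hP : P[c.pc]? = some ins)
    (hb : BoundedBy b (c.exec ins)) : Reach P b c 1 (c.exec ins) := by
  have hs : RAMConfig.step P c = c.exec ins := by simp [RAMConfig.step, hP]
  refine ⟨hs, fun s hs' => ?_⟩
  rcases (by omega : s = 0 ∨ s = 1) with rfl | rfl
  · exact h
  · rw [Function.iterate_one, hs]
    exact hb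

/-- The code contains no jumps and computes no number above `b`. -/
def Safe (b : ℕ) : RAMProgram → RAMConfig → Prop
  | [], _ => True
  | ins :: l, c => (match ins with
      | const _ v => v ≤ b
      | add _ s t => c.reg s + c.reg t ≤ b
      | jump _ => False
      | jumpLt _ _ _ => False
      | _ => True) ∧ Safe b l (c.exec ins)

theorem boundedBy_reg (h : BoundedBy b c) {r x pc : ℕ} (hx : x ≤ b) :
    BoundedBy b ⟨pc, Function.update c.reg r x, c.mem⟩ := by
  refine ⟨fun r' => ?_, h.2⟩
  by_cases hr : r' = r
  · subst hr; simpa using hx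
  · simpa [hr] using h.1 r'

theorem Reach.of_safe : ∀ (l : RAMProgram) (c : RAMConfig), BoundedBy b c → Safe b l c →
    CodeAt P c.pc l → Reach P b c l.length (l.foldl exec c)
  | [], _, h, _, _ => Reach.refl h
  | ins :: l, c, h, hs, hP => by
    have key : BoundedBy b (c.exec ins) ∧ (c.exec ins).pc = c.pc + 1 := by
      cases ins with
      | const r v => exact ⟨boundedBy_reg h hs.1, rfl⟩
      | add r s t => exact ⟨boundedBy_reg h hs.1, rfl⟩
      | sub r s t => exact ⟨boundedBy_reg h ((Nat.sub_le _ _).trans (h.1 _)), rfl⟩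
      | load r s => exact ⟨boundedBy_reg h (h.2 _), rfl⟩
      | store r s =>
        refine ⟨⟨h.1, fun a => ?_⟩, rfl⟩
        by_cases ha : a = c.reg r
        · simpa [RAMConfig.exec, ha] using h.1 s
        · simpa [RAMConfig.exec, ha] using h.2 a
      | jump _ => exact hs.1.elim
      | jumpLt _ _ _ => exact hs.1.elim
    rw [List.length_cons, add_comm, List.foldl_cons]
    refine (Reach.step h hP.cons.1 key.1).trans (Reach.of_safe l _ key.1 hs.2 ?_)
    rw [key.2]
    exact hP.cons.2

end Reach

/-! ### Simulation of structured programs by machine code -/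

/-- The machine configuration `c` represents the state `s`. -/
structure Sim (E : Env) (s : St) (c : RAMConfig) : Prop where
  reg : ∀ x : Var, c.reg x.reg = s.v x
  base : c.reg 5 = 3 * E.m + E.n
  base' : c.reg 6 = 3 * E.m
  inp : ∀ (col : Fin 3) (j), j < E.m → c.mem (3 * j + col) = E.inp col j
  out : ∀ i < E.n, c.mem (3 * E.m + i) = s.out i
  arr : ∀ (k : Arr) (i), c.mem (3 * E.m + E.n + 16 * i + k.idx) = s.a k i
  le_v : ∀ x, s.v x ≤ E.B
  le_a : ∀ k i, s.a k i ≤ E.B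

/-- Registers `3` and `4` are scratch space for addresses, so nothing is required of them. -/
theorem Sim.setV {E : Env} {s : St} {c : RAMConfig} (h : Sim E s c) {r : Var} {x : ℕ}
    (hx : x ≤ E.B) {c' : RAMConfig} (hm : c'.mem = c.mem)
    (hr : ∀ j, j ≠ 3 → j ≠ 4 → c'.reg j = Function.update c.reg r.reg x j) :
    Sim E (s.setV r x) c' where
  reg y := by
    rw [hr _ y.reg_ne.1 y.reg_ne.2.1, St.setV_v, Function.update_apply, h.reg]
    simp only [Var.reg_inj]
  base := by rw [hr _ (by simp) (by simp), Function.update_of_ne r.reg_ne.2.2.1.symm, h.base]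
  base' := by rw [hr _ (by simp) (by simp), Function.update_of_ne r.reg_ne.2.2.2.symm, h.base']
  inp := by rw [hm]; exact h.inp
  out := by rw [hm]; exact h.out
  arr := by rw [hm]; exact h.arr
  le_v y := by
    rw [St.setV_v]
    split_ifs
    · exact hx
    · exact h.le_v y
  le_a := h.le_a

theorem Sim.of_reg {E : Env} {s : St} {c c' : RAMConfig} (h : Sim E s c)
    (hm : c'.mem = c.mem) (hr : c'.reg = c.reg) : Sim E s c' :=
  ⟨by rw [hr]; exact h.reg, by rw [hr]; exact h.base, by rw [hr]; exact h.base',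
    by rw [hm]; exact h.inp, by rw [hm]; exact h.out, by rw [hm]; exact h.arr, h.le_v, h.le_a⟩

theorem Sim.setA {E : Env} {s : St} {c : RAMConfig} (h : Sim E s c) {k : Arr} {j : ℕ} {x : Var}
    {c' : RAMConfig}
    (hm : c'.mem = Function.update c.mem (3 * E.m + E.n + 16 * j + k.idx) (s.v x))
    (hr : ∀ j, j ≠ 3 → j ≠ 4 → c'.reg j = c.reg j) :
    Sim E (s.setA k j (s.v x)) c' where
  reg y := by rw [hr _ y.reg_ne.1 y.reg_ne.2.1, St.setA_v, h.reg]
  base := by rw [hr _ (by simp) (by simp), h.base]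
  base' := by rw [hr _ (by simp) (by simp), h.base']
  inp col i hi := by
    have := col.isLt
    rw [hm, Function.update_of_ne (by omega), h.inp col i hi]
  out i hi := by rw [hm, Function.update_of_ne (by omega), h.out i hi]; rfl
  arr k' i := by
    have h1 := k.idx_lt
    have h2 := k'.idx_lt
    rw [hm, Function.update_apply, St.setA_a, h.arr]
    by_cases hk : k' = k
    · subst hk
      rw [if_pos rfl, Function.update_apply]
      congr 1
      exact propext ⟨fun _ => by omega, fun h => by rw [h]⟩
    · rw [if_neg hk, if_neg]
      intro h'
      exact hk (Arr.idx_inj.1 (by omega))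
  le_v := h.le_v
  le_a k' i := by
    rw [St.setA_a]
    split_ifs
    · rw [Function.update_apply]
      split_ifs
      · exact h.le_v x
      · exact h.le_a _ _
    · exact h.le_a _ _

theorem Sim.setOut {E : Env} {s : St} {c : RAMConfig} (h : Sim E s c) {j : ℕ} (hj : j < E.n)
    {x : ℕ} {c' : RAMConfig} (hm : c'.mem = Function.update c.mem (3 * E.m + j) x)
    (hr : ∀ j, j ≠ 3 → j ≠ 4 → c'.reg j = c.reg j) :
    Sim E (s.setOut j x) c' where
  reg y := by rw [hr _ y.reg_ne.1 y.reg_ne.2.1, St.setOut_v, h.reg]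
  base := by rw [hr _ (by simp) (by simp), h.base]
  base' := by rw [hr _ (by simp) (by simp), h.base']
  inp col i hi := by
    have := col.isLt
    rw [hm, Function.update_of_ne (by omega), h.inp col i hi]
  out i hi := by
    rw [hm, St.setOut_out, Function.update_apply, Function.update_apply, h.out i hi]
    congr 1
    exact propext ⟨fun _ => by omega, fun h => by rw [h]⟩
  arr k' i := by rw [hm, Function.update_of_ne (by omega), h.arr]; rfl
  le_v := h.le_v
  le_a := h.le_a

/-- An address is at most `4B + 16B + 15`, which explains the bound `32B` for the machine when
variables and arrays are bounded by `B`. -/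
theorem addrCode_spec {E : Env} {s : St} {c : RAMConfig} (h : Sim E s c) (k : Arr) (x : Var) :
    Safe (32 * E.B) (addrCode k x) c ∧
      ((addrCode k x).foldl exec c).reg 3 = 3 * E.m + E.n + 16 * s.v x + k.idx ∧
      ((addrCode k x).foldl exec c).mem = c.mem ∧
      ∀ j, j ≠ 3 → j ≠ 4 → ((addrCode k x).foldl exec c).reg j = c.reg j := by
  have h1 := k.idx_lt
  have h2 := h.le_v x
  have h3 := E.sixteen_le
  have h4 := E.base_le
  have h5 := x.reg_ne
  refine ⟨?_, ?_, rfl, ?_⟩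
  · simp [addrCode, Safe, RAMConfig.exec, h.reg, h.base]
    omega
  · simp [addrCode, RAMConfig.exec, h.reg, h.base]
    omega
  · intro j hj hj'
    simp [addrCode, RAMConfig.exec, hj, hj']

theorem Safe.append {b : ℕ} : ∀ {l l' : RAMProgram} {c : RAMConfig}, Safe b l c →
    Safe b l' (l.foldl exec c) → Safe b (l ++ l') c
  | [], _, _, _, h' => h'
  | _ :: _, _, _, h, h' => ⟨h.1, Safe.append h.2 h'⟩

theorem pc_foldl_exec {b : ℕ} : ∀ {l : RAMProgram} {c : RAMConfig}, Safe b l c →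
    (l.foldl exec c).pc = c.pc + l.length
  | [], _, _ => rfl
  | ins :: l, c, h => by
    rw [List.foldl_cons, pc_foldl_exec h.2, List.length_cons]
    cases ins with
    | jump _ => exact h.1.elim
    | jumpLt _ _ _ => exact h.1.elim
    | _ => simp only [RAMConfig.exec]; omega

/-- Straight code simulates an instruction. -/
theorem Reach.simulate {E : Env} {P : RAMProgram} {s' : St} {l : RAMProgram} {c : RAMConfig}
    (hb : BoundedBy (32 * E.B) c) (hs : Safe (32 * E.B) l c) (hP : CodeAt P c.pc l)
    (hl : l.length ≤ 10) (h' : Sim E s' (l.foldl exec c)) :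
    ∃ t' c', t' ≤ 10 * 1 ∧ Reach P (32 * E.B) c t' c' ∧ Sim E s' c' ∧
      c'.pc = c.pc + l.length :=
  ⟨_, _, by omega, Reach.of_safe l c hb hs hP, h', pc_foldl_exec hs⟩

/-- By induction on the run, not on the program. The factor ten is generous: the longest instruction
is an array access, with seven instructions for the address and one for the access, and a test or a
round of a loop adds at most two jumps. -/
theorem simulation {E : Env} {P : RAMProgram} {a : Cmd} {s s' : St} {t : ℕ}
    (h : Runs E a s s' t) : ∀ c : RAMConfig, Sim E s c → BoundedBy (32 * E.B) c →
      CodeAt P c.pc (compile c.pc a) →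
      ∃ t' c', t' ≤ 10 * t ∧ Reach P (32 * E.B) c t' c' ∧ Sim E s' c' ∧
        c'.pc = c.pc + (compile c.pc a).length := by
  have hB := E.sixteen_le
  have hD := E.base_le
  induction h with
  | const r v s hv =>
    intro c hS hb hP
    refine Reach.simulate hb ?_ hP (by simp [compile]) (hS.setV hv rfl fun j _ _ => rfl)
    exact ⟨by simp only; omega, trivial⟩
  | add r x y s hv =>
    intro c hS hb hP
    refine Reach.simulate hb ?_ hP (by simp [compile]) (hS.setV hv rfl fun j _ _ => ?_)
    · refine ⟨?_, trivial⟩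
      simp only [hS.reg]
      omega
    · simp [compile, RAMConfig.exec, hS.reg]
  | sub r x y s =>
    intro c hS hb hP
    refine Reach.simulate hb ⟨trivial, trivial⟩ hP (by simp [compile])
      (hS.setV ((Nat.sub_le _ _).trans (hS.le_v x)) rfl fun j _ _ => ?_)
    simp [compile, RAMConfig.exec, hS.reg]
  | load r k x s =>
    intro c hS hb hP
    obtain ⟨h1, h2, h3, h4⟩ := addrCode_spec hS k x
    refine Reach.simulate hb (h1.append ⟨trivial, trivial⟩) hP (by simp [compile, addrCode])
      (hS.setV (hS.le_a k _) ?_ fun j hj hj' => ?_)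
    · simpa [compile, RAMConfig.exec] using h3
    · simp only [compile, List.foldl_append, List.foldl_cons, List.foldl_nil, RAMConfig.exec]
      rw [h2, h3, hS.arr]
      by_cases hr : j = r.reg
      · simp [hr]
      · simp [hr, h4 j hj hj']
  | store k r x s =>
    intro c hS hb hP
    obtain ⟨h1, h2, h3, h4⟩ := addrCode_spec hS k r
    refine Reach.simulate hb (h1.append ⟨trivial, trivial⟩) hP (by simp [compile, addrCode])
      (hS.setA ?_ fun j hj hj' => ?_)
    · simp only [compile, List.foldl_append, List.foldl_cons, List.foldl_nil, RAMConfig.exec]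
      rw [h2, h3, h4 _ x.reg_ne.1 x.reg_ne.2.1, hS.reg]
    · simpa [compile, RAMConfig.exec] using h4 j hj hj'
  | inp r col x s hx =>
    intro c hS hb hP
    have h1 := hS.le_v x
    have h2 := col.isLt
    have h3 := x.reg_ne
    refine Reach.simulate hb ?_ hP (by simp [compile])
      (hS.setV (E.inp_le col _ hx) ?_ fun j hj hj' => ?_)
    · simp [compile, Safe, RAMConfig.exec, hS.reg, h3]
      omega
    · simp [compile, RAMConfig.exec]
    · rw [← hS.inp col _ hx, show 3 * s.v x + (col : ℕ) = s.v x + s.v x + s.v x + col by ring]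
      simp [compile, RAMConfig.exec, Function.update_apply, hS.reg, hj, hj', h3]
  | out r x s hr =>
    intro c hS hb hP
    have h1 := hS.le_v r
    have h3 := x.reg_ne
    refine Reach.simulate hb ?_ hP (by simp [compile])
      (hS.setOut hr ?_ fun j hj hj' => ?_)
    · simp [compile, Safe, hS.reg, hS.base']
      omega
    · simp [compile, RAMConfig.exec, hS.reg, hS.base', h3]
    · simp [compile, RAMConfig.exec, hj]
  | seq _ _ ih₁ ih₂ =>
    intro c hS hb hP
    obtain ⟨hP₁, hP₂⟩ := CodeAt.append hP
    obtain ⟨t₁, c₁, ht₁, hR₁, hS₁, hpc₁⟩ := ih₁ c hS hb hP₁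
    obtain ⟨t₂, c₂, ht₂, hR₂, hS₂, hpc₂⟩ := ih₂ c₁ hS₁ hR₁.bounded (by rw [hpc₁]; exact hP₂)
    refine ⟨_, c₂, ?_, hR₁.trans hR₂, hS₂, ?_⟩
    · omega
    · rw [hpc₂, hpc₁, compile, List.length_append]; omega
  | @ite_true x y a b s s' t hc _ ih =>
    intro c hS hb hP
    simp only [compile] at hP ⊢
    obtain ⟨hj, hP⟩ := hP.cons
    obtain ⟨-, hP⟩ := hP.append
    obtain ⟨-, hP⟩ := hP.cons
    have h1 := Reach.step (b := 32 * E.B) hb hj ⟨hb.1, hb.2⟩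
    have hpc : (c.exec (jumpLt x.reg y.reg (c.pc + 2 + (compile (c.pc + 1) b).length))).pc =
        c.pc + 2 + (compile (c.pc + 1) b).length := by
      simp [RAMConfig.exec, hS.reg, hc]
    obtain ⟨t₂, c₂, ht₂, hR₂, hS₂, hpc₂⟩ := ih
      (c.exec (jumpLt x.reg y.reg (c.pc + 2 + (compile (c.pc + 1) b).length)))
      (hS.of_reg rfl rfl) h1.bounded
      (by rw [hpc]; convert hP using 1; omega)
    refine ⟨_, c₂, ?_, h1.trans hR₂, hS₂, ?_⟩
    · omega
    · rw [hpc₂, hpc]; simp; omega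
  | @ite_false x y a b s s' t hc _ ih =>
    intro c hS hb hP
    simp only [compile] at hP ⊢
    obtain ⟨hj, hP⟩ := hP.cons
    obtain ⟨hP, hP'⟩ := hP.append
    obtain ⟨hj', -⟩ := hP'.cons
    have h1 := Reach.step (b := 32 * E.B) hb hj ⟨hb.1, hb.2⟩
    have hpc : (c.exec (jumpLt x.reg y.reg (c.pc + 2 + (compile (c.pc + 1) b).length))).pc =
        c.pc + 1 := by
      simp only [RAMConfig.exec, hS.reg, if_neg hc]
    obtain ⟨t₂, c₂, ht₂, hR₂, hS₂, hpc₂⟩ := ih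
      (c.exec (jumpLt x.reg y.reg (c.pc + 2 + (compile (c.pc + 1) b).length)))
      (hS.of_reg rfl rfl) h1.bounded
      (by rw [hpc]; exact hP)
    rw [hpc] at hpc₂
    rw [← hpc₂] at hj'
    have h3 := Reach.step hR₂.bounded hj' ⟨hR₂.bounded.1, hR₂.bounded.2⟩
    refine ⟨_, _, ?_, (h1.trans hR₂).trans h3, hS₂.of_reg rfl rfl, ?_⟩
    · omega
    · simp only [RAMConfig.exec, List.length_cons, List.length_append]; omega
  | @loop_false x y a s hc =>
    intro c hS hb hP
    simp only [compile] at hP ⊢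
    obtain ⟨hj, hP⟩ := hP.cons
    obtain ⟨hj', -⟩ := hP.cons
    have h1 := Reach.step (b := 32 * E.B) hb hj ⟨hb.1, hb.2⟩
    have hpc : (c.exec (jumpLt x.reg y.reg (c.pc + 2))).pc = c.pc + 1 := by
      simp only [RAMConfig.exec, hS.reg, if_neg hc]
    rw [← hpc] at hj'
    have h3 := Reach.step h1.bounded hj' ⟨hb.1, hb.2⟩
    refine ⟨_, _, ?_, h1.trans h3, (hS.of_reg rfl rfl).of_reg rfl rfl, ?_⟩
    · omega
    · simp only [RAMConfig.exec, List.length_cons, List.length_append, List.length_nil]; omega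
  | @loop_true x y a s s' s'' t t' hc _ _ ih₁ ih₂ =>
    intro c hS hb hP₀
    have hP := hP₀
    simp only [compile] at hP
    obtain ⟨hj, hP⟩ := hP.cons
    obtain ⟨-, hP⟩ := hP.cons
    obtain ⟨hP, hP'⟩ := hP.append
    obtain ⟨hj', -⟩ := hP'.cons
    have h1 := Reach.step (b := 32 * E.B) hb hj ⟨hb.1, hb.2⟩
    have hpc : (c.exec (jumpLt x.reg y.reg (c.pc + 2))).pc = c.pc + 2 := by
      simp only [RAMConfig.exec, hS.reg, if_pos hc]
    obtain ⟨t₂, c₂, ht₂, hR₂, hS₂, hpc₂⟩ := ih₁ (c.exec (jumpLt x.reg y.reg (c.pc + 2)))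
      (hS.of_reg rfl rfl) h1.bounded
      (by rw [hpc]; exact hP)
    rw [hpc] at hpc₂
    have hj'' : P[c₂.pc]? = some (jump c.pc) := by rw [hpc₂]; exact hj'
    have h3 := Reach.step hR₂.bounded hj'' ⟨hR₂.bounded.1, hR₂.bounded.2⟩
    -- The jump leads back to the start of the same loop code, so the remaining rounds run on `hP₀`.
    obtain ⟨t₄, c₄, ht₄, hR₄, hS₄, hpc₄⟩ := ih₂ (c₂.exec (jump c.pc)) (hS₂.of_reg rfl rfl)
      h3.bounded hP₀
    refine ⟨_, c₄, ?_, ((h1.trans hR₂).trans h3).trans hR₄, hS₄, ?_⟩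
    · omega
    · exact hpc₄

end RAMCode

/-! ### Matchings given by arrays -/

namespace RAMCode

/-- The arrays `mate` and `own` hold a matching of agents to objects along `adj`, where `0` stands
for being unmatched. -/
structure Matched (adj : ℕ → ℕ → Prop) (mate own : ℕ → ℕ) : Prop where
  adj_mate : ∀ c, mate c ≠ 0 → adj c (mate c)
  own_mate : ∀ c, mate c ≠ 0 → own (mate c) = c
  mate_own : ∀ o, own o ≠ 0 → mate (own o) = o
  mate_zero : mate 0 = 0
  own_zero : own 0 = 0

/-- The mates after the unmatched agent `c` has taken the object `o`. -/
def takeMate (mate own : ℕ → ℕ) (c o : ℕ) : ℕ → ℕ :=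
  Function.update (Function.update mate c o) (own o) 0

namespace Matched

variable {adj : ℕ → ℕ → Prop} {mate own : ℕ → ℕ} {c o : ℕ}

theorem own_ne (h : Matched adj mate own) (hc : c ≠ 0) (hm : mate c = 0) (ho : o ≠ 0) :
    own o ≠ c := by
  rintro rfl
  exact ho ((h.mate_own o hc).symm.trans hm)

theorem takeMate_self (h : Matched adj mate own) (hc : c ≠ 0) (hm : mate c = 0) (ho : o ≠ 0) :
    takeMate mate own c o c = o := by
  simp [takeMate, Function.update_of_ne (h.own_ne hc hm ho).symm]

theorem takeMate_own : takeMate mate own c o (own o) = 0 := by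
  simp [takeMate]

theorem takeMate_of_ne {x : ℕ} (hx : x ≠ c) (hx' : x ≠ own o) :
    takeMate mate own c o x = mate x := by
  simp [takeMate, hx, hx']

theorem takeMate_eq_zero (h : Matched adj mate own) (hc : c ≠ 0) (hm : mate c = 0) (ho : o ≠ 0)
    {x : ℕ} (hx : takeMate mate own c o x = 0) : x = own o ∨ (x ≠ c ∧ mate x = 0) := by
  by_cases h1 : x = own o
  · exact Or.inl h1
  by_cases h2 : x = c
  · subst h2
    rw [h.takeMate_self hc hm ho] at hx
    exact absurd hx ho
  · rw [takeMate_of_ne h2 h1] at hx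
    exact Or.inr ⟨h2, hx⟩

/-- This single exchange covers a bid in the auction, a step along a search path, the undoing of
such a step and the final augmentation. Hence the arrays hold a genuine matching at all times. -/
theorem take (h : Matched adj mate own) (hc : c ≠ 0) (hm : mate c = 0) (ho : o ≠ 0)
    (ha : adj c o) : Matched adj (takeMate mate own c o) (Function.update own o c) := by
  have hne := h.own_ne hc hm ho
  -- A matched agent is now either `c`, holding `o`, or an agent that keeps an object other than
  -- `o`.
  have key : ∀ x, takeMate mate own c o x ≠ 0 →
      (x = c ∧ takeMate mate own c o x = o) ∨
      (mate x ≠ 0 ∧ takeMate mate own c o x = mate x ∧ mate x ≠ o) := by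
    intro x hx
    have h1 : x ≠ own o := by rintro rfl; exact hx takeMate_own
    by_cases h2 : x = c
    · subst h2
      exact Or.inl ⟨rfl, h.takeMate_self hc hm ho⟩
    · rw [takeMate_of_ne h2 h1] at hx ⊢
      refine Or.inr ⟨hx, rfl, fun h3 => h1 ?_⟩
      rw [← h3, h.own_mate x hx]
  refine ⟨fun x hx => ?_, fun x hx => ?_, fun y hy => ?_, ?_, ?_⟩
  · rcases key x hx with ⟨rfl, h1⟩ | ⟨h1, h2, -⟩
    · rw [h1]; exact ha
    · rw [h2]; exact h.adj_mate x h1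
  · rcases key x hx with ⟨rfl, h1⟩ | ⟨h1, h2, h3⟩
    · rw [h1, Function.update_self]
    · rw [h2, Function.update_of_ne h3, h.own_mate x h1]
  · by_cases hyo : y = o
    · subst hyo
      rw [Function.update_self]
      exact h.takeMate_self hc hm ho
    · rw [Function.update_of_ne hyo] at hy ⊢
      have h1 := h.mate_own y hy
      rw [takeMate_of_ne, h1]
      · intro h2
        have hy0 : y = 0 := by rw [← h1, h2, hm]
        rw [hy0, h.own_zero] at hy
        exact hy rfl
      · intro h2
        rw [h2] at h1 hy
        exact hyo (h1.symm.trans (h.mate_own o hy))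
  -- If `o` was free, the evicted owner is the dummy agent `0`, and erasing its mate only rewrites a
  -- zero.
  · by_cases h0 : own o = 0
    · have h1 : takeMate mate own c o (own o) = 0 := takeMate_own
      rwa [h0] at h1
    · rw [takeMate_of_ne hc.symm (Ne.symm h0), h.mate_zero]
  · rw [Function.update_of_ne ho.symm, h.own_zero]

end Matched

/-- The number of matched agents. -/
def size (n : ℕ) (mate : ℕ → ℕ) : ℕ := ((Finset.Icc 1 n).filter (mate · ≠ 0)).card

theorem size_le (n : ℕ) (mate : ℕ → ℕ) : size n mate ≤ n :=
  (Finset.card_filter_le _ _).trans (by simp)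

/-- The agent `c` enters the set of matched agents and the former owner of `o`, if there is one,
leaves it. -/
theorem Matched.size_take {adj : ℕ → ℕ → Prop} {mate own : ℕ → ℕ} {c o n : ℕ}
    (h : Matched adj mate own) (hc : c ≠ 0) (hcn : c ≤ n) (hm : mate c = 0) (ho : o ≠ 0)
    (hadj : ∀ c o, adj c o → c ≤ n) :
    size n (takeMate mate own c o) = size n mate + if own o = 0 then 1 else 0 := by
  have hset : (Finset.Icc 1 n).filter (takeMate mate own c o · ≠ 0) =
      insert c (((Finset.Icc 1 n).filter (mate · ≠ 0)).erase (own o)) := by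
    ext x
    have hne := h.own_ne hc hm ho
    simp only [Finset.mem_filter, Finset.mem_Icc, Finset.mem_insert, Finset.mem_erase]
    by_cases h1 : x = own o
    · subst h1
      simp [Matched.takeMate_own, hne]
    by_cases h2 : x = c
    · subst h2
      simp [h.takeMate_self hc hm ho, ho]
      omega
    · rw [Matched.takeMate_of_ne h2 h1]
      tauto
  unfold size
  rw [hset, Finset.card_insert_of_notMem (by simp [hm])]
  split_ifs with h0
  · rw [Finset.erase_eq_of_notMem (by simp [h0])]
  · have h1 := h.mate_own o h0
    have h2 := hadj _ _ (h.adj_mate (own o) (by rw [h1]; exact ho))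
    rw [Finset.card_erase_add_one]
    · rfl
    · simp only [Finset.mem_filter, Finset.mem_Icc]
      exact ⟨⟨by omega, h2⟩, by rw [h1]; exact ho⟩

/-! ### Edge lists, scanning potentials and optimality certificates -/

/-- A list of edges between agents and objects, numbered from `1`, and for each agent a linked list
of its good edges in decreasing order. -/
structure Net where
  n : ℕ
  m : ℕ
  agt : ℕ → ℕ
  obj : ℕ → ℕ
  good : ℕ → Prop
  nxt : ℕ → ℕ
  hd : ℕ → ℕ
  agt_mem : ∀ e, 1 ≤ e → e ≤ m → 1 ≤ agt e ∧ agt e ≤ n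
  obj_pos : ∀ e, 1 ≤ e → e ≤ m → 1 ≤ obj e
  nxt_lt : ∀ p, 1 ≤ p → p ≤ m → good p → nxt p < p
  nxt_good : ∀ p, 1 ≤ p → p ≤ m → good p → nxt p ≠ 0 → good (nxt p) ∧ agt (nxt p) = agt p
  nxt_gap : ∀ p, 1 ≤ p → p ≤ m → good p → ∀ f, nxt p < f → f < p → good f → agt f ≠ agt p
  hd_le : ∀ c, hd c ≤ m
  hd_good : ∀ c, hd c ≠ 0 → good (hd c) ∧ agt (hd c) = c
  hd_gap : ∀ c f, hd c < f → f ≤ m → good f → agt f ≠ c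

namespace Net

variable (G : Net)

/-- Agent `a` and object `b` are joined by a good edge. -/
def Adj (a b : ℕ) : Prop := ∃ e, 1 ≤ e ∧ e ≤ G.m ∧ G.good e ∧ G.agt e = a ∧ G.obj e = b

/-- Agent `a` and object `b` are joined by an edge. -/
def AdjAll (a b : ℕ) : Prop := ∃ e, 1 ≤ e ∧ e ≤ G.m ∧ G.agt e = a ∧ G.obj e = b

variable {G}

theorem Adj.all {a b : ℕ} (h : G.Adj a b) : G.AdjAll a b := by
  obtain ⟨e, h1, h2, -, h3, h4⟩ := h
  exact ⟨e, h1, h2, h3, h4⟩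

theorem AdjAll.bounds {a b : ℕ} (h : G.AdjAll a b) : 1 ≤ a ∧ a ≤ G.n ∧ 1 ≤ b := by
  obtain ⟨e, h1, h2, rfl, rfl⟩ := h
  exact ⟨(G.agt_mem e h1 h2).1, (G.agt_mem e h1 h2).2, G.obj_pos e h1 h2⟩

/-- Every pointer is `0` or a good edge of its agent. -/
def PtrOk (G : Net) (ptr : ℕ → ℕ) : Prop :=
  ∀ c, ptr c ≤ G.m ∧ (ptr c ≠ 0 → G.good (ptr c) ∧ G.agt (ptr c) = c)

theorem PtrOk.adj {ptr : ℕ → ℕ} (h : G.PtrOk ptr) {c : ℕ} (hp : ptr c ≠ 0) :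
    G.Adj c (G.obj (ptr c)) :=
  ⟨ptr c, by omega, (h c).1, ((h c).2 hp).1, ((h c).2 hp).2, rfl⟩

theorem PtrOk.advance {ptr : ℕ → ℕ} (h : G.PtrOk ptr) {c : ℕ} (hp : ptr c ≠ 0) :
    G.PtrOk (Function.update ptr c (G.nxt (ptr c))) := by
  intro x
  by_cases hx : x = c
  · subst hx
    rw [Function.update_self]
    obtain ⟨h1, h2⟩ := h x
    obtain ⟨h2, h3⟩ := h2 hp
    have h4 := G.nxt_lt _ (by omega) h1 h2
    refine ⟨by omega, fun h5 => ?_⟩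
    have h6 := G.nxt_good _ (by omega) h1 h2 h5
    exact ⟨h6.1, h6.2.trans h3⟩
  · rw [Function.update_of_ne hx]
    exact h x

theorem PtrOk.reset {ptr : ℕ → ℕ} (h : G.PtrOk ptr) (c : ℕ) :
    G.PtrOk (Function.update ptr c (G.hd c)) := by
  intro x
  by_cases hx : x = c
  · subst hx
    rw [Function.update_self]
    exact ⟨G.hd_le x, G.hd_good x⟩
  · rw [Function.update_of_ne hx]
    exact h x

theorem ptrOk_hd : G.PtrOk G.hd := fun c => ⟨G.hd_le c, G.hd_good c⟩

/-- The good edges that the pointers have passed satisfy `S`. -/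
def Scanned (G : Net) (ptr : ℕ → ℕ) (S : ℕ → Prop) : Prop :=
  ∀ e, 1 ≤ e → e ≤ G.m → G.good e → ptr (G.agt e) < e → S e

/-- The lists are decreasing and omit no good edge, so an advance passes exactly one further good
edge of `c`, namely `ptr c`. -/
theorem Scanned.advance {ptr : ℕ → ℕ} {S S' : ℕ → Prop} (h : G.Scanned ptr S) (hp : G.PtrOk ptr)
    {c : ℕ} (hc : ptr c ≠ 0) (hS : ∀ e, 1 ≤ e → e ≤ G.m → S e → S' e) (hS' : S' (ptr c)) :
    G.Scanned (Function.update ptr c (G.nxt (ptr c))) S' := by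
  intro e h1 h2 h3 h4
  by_cases hx : G.agt e = c
  · rw [hx, Function.update_self] at h4
    obtain ⟨h5, h6⟩ := hp c
    obtain ⟨h6, h7⟩ := h6 hc
    rcases lt_trichotomy e (ptr c) with h8 | h8 | h8
    · exact absurd (hx.trans h7.symm) (G.nxt_gap _ (by omega) h5 h6 e h4 h8 h3)
    · rw [h8]; exact hS'
    · exact hS e h1 h2 (h e h1 h2 h3 (by rw [hx]; exact h8))
  · rw [Function.update_of_ne hx] at h4
    exact hS e h1 h2 (h e h1 h2 h3 h4)

/-- A pointer at the head of its list has passed no good edge, so the condition may change freely on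
the edges of `c`. This is used when the level of `c` rises. -/
theorem Scanned.reset {ptr : ℕ → ℕ} {S S' : ℕ → Prop} (h : G.Scanned ptr S) (c : ℕ)
    (hS : ∀ e, G.agt e ≠ c → S e → S' e) :
    G.Scanned (Function.update ptr c (G.hd c)) S' := by
  intro e h1 h2 h3 h4
  by_cases hx : G.agt e = c
  · rw [hx, Function.update_self] at h4
    exact absurd hx (G.hd_gap c e h4 h2 h3)
  · rw [Function.update_of_ne hx] at h4
    exact hS e hx (h e h1 h2 h3 h4)

/-- A potential for the scanning of the edges at each of the levels below `K`. -/
def pot (G : Net) (K : ℕ) (lvl ptr : ℕ → ℕ) : ℕ :=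
  ∑ e ∈ Finset.Icc 1 G.m, (2 * (K - lvl (G.agt e)) + if e ≤ ptr (G.agt e) then 1 else 0)

theorem pot_le (K : ℕ) (lvl ptr : ℕ → ℕ) : G.pot K lvl ptr ≤ G.m * (2 * K + 1) := by
  refine (Finset.sum_le_card_nsmul _ _ (2 * K + 1) fun e _ => ?_).trans (by simp)
  split_ifs <;> omega

theorem pot_advance {ptr : ℕ → ℕ} (hp : G.PtrOk ptr) {c : ℕ} (hc : ptr c ≠ 0) (K : ℕ)
    (lvl : ℕ → ℕ) :
    G.pot K lvl (Function.update ptr c (G.nxt (ptr c))) + 1 ≤ G.pot K lvl ptr := by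
  obtain ⟨h1, h2⟩ := hp c
  obtain ⟨h2, h3⟩ := h2 hc
  have h4 := G.nxt_lt _ (by omega) h1 h2
  unfold pot
  refine Nat.succ_le_of_lt (Finset.sum_lt_sum (fun e _ => ?_)
    ⟨ptr c, Finset.mem_Icc.2 ⟨by omega, h1⟩, ?_⟩)
  · by_cases hx : G.agt e = c
    · simp only [hx, Function.update_self]
      split_ifs <;> omega
    · simp only [Function.update_of_ne hx]
      omega
  · simp only [h3, Function.update_self, le_refl, if_true]
    rw [if_neg (by omega)]
    omega

/-- Resetting the pointer can add one for each edge of the agent, while the new level removes two;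
this is the reason for the weight two. The edge `e₀` makes the decrease strict. -/
theorem pot_raise {ptr lvl : ℕ → ℕ} {e₀ K : ℕ} (h1 : 1 ≤ e₀) (h2 : e₀ ≤ G.m)
    (hK : lvl (G.agt e₀) < K) (hd : ℕ) :
    G.pot K (Function.update lvl (G.agt e₀) (lvl (G.agt e₀) + 1))
      (Function.update ptr (G.agt e₀) hd) + 1 ≤ G.pot K lvl ptr := by
  unfold pot
  refine Nat.succ_le_of_lt (Finset.sum_lt_sum (fun e _ => ?_) ⟨e₀, Finset.mem_Icc.2 ⟨h1, h2⟩, ?_⟩)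
  · by_cases hx : G.agt e = G.agt e₀
    · simp only [hx, Function.update_self]
      split_ifs <;> omega
    · simp only [Function.update_of_ne hx]
      omega
  · simp only [Function.update_self]
    split_ifs <;> omega

/-- The agents of `A` can be matched along good edges by `f`. -/
structure Matchable (G : Net) (A : Finset ℕ) (f : ℕ → ℕ) : Prop where
  adj : ∀ a ∈ A, G.Adj a (f a)
  inj : ∀ a ∈ A, ∀ b ∈ A, f a = f b → a = b

theorem mem_matched {mate own : ℕ → ℕ} (h : Matched G.Adj mate own) {o : ℕ} (ho : 1 ≤ o)
    (hown : own o ≠ 0) : own o ∈ (Finset.Icc 1 G.n).filter (mate · ≠ 0) := by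
  have h1 := h.mate_own o hown
  have h2 : mate (own o) ≠ 0 := by omega
  have h3 := (h.adj_mate _ h2).all.bounds
  exact Finset.mem_filter.2 ⟨Finset.mem_Icc.2 ⟨h3.1, h3.2.1⟩, h2⟩

theorem mem_matched' {mate own : ℕ → ℕ} (h : Matched G.Adj mate own) {a : ℕ}
    (ha : mate a ≠ 0) : a ∈ (Finset.Icc 1 G.n).filter (mate · ≠ 0) := by
  have h3 := (h.adj_mate _ ha).all.bounds
  exact Finset.mem_filter.2 ⟨Finset.mem_Icc.2 ⟨h3.1, h3.2.1⟩, ha⟩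

/-- A failed search proves that the matching is maximum. -/
theorem Matchable.card_le_size {A : Finset ℕ} {f : ℕ → ℕ} (hA : G.Matchable A f)
    {mate own ptr : ℕ → ℕ} {R : ℕ → Prop} (h : Matched G.Adj mate own)
    (h1 : G.Scanned ptr fun e => R (G.obj e))
    (h2 : ∀ e, 1 ≤ e → e ≤ G.m → R (G.obj e) → own (G.obj e) ≠ 0 ∧ ptr (own (G.obj e)) = 0)
    (h3 : ∀ e, 1 ≤ e → e ≤ G.m → mate (G.agt e) = 0 → ptr (G.agt e) = 0) :
    A.card ≤ size G.n mate := by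
  have hown : ∀ a ∈ A, ptr a = 0 → 1 ≤ f a ∧ own (f a) ≠ 0 ∧ ptr (own (f a)) = 0 := by
    intro a ha hp
    obtain ⟨e, he, he', hg, hea, heo⟩ := hA.adj a ha
    have := h2 e he he' (h1 e he he' hg (by rw [hea, hp]; exact he))
    rw [heo] at this
    exact ⟨heo ▸ G.obj_pos e he he', this⟩
  -- An agent with unscanned edges is matched and stands for itself. An exhausted agent has passed
  -- all its good edges, so its object is marked, and the owner of that object stands for it. The
  -- images do not collide, because only owners of the second kind are exhausted.
  refine Finset.card_le_card_of_injOn (fun a => if ptr a = 0 then own (f a) else a) ?_ ?_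
  · intro a ha
    dsimp only
    split_ifs with hp
    · obtain ⟨h4, h5, -⟩ := hown a ha hp
      exact mem_matched h h4 h5
    · refine mem_matched' h fun hm => hp ?_
      obtain ⟨e, he, he', hg, rfl, heo⟩ := hA.adj a ha
      exact h3 e he he' hm
  · intro a ha b hb hab
    dsimp only at hab
    split_ifs at hab with hp hp' hp'
    · obtain ⟨-, h5, -⟩ := hown a ha hp
      obtain ⟨-, h6, -⟩ := hown b hb hp'
      refine hA.inj a ha b hb ?_
      rw [← h.mate_own _ h5, hab, h.mate_own _ h6]
    · exact absurd (hab ▸ (hown a ha hp).2.2) hp'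
    · exact absurd (hab ▸ (hown b hb hp').2.2) hp
    · exact hab

/-- The matching found by an auction with `K` price levels is almost maximum. -/
theorem Matchable.mul_card_le {A : Finset ℕ} {f : ℕ → ℕ} (hA : G.Matchable A f)
    {mate own lvl prc : ℕ → ℕ} {K : ℕ} (h : Matched G.Adj mate own)
    (h1 : ∀ e, 1 ≤ e → e ≤ G.m → G.good e → lvl (G.agt e) ≤ prc (G.obj e))
    (h2 : ∀ c, mate c ≠ 0 → prc (mate c) = lvl c + 1)
    (h3 : ∀ o, prc o ≠ 0 → own o ≠ 0)
    (h4 : ∀ e, 1 ≤ e → e ≤ G.m → mate (G.agt e) ≠ 0 ∨ lvl (G.agt e) = K) :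
    K * A.card ≤ K * size G.n mate + size G.n mate := by
  set T := (Finset.Icc 1 G.n).filter (mate · ≠ 0) with hT
  -- Agents of `A` at levels above `t` are mapped to the owners of their objects, which have level
  -- at least `t`; the other agents of `A` are matched. Only matched agents of level exactly `t` are
  -- counted twice.
  have key : ∀ t ∈ Finset.range K, A.card ≤ T.card + (T.filter (lvl · = t)).card := by
    intro t ht
    have htK := Finset.mem_range.1 ht
    have hown : ∀ a ∈ A, t < lvl a → 1 ≤ f a ∧ own (f a) ≠ 0 ∧ t ≤ lvl (own (f a)) := by
      intro a ha hl
      obtain ⟨e, he, he', hg, rfl, heo⟩ := hA.adj a ha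
      have h5 := h1 e he he' hg
      rw [heo] at h5
      -- The price is at least the level, which exceeds `t`, so it is positive and the object has an
      -- owner.
      have h6 := h3 (f (G.agt e)) (by omega)
      have h8 : 1 ≤ f (G.agt e) := heo ▸ G.obj_pos e he he'
      have h7 := h2 (own (f (G.agt e))) (by rw [h.mate_own _ h6]; omega)
      rw [h.mate_own _ h6] at h7
      exact ⟨h8, h6, by omega⟩
    have c1 : (A.filter (t < lvl ·)).card ≤ (T.filter (t ≤ lvl ·)).card := by
      refine Finset.card_le_card_of_injOn (fun a => own (f a)) ?_ ?_
      · intro a ha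
        obtain ⟨ha, hl⟩ := Finset.mem_filter.1 ha
        obtain ⟨h5, h6, h7⟩ := hown a ha hl
        exact Finset.mem_filter.2 ⟨mem_matched h h5 h6, h7⟩
      · intro a ha b hb hab
        obtain ⟨ha, hl⟩ := Finset.mem_filter.1 ha
        obtain ⟨hb, hl'⟩ := Finset.mem_filter.1 hb
        dsimp only at hab
        refine hA.inj a ha b hb ?_
        rw [← h.mate_own _ (hown a ha hl).2.1, hab, h.mate_own _ (hown b hb hl').2.1]
    have c2 : (A.filter (¬ t < lvl ·)).card ≤ (T.filter (¬ t < lvl ·)).card := by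
      refine Finset.card_le_card fun a ha => ?_
      obtain ⟨ha, hl⟩ := Finset.mem_filter.1 ha
      refine Finset.mem_filter.2 ⟨mem_matched' h fun hm => ?_, hl⟩
      obtain ⟨e, he, he', hg, rfl, heo⟩ := hA.adj a ha
      rcases h4 e he he' with h5 | h5
      · exact h5 hm
      · omega
    have c3 : (T.filter (t ≤ lvl ·)).card ≤
        (T.filter (t < lvl ·)).card + (T.filter (lvl · = t)).card := by
      refine le_trans (Finset.card_le_card fun a ha => ?_) (Finset.card_union_le _ _)
      obtain ⟨ha, hl⟩ := Finset.mem_filter.1 ha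
      rcases hl.lt_or_eq with h5 | h5
      · exact Finset.mem_union_left _ (Finset.mem_filter.2 ⟨ha, h5⟩)
      · exact Finset.mem_union_right _ (Finset.mem_filter.2 ⟨ha, h5.symm⟩)
    have c4 := Finset.card_filter_add_card_filter_not (s := A) (t < lvl ·)
    have c5 := Finset.card_filter_add_card_filter_not (s := T) (t < lvl ·)
    omega
  -- Summing over all `t < K` counts each matched agent at most once in the error terms.
  have hsum := Finset.sum_le_sum key
  simp only [Finset.sum_const, Finset.card_range, smul_eq_mul, Finset.sum_add_distrib] at hsum
  have hf : ∑ t ∈ Finset.range K, (T.filter (lvl · = t)).card ≤ T.card := by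
    rw [← Finset.card_biUnion]
    · exact Finset.card_le_card (Finset.biUnion_subset.2 fun t _ => Finset.filter_subset _ _)
    · intro t _ t' _ hne
      exact Finset.disjoint_left.2 fun a ha ha' =>
        hne ((Finset.mem_filter.1 ha).2.symm.trans (Finset.mem_filter.1 ha').2)
  have hs : size G.n mate = T.card := rfl
  rw [hs]
  omega

/-- The error `s` is at most `n ≤ K * K`, so division by `K` leaves an error of at most `K`. -/
theorem Matchable.card_le_add {A : Finset ℕ} {K s n : ℕ} (hs : s ≤ n) (hK : n ≤ K * K)
    (hK0 : 0 < K) (h : K * A.card ≤ K * s + s) : A.card ≤ s + K := by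
  refine Nat.le_of_mul_le_mul_left (c := K) ?_ hK0
  rw [mul_add]
  omega

end Net

end RAMCode

/-! ### The auction and the search for an augmenting path -/

namespace RAMCode

namespace Net

variable {G : Net}

/-- The invariant of the auction. Each object has a price and each agent a level, a lower bound for
the prices of its good objects. The agent `c` is bidding; the unmatched agents of the edges
before `b` have reached the level `K`. -/
structure AuctionInv (G : Net) (K b c : ℕ) (lvl prc mate own ptr : ℕ → ℕ) : Prop where
  matched : Matched G.Adj mate own
  ptr_ok : G.PtrOk ptr
  lvl_le : ∀ a, lvl a ≤ K
  lvl_le_prc : ∀ e, 1 ≤ e → e ≤ G.m → G.good e → lvl (G.agt e) ≤ prc (G.obj e)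
  scanned : G.Scanned ptr fun e => lvl (G.agt e) < prc (G.obj e)
  prc_mate : ∀ a, mate a ≠ 0 → prc (mate a) = lvl a + 1
  own_of_prc : ∀ o, prc o ≠ 0 → own o ≠ 0
  cur : c ≠ 0 → mate c = 0 ∧ lvl c < K ∧ ∃ e, 1 ≤ e ∧ e ≤ G.m ∧ G.agt e = c
  done : ∀ e, 1 ≤ e → e ≤ G.m → e < b → mate (G.agt e) ≠ 0 ∨ lvl (G.agt e) = K ∨ G.agt e = c

namespace AuctionInv

variable {K b c : ℕ} {lvl prc mate own ptr : ℕ → ℕ}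

theorem start (h : G.AuctionInv K b 0 lvl prc mate own ptr) (hb : 1 ≤ b) (hb' : b ≤ G.m)
    (hc : (c = 0 ∧ (mate (G.agt b) ≠ 0 ∨ lvl (G.agt b) = K)) ∨
      (c = G.agt b ∧ mate (G.agt b) = 0 ∧ lvl (G.agt b) < K)) :
    G.AuctionInv K (b + 1) c lvl prc mate own ptr where
  matched := h.matched
  ptr_ok := h.ptr_ok
  lvl_le := h.lvl_le
  lvl_le_prc := h.lvl_le_prc
  scanned := h.scanned
  prc_mate := h.prc_mate
  own_of_prc := h.own_of_prc
  cur hc' := by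
    rcases hc with hc | ⟨rfl, hc⟩
    · exact absurd hc.1 hc'
    · exact ⟨hc.1, hc.2, b, hb, hb', rfl⟩
  done e he he' hlt := by
    rcases Nat.lt_succ_iff_lt_or_eq.1 hlt with hlt | rfl
    · have := (G.agt_mem e he he').1
      rcases h.done e he he' hlt with h1 | h1 | h1
      · exact Or.inl h1
      · exact Or.inr (Or.inl h1)
      · omega
    · rcases hc with ⟨-, hc | hc⟩ | hc
      · exact Or.inl hc
      · exact Or.inr (Or.inl hc)
      · exact Or.inr (Or.inr hc.1.symm)

/-- The next object of the list is too expensive. -/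
theorem skip (h : G.AuctionInv K b c lvl prc mate own ptr) (hp : ptr c ≠ 0)
    (hlt : lvl c < prc (G.obj (ptr c))) :
    G.AuctionInv K b c lvl prc mate own (Function.update ptr c (G.nxt (ptr c))) where
  matched := h.matched
  ptr_ok := h.ptr_ok.advance hp
  lvl_le := h.lvl_le
  lvl_le_prc := h.lvl_le_prc
  scanned := h.scanned.advance h.ptr_ok hp (fun _ _ _ h => h)
    (by rw [((h.ptr_ok c).2 hp).2]; exact hlt)
  prc_mate := h.prc_mate
  own_of_prc := h.own_of_prc
  cur := h.cur
  done := h.done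

/-- The bidding agent takes the next object of its list. -/
theorem take (h : G.AuctionInv K b c lvl prc mate own ptr) (hc : c ≠ 0) (hp : ptr c ≠ 0)
    (hle : prc (G.obj (ptr c)) ≤ lvl c) :
    G.AuctionInv K b (own (G.obj (ptr c))) lvl
      (Function.update prc (G.obj (ptr c)) (lvl c + 1))
      (takeMate mate own c (G.obj (ptr c))) (Function.update own (G.obj (ptr c)) c)
      (Function.update ptr c (G.nxt (ptr c))) := by
  have hadj := h.ptr_ok.adj hp
  have hagt := ((h.ptr_ok c).2 hp).2
  -- Levels are lower bounds for prices, so an affordable object costs exactly the level of the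
  -- bidder.
  have hprc : prc (G.obj (ptr c)) = lvl c := by
    have := h.lvl_le_prc (ptr c) (by omega) (h.ptr_ok c).1 ((h.ptr_ok c).2 hp).1
    rw [hagt] at this
    omega
  have ho : G.obj (ptr c) ≠ 0 := by have := hadj.all.bounds; omega
  obtain ⟨hm, hlK, -⟩ := h.cur hc
  have hM := h.matched
  have hmono : ∀ x, prc x ≤ Function.update prc (G.obj (ptr c)) (lvl c + 1) x := by
    intro x
    by_cases hx : x = G.obj (ptr c)
    · rw [hx, Function.update_self]; omega
    · rw [Function.update_of_ne hx]
  have hscan : ∀ x, G.obj (ptr c) = x → G.Scanned (Function.update ptr c (G.nxt (ptr c)))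
      fun e => lvl (G.agt e) < Function.update prc x (lvl c + 1) (G.obj e) := by
    rintro x rfl
    refine h.scanned.advance h.ptr_ok hp (fun e _ _ h => h.trans_le (hmono _)) ?_
    rw [hagt, Function.update_self]
    omega
  have hscan := hscan _ rfl
  generalize G.obj (ptr c) = o at *
  refine ⟨hM.take hc hm ho hadj, h.ptr_ok.advance hp, h.lvl_le,
    fun e h1 h2 h3 => (h.lvl_le_prc e h1 h2 h3).trans (hmono _),
    hscan, fun a ha => ?_,
    fun x hx => ?_, fun hown => ⟨Matched.takeMate_own, ?_, ?_⟩, fun e h1 h2 h3 => ?_⟩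
  · by_cases hac : a = c
    · subst hac
      rw [hM.takeMate_self hc hm ho, Function.update_self]
    · have hao : a ≠ own o := by rintro rfl; exact ha Matched.takeMate_own
      rw [Matched.takeMate_of_ne hac hao] at ha ⊢
      rw [Function.update_of_ne, h.prc_mate a ha]
      rintro rfl
      exact hao (hM.own_mate a ha).symm
  · by_cases hxo : x = o
    · subst hxo; rw [Function.update_self]; exact hc
    · rw [Function.update_of_ne hxo] at hx ⊢
      exact h.own_of_prc x hx
  -- The evicted owner paid the old price `lvl c`, so its level is one less than that of `c`.
  · have h1 := hM.mate_own o hown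
    have h2 := h.prc_mate (own o) (by rw [h1]; exact ho)
    rw [h1] at h2
    omega
  · obtain ⟨e, h1, h2, -, h3, -⟩ := hM.adj_mate (own o) (by rw [hM.mate_own o hown]; exact ho)
    exact ⟨e, h1, h2, h3⟩
  · by_cases hmate : takeMate mate own c o (G.agt e) = 0
    · rcases hM.takeMate_eq_zero hc hm ho hmate with h4 | ⟨h4, h5⟩
      · exact Or.inr (Or.inr h4)
      · rcases h.done e h1 h2 h3 with h6 | h6 | h6
        · exact absurd h5 h6
        · exact Or.inr (Or.inl h6)
        · exact absurd h6 h4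
    · exact Or.inl hmate

/-- At the end of its list, the bidding agent raises its level, and gives up at level `K`. -/
theorem raise (h : G.AuctionInv K b c lvl prc mate own ptr) (hc : c ≠ 0) (hp : ptr c = 0)
    {c' : ℕ} (hc' : (c' = c ∧ lvl c + 1 < K) ∨ (c' = 0 ∧ K ≤ lvl c + 1)) :
    G.AuctionInv K b c' (Function.update lvl c (lvl c + 1)) prc mate own
      (Function.update ptr c (G.hd c)) := by
  obtain ⟨hm, hlK, hex⟩ := h.cur hc
  refine ⟨h.matched, h.ptr_ok.reset c, fun a => ?_, fun e h1 h2 h3 => ?_,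
    h.scanned.reset c fun e he hS => ?_, fun a ha => ?_, h.own_of_prc, fun hc0 => ?_,
    fun e h1 h2 h3 => ?_⟩
  · by_cases ha : a = c
    · subst ha; rw [Function.update_self]; omega
    · rw [Function.update_of_ne ha]; exact h.lvl_le a
  · by_cases ha : G.agt e = c
    · rw [ha, Function.update_self]
      -- The list is exhausted: every good object of `c` was found to cost more than the level, so
      -- the raised level is still a lower bound.
      have := h.scanned e h1 h2 h3 (by rw [ha, hp]; omega)
      simp only [ha] at this
      omega
    · rw [Function.update_of_ne ha]; exact h.lvl_le_prc e h1 h2 h3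
  · rw [Function.update_of_ne he]; exact hS
  · have hac : a ≠ c := by rintro rfl; exact ha hm
    rw [Function.update_of_ne hac]; exact h.prc_mate a ha
  · rcases hc' with ⟨rfl, hlt⟩ | ⟨rfl, -⟩
    · exact ⟨hm, by rw [Function.update_self]; exact hlt, hex⟩
    · exact absurd rfl hc0
  · by_cases ha : G.agt e = c
    · rcases hc' with ⟨rfl, hlt⟩ | ⟨rfl, hle⟩
      · exact Or.inr (Or.inr ha)
      · refine Or.inr (Or.inl ?_)
        rw [ha, Function.update_self]
        omega
    · rw [Function.update_of_ne ha]
      rcases h.done e h1 h2 h3 with h6 | h6 | h6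
      · exact Or.inl h6
      · exact Or.inr (Or.inl h6)
      · exact absurd h6 ha

theorem card_le (h : G.AuctionInv K (G.m + 1) 0 lvl prc mate own ptr) (hK : G.n ≤ K * K)
    (hK0 : 0 < K) {A : Finset ℕ} {f : ℕ → ℕ} (hA : G.Matchable A f) :
    A.card ≤ size G.n mate + K := by
  refine Matchable.card_le_add (size_le _ _) hK hK0 (hA.mul_card_le h.matched h.lvl_le_prc
    h.prc_mate h.own_of_prc fun e h1 h2 => ?_)
  have := (G.agt_mem e h1 h2).1
  rcases h.done e h1 h2 (by omega) with h6 | h6 | h6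
  · exact Or.inl h6
  · exact Or.inr h6
  · omega

end AuctionInv

/-! ### Depth-first search by exchanging objects in place -/

/-- The invariant of the search for an augmenting path, which exchanges objects along the current
path. The agent `c` at the end of the path has no object; the objects on the path are on the stack;
the marked objects are on the stack or belong to agents that have been dealt with, like the
unmatched agents of the edges before `b`. -/
structure SearchInv (G : Net) (b c top : ℕ) (mate own ptr mrk stk : ℕ → ℕ) : Prop where
  matched : Matched G.Adj mate own
  ptr_ok : G.PtrOk ptr
  scanned : G.Scanned ptr fun e => mrk (G.obj e) ≠ 0
  cur : c ≠ 0 → mate c = 0 ∧ c ≤ G.n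
  done : ∀ e, 1 ≤ e → e ≤ G.m → e < b →
    mate (G.agt e) = 0 → ptr (G.agt e) = 0 ∨ G.agt e = c
  stk_adj : 0 < top → G.Adj c (stk (top - 1))
  stk_chain : ∀ x, x + 1 < top → G.Adj (own (stk (x + 1))) (stk x)
  stk_own : ∀ x < top, own (stk x) ≠ 0
  stk_mrk : ∀ x < top, mrk (stk x) ≠ 0
  stk_inj : ∀ x < top, ∀ y < top, stk x = stk y → x = y
  own_of_mrk : ∀ e, 1 ≤ e → e ≤ G.m → mrk (G.obj e) ≠ 0 →
    own (G.obj e) ≠ 0 ∧ (ptr (own (G.obj e)) = 0 ∨ ∃ x < top, stk x = G.obj e)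

namespace SearchInv

variable {b c top : ℕ} {mate own ptr mrk stk : ℕ → ℕ}

theorem of_unmarked (h : Matched G.Adj mate own) (hp : G.PtrOk ptr)
    (hptr : ∀ e, 1 ≤ e → e ≤ G.m → ptr (G.agt e) = G.hd (G.agt e))
    (hmrk : ∀ e, 1 ≤ e → e ≤ G.m → mrk (G.obj e) = 0) :
    G.SearchInv 1 0 0 mate own ptr mrk stk where
  matched := h
  ptr_ok := hp
  scanned e h1 h2 h3 h4 := by
    rw [hptr e h1 h2] at h4
    exact absurd rfl (G.hd_gap _ e h4 h2 h3)
  cur h := absurd rfl h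
  done e h1 _ h3 := by omega
  stk_adj h := by omega
  stk_chain x h := by omega
  stk_own x h := by omega
  stk_mrk x h := by omega
  stk_inj x h := by omega
  own_of_mrk e h1 h2 h3 := absurd (hmrk e h1 h2) h3

theorem start (h : G.SearchInv b 0 0 mate own ptr mrk stk) (hb : 1 ≤ b) (hb' : b ≤ G.m)
    (hc : (c = 0 ∧ mate (G.agt b) ≠ 0) ∨ (c = G.agt b ∧ mate (G.agt b) = 0)) :
    G.SearchInv (b + 1) c 0 mate own ptr mrk stk where
  matched := h.matched
  ptr_ok := h.ptr_ok
  scanned := h.scanned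
  cur hc' := by
    rcases hc with hc | ⟨rfl, hc⟩
    · exact absurd hc.1 hc'
    · exact ⟨hc, (G.agt_mem b hb hb').2⟩
  done e he he' hlt hm := by
    rcases Nat.lt_succ_iff_lt_or_eq.1 hlt with hlt | rfl
    · have := (G.agt_mem e he he').1
      rcases h.done e he he' hlt hm with h1 | h1
      · exact Or.inl h1
      · omega
    · rcases hc with ⟨-, hc⟩ | hc
      · exact absurd hm hc
      · exact Or.inr hc.1.symm
  stk_adj h := by omega
  stk_chain x h := by omega
  stk_own x h := by omega
  stk_mrk x h := by omega
  stk_inj x h := by omega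
  own_of_mrk := h.own_of_mrk

theorem done_advance (h : G.SearchInv b c top mate own ptr mrk stk) (x : ℕ) :
    ∀ e, 1 ≤ e → e ≤ G.m → e < b →
      mate (G.agt e) = 0 → Function.update ptr c x (G.agt e) = 0 ∨ G.agt e = c := by
  intro e h1 h2 h3 h4
  by_cases ha : G.agt e = c
  · exact Or.inr ha
  · rw [Function.update_of_ne ha]
    exact h.done e h1 h2 h3 h4

theorem own_of_mrk_advance (h : G.SearchInv b c top mate own ptr mrk stk) (hp : ptr c ≠ 0)
    (x : ℕ) {e : ℕ} (h1 : 1 ≤ e) (h2 : e ≤ G.m) (h3 : mrk (G.obj e) ≠ 0) :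
    own (G.obj e) ≠ 0 ∧
      (Function.update ptr c x (own (G.obj e)) = 0 ∨ ∃ x < top, stk x = G.obj e) := by
  obtain ⟨h4, h5⟩ := h.own_of_mrk e h1 h2 h3
  refine ⟨h4, h5.imp_left fun h5 => ?_⟩
  rw [Function.update_of_ne, h5]
  rintro h6
  exact hp (h6 ▸ h5)

/-- The next object of the list is marked. -/
theorem skip (h : G.SearchInv b c top mate own ptr mrk stk) (hp : ptr c ≠ 0)
    (hm : mrk (G.obj (ptr c)) ≠ 0) :
    G.SearchInv b c top mate own (Function.update ptr c (G.nxt (ptr c))) mrk stk where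
  matched := h.matched
  ptr_ok := h.ptr_ok.advance hp
  scanned := h.scanned.advance h.ptr_ok hp (fun _ _ _ h => h) hm
  cur := h.cur
  done := h.done_advance _
  stk_adj := h.stk_adj
  stk_chain := h.stk_chain
  stk_own := h.stk_own
  stk_mrk := h.stk_mrk
  stk_inj := h.stk_inj
  own_of_mrk _ h1 h2 h3 := h.own_of_mrk_advance hp _ h1 h2 h3

/-- The only agent that can become unmatched is the former owner of `o`, and it becomes the current
agent. -/
theorem done_take (h : G.SearchInv b c top mate own ptr mrk stk) (hc : c ≠ 0) {o : ℕ}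
    (ho : o ≠ 0) {ptr' : ℕ → ℕ} (hptr : ∀ x, x ≠ c → ptr' x = ptr x) :
    ∀ e, 1 ≤ e → e ≤ G.m → e < b →
      takeMate mate own c o (G.agt e) = 0 → ptr' (G.agt e) = 0 ∨ G.agt e = own o := by
  intro e h1 h2 h3 h4
  rcases h.matched.takeMate_eq_zero hc (h.cur hc).1 ho h4 with h5 | ⟨h5, h6⟩
  · exact Or.inr h5
  · rw [hptr _ h5]
    exact Or.inl ((h.done e h1 h2 h3 h6).resolve_right h5)

theorem cur_take (h : G.SearchInv b c top mate own ptr mrk stk) {o : ℕ} (ho : o ≠ 0)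
    (hown : own o ≠ 0) : takeMate mate own c o (own o) = 0 ∧ own o ≤ G.n :=
  ⟨Matched.takeMate_own, (h.matched.adj_mate (own o)
    (by rw [h.matched.mate_own o hown]; exact ho)).all.bounds.2.1⟩

/-- The agent at the end of the path takes the unmarked next object of its list from its owner. -/
theorem push (h : G.SearchInv b c top mate own ptr mrk stk) (hc : c ≠ 0) (hp : ptr c ≠ 0)
    (hm : mrk (G.obj (ptr c)) = 0) (hown : own (G.obj (ptr c)) ≠ 0) :
    G.SearchInv b (own (G.obj (ptr c))) (top + 1) (takeMate mate own c (G.obj (ptr c)))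
      (Function.update own (G.obj (ptr c)) c) (Function.update ptr c (G.nxt (ptr c)))
      (Function.update mrk (G.obj (ptr c)) 1) (Function.update stk top (G.obj (ptr c))) := by
  have hadj := h.ptr_ok.adj hp
  have hscan : ∀ x, G.obj (ptr c) = x →
      G.Scanned (Function.update ptr c (G.nxt (ptr c)))
        fun e => Function.update mrk x 1 (G.obj e) ≠ 0 := by
    rintro x rfl
    refine h.scanned.advance h.ptr_ok hp (fun e _ _ h1 => ?_) (by simp)
    by_cases hx : G.obj e = G.obj (ptr c)
    · simp [hx]
    · rwa [Function.update_of_ne hx]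
  have hscan := hscan _ rfl
  have ho : G.obj (ptr c) ≠ 0 := by have := hadj.all.bounds; omega
  generalize G.obj (ptr c) = o at *
  have hM := h.matched
  -- Objects on the stack are marked and `o` is not, so the exchange leaves their owners unchanged.
  have hne : ∀ x < top, stk x ≠ o := by
    rintro x hx rfl
    exact h.stk_mrk x hx hm
  refine ⟨hM.take hc (h.cur hc).1 ho hadj, h.ptr_ok.advance hp, hscan,
    fun _ => h.cur_take ho hown, h.done_take hc ho fun x hx => Function.update_of_ne hx _ _,
    fun _ => ?_, fun x hx => ?_, fun x hx => ?_, fun x hx => ?_, fun x hx y hy hxy => ?_,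
    fun e h1 h2 h3 => ?_⟩
  -- The evicted owner held `o` along a good edge, so it can take `o` back when the step is undone.
  · rw [Nat.add_sub_cancel, Function.update_self]
    have := hM.adj_mate (own o) (by rw [hM.mate_own o hown]; exact ho)
    rwa [hM.mate_own o hown] at this
  · rw [Function.update_of_ne (by omega : x ≠ top)]
    -- The owner of the new top object is `c`, which is joined to the previous top by `stk_adj`.
    by_cases hx' : x + 1 = top
    · subst hx'
      rw [Function.update_self, Function.update_self]
      exact h.stk_adj (by omega)
    · rw [Function.update_of_ne hx', Function.update_of_ne (hne _ (by omega))]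
      exact h.stk_chain x (by omega)
  · by_cases hx' : x = top
    · subst hx'
      rwa [Function.update_self, Function.update_self]
    · rw [Function.update_of_ne hx', Function.update_of_ne (hne _ (by omega))]
      exact h.stk_own x (by omega)
  · by_cases hx' : x = top
    · subst hx'
      simp
    · rw [Function.update_of_ne hx', Function.update_of_ne (hne _ (by omega))]
      exact h.stk_mrk x (by omega)
  · by_cases hx' : x = top <;> by_cases hy' : y = top
    · omega
    · rw [hx', Function.update_self, Function.update_of_ne hy'] at hxy
      exact absurd hxy.symm (hne y (by omega))
    · rw [hy', Function.update_self, Function.update_of_ne hx'] at hxy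
      exact absurd hxy (hne x (by omega))
    · rw [Function.update_of_ne hx', Function.update_of_ne hy'] at hxy
      exact h.stk_inj x (by omega) y (by omega) hxy
  · by_cases ho' : G.obj e = o
    · rw [ho', Function.update_self]
      exact ⟨hc, Or.inr ⟨top, by omega, by simp⟩⟩
    · rw [Function.update_of_ne ho'] at h3 ⊢
      obtain ⟨h4, h5⟩ := h.own_of_mrk_advance hp (G.nxt (ptr c)) h1 h2 h3
      refine ⟨h4, h5.imp_right ?_⟩
      rintro ⟨x, hx, hxe⟩
      exact ⟨x, by omega, by rw [Function.update_of_ne (by omega : x ≠ top), hxe]⟩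

/-- At the end of its list, the agent at the end of the path gets back its object. -/
theorem pop (h : G.SearchInv b c top mate own ptr mrk stk) (hc : c ≠ 0) (hp : ptr c = 0)
    (htop : 0 < top) :
    own (stk (top - 1)) ≠ 0 ∧
    G.SearchInv b (own (stk (top - 1))) (top - 1) (takeMate mate own c (stk (top - 1)))
      (Function.update own (stk (top - 1)) c) ptr mrk stk := by
  have hadj := h.stk_adj htop
  have hown := h.stk_own (top - 1) (by omega)
  have hchain := fun x (hx : x + 1 = top - 1) => h.stk_chain x (by omega)
  have hne : ∀ x < top - 1, stk x ≠ stk (top - 1) := by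
    intro x hx hxe
    have := h.stk_inj x (by omega) (top - 1) (by omega) hxe
    omega
  have hstk : ∀ x < top, stk x ≠ stk (top - 1) → x < top - 1 := by
    intro x hx hxe
    have : x ≠ top - 1 := by rintro rfl; exact hxe rfl
    omega
  have ho : stk (top - 1) ≠ 0 := by have := hadj.all.bounds; omega
  have hch : 0 < top - 1 → G.Adj (own (stk (top - 1))) (stk (top - 1 - 1)) := by
    intro h0
    have := h.stk_chain (top - 1 - 1) (by omega)
    rwa [show top - 1 - 1 + 1 = top - 1 by omega] at this
  generalize stk (top - 1) = o at *
  have hM := h.matched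
  refine ⟨hown, hM.take hc (h.cur hc).1 ho hadj, h.ptr_ok, h.scanned,
    fun _ => h.cur_take ho hown, h.done_take hc ho fun x hx => rfl, hch, fun x hx => ?_,
    fun x hx => ?_, fun x hx => h.stk_mrk x (by omega),
    fun x hx y hy hxy => h.stk_inj x (by omega) y (by omega) hxy, fun e h1 h2 h3 => ?_⟩
  · rw [Function.update_of_ne (hne _ hx)]
    exact h.stk_chain x (by omega)
  · rw [Function.update_of_ne (hne _ hx)]
    exact h.stk_own x (by omega)
  -- The object `o` leaves the stack but now belongs to `c`, whose list is exhausted.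
  · by_cases ho' : G.obj e = o
    · rw [ho', Function.update_self]
      exact ⟨hc, Or.inl hp⟩
    · rw [Function.update_of_ne ho']
      obtain ⟨h4, h5⟩ := h.own_of_mrk e h1 h2 h3
      refine ⟨h4, h5.imp_right ?_⟩
      rintro ⟨x, hx, hxe⟩
      exact ⟨x, hstk x hx (by rwa [hxe]), hxe⟩

/-- The search fails when all agents of the path have been dealt with. -/
theorem fail (h : G.SearchInv b c 0 mate own ptr mrk stk) (hp : ptr c = 0) :
    G.SearchInv b 0 0 mate own ptr mrk stk where
  matched := h.matched
  ptr_ok := h.ptr_ok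
  scanned := h.scanned
  cur h := absurd rfl h
  done e h1 h2 h3 h4 := by
    rcases h.done e h1 h2 h3 h4 with h5 | h5
    · exact Or.inl h5
    · exact Or.inl (h5 ▸ hp)
  stk_adj h := by omega
  stk_chain := h.stk_chain
  stk_own := h.stk_own
  stk_mrk := h.stk_mrk
  stk_inj := h.stk_inj
  own_of_mrk := h.own_of_mrk

/-- With an empty stack every marked object belongs to an exhausted agent, and all unmatched agents
with an edge are exhausted as well: the search has failed everywhere. -/
theorem card_le (h : G.SearchInv (G.m + 1) 0 0 mate own ptr mrk stk) {A : Finset ℕ} {f : ℕ → ℕ}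
    (hA : G.Matchable A f) : A.card ≤ size G.n mate := by
  refine hA.card_le_size (R := (mrk · ≠ 0)) h.matched h.scanned (fun e h1 h2 h3 => ?_)
    fun e h1 h2 h3 => ?_
  · obtain ⟨h4, h5 | ⟨x, hx, -⟩⟩ := h.own_of_mrk e h1 h2 h3
    · exact ⟨h4, h5⟩
    · omega
  · have := (G.agt_mem e h1 h2).1
    rcases h.done e h1 h2 (by omega) h3 with h4 | h4
    · exact h4
    · omega

end SearchInv

/-- A matching held by arrays has at most as many edges as any upper bound allows. -/
theorem size_le_of_matched {mate own : ℕ → ℕ} (h : Matched G.Adj mate own) {W : ℕ}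
    (hW : ∀ A f, G.Matchable A f → A.card ≤ W) : size G.n mate ≤ W := by
  refine hW _ mate ⟨fun a ha => h.adj_mate a (Finset.mem_filter.1 ha).2, fun a ha b hb hab => ?_⟩
  rw [← h.own_mate a (Finset.mem_filter.1 ha).2, hab, h.own_mate b (Finset.mem_filter.1 hb).2]

end Net

end RAMCode

/-! ### The program -/

namespace RAMCode

open Cmd Var Arr

/-- No operation. -/
def skip : Cmd := const g 0

/-- The agent `c` takes the object `o`; its owner becomes the agent `c`. -/
def takeObj : Cmd :=
  -- For a free object `i` is `0`: the write to `mate[0]` changes nothing, and `c` becomes `0`,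
  -- which ends the enclosing loop. Subtracting `zero` copies a register.
  load i own o ++ store own o c ++ store mate c o ++ store mate i zero ++ sub c i zero

/-- Agent `c` considers the next object of its list. -/
def auctionStep : Cmd :=
  load p ptr c ++
  ite zero p
    (load g nxt p ++ store ptr c g ++ load o obj p ++ load g prc o ++ load l lvl c ++
      ite l g skip (add l l one ++ store prc o l ++ takeObj))
    (load l lvl c ++ add l l one ++ store lvl c l ++ load g hd c ++ store ptr c g ++
      ite l cap skip (const c 0))

/-- The agent of edge `e` becomes the agent `c` if it takes part in the auction. -/
def auctionPick : Cmd :=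
  load c agt e ++ load g mate c ++
    ite zero g (const c 0) (load l lvl c ++ ite l cap skip (const c 0))

def auction : Cmd :=
  const e 1 ++ loop e lim (auctionPick ++ loop zero c auctionStep ++ add e e one)

/-- Agent `c` searches for an object. -/
def searchStep : Cmd :=
  load p ptr c ++
  ite zero p
    (load g nxt p ++ store ptr c g ++ load o obj p ++ load g mrk o ++
      ite zero g skip (store mrk o one ++ store stk top o ++ add top top one ++ takeObj))
    -- Backtracking is the same exchange: `c` takes its old object back, and the previous agent of
    -- the path becomes current again.
    (ite zero top (sub top top one ++ load o stk top ++ takeObj) (const fnd 0 ++ const c 0))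

/-- Remove all marks, and go to the start of all lists. -/
def clear : Cmd :=
  const e 1 ++
  loop e lim
    (load o obj e ++ store mrk o zero ++ load c agt e ++ load g hd c ++ store ptr c g ++
      add e e one)

/-- The agent of edge `e` becomes the agent `c` if it is unmatched. -/
def searchPick : Cmd :=
  load c agt e ++ load g mate c ++ ite zero g (const c 0) (const fnd 1)

/-- Search for an augmenting path. -/
def search : Cmd :=
  const fnd 0 ++ const top 0 ++ const e 1 ++
  loop e lim
    -- A failed search resets `fnd` to `0`, a successful one leaves it at `1`; success ends the pass
    -- by moving `e` to the limit.
    (searchPick ++ loop zero c searchStep ++ add e e one ++ ite zero fnd (sub e lim zero) skip)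

def augment : Cmd := const fnd 1 ++ loop zero fnd (clear ++ search)

/-- Match free agents with free objects, and write the output. -/
def complete : Cmd :=
  const e 1 ++
  loop e lim
    (load c agt e ++ load o obj e ++ load g mate c ++ load i own o ++
      ite zero g skip (ite zero i skip (store mate c o ++ store own o c)) ++
      load g mate c ++ sub c c one ++ out c g ++ add e e one)

/-- Read the edges. -/
def build : Cmd :=
  const one 1 ++ add lim m one ++ const e 1 ++
  loop e lim
    (sub g e one ++ inp c 0 g ++ add c c one ++ store agt e c ++
      inp o 1 g ++ add o o one ++ store obj e o ++ inp i 2 g ++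
      ite zero i skip (load p hd c ++ store nxt e p ++ store hd c e ++ store ptr c e) ++
      add e e one)

/-- Compute the least number whose square is at least `n`. -/
def squareRoot : Cmd :=
  -- The machine cannot multiply; `(c + 1)² = c² + c + (c + 1)` keeps `sq` equal to the square of
  -- `cap`.
  loop sq n (add sq sq cap ++ add cap cap one ++ add sq sq cap)

/-- No loop runs through all agents or all objects, whose numbers need not be bounded in terms of
`m`. The test for `m > 0` lets the cost of the square root be absorbed in `√n m`. -/
def main : Cmd :=
  ite zero m (build ++ squareRoot ++ auction ++ augment ++ complete) skip

/-- The part of the state that does not change after the edges have been read. -/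
def Static (G : Net) (K : ℕ) (s : St) : Prop :=
  s.v zero = 0 ∧ s.v one = 1 ∧ s.v lim = G.m + 1 ∧ s.v cap = K ∧ s.a agt = G.agt ∧
    s.a obj = G.obj ∧ s.a nxt = G.nxt ∧ s.a hd = G.hd ∧ s.out = fun _ => 0

variable {E : Env} {G : Net} {K : ℕ}

def AuctionState (G : Net) (K b : ℕ) (s : St) : Prop :=
  Static G K s ∧ G.AuctionInv K b (s.v c) (s.a lvl) (s.a prc) (s.a mate) (s.a own) (s.a ptr)

/-- Every branch either advances a pointer or raises a level. Both lower `pot` by at least one, and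
30 units pay for the instructions of the branch. -/
theorem auctionStep_spec (hB : K + 1 ≤ E.B) {b : ℕ} {s : St} (hI : AuctionState G K b s)
    (hc : s.v c ≠ 0) :
    wp E auctionStep (fun s' t => (AuctionState G K b s' ∧ s'.v e = s.v e) ∧
      t + 1 + 30 * G.pot K (s'.a lvl) (s'.a ptr) ≤ 30 * G.pot K (s.a lvl) (s.a ptr)) s := by
  obtain ⟨hS, hI⟩ := hI
  obtain ⟨hz, ho, hl, hk, ha, hob, hn, hh, hout⟩ := hS
  have hpot := fun hp => Net.pot_advance hI.ptr_ok (c := s.v c) hp K (s.a lvl)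
  obtain ⟨hm, hlK, e₀, he1, he2, he3⟩ := hI.cur hc
  simp only [auctionStep, takeObj, skip, AuctionState, Static, wp_seq, wp_const, wp_add, wp_sub,
    wp_load, wp_store, wp_ite, St.setV_v, St.setV_a, St.setV_out, St.setA_v, St.setA_a,
    St.setA_out, reduceCtorEq, if_true, if_false, hz, ho, hl, hk, ha, hob, hn, hh, hout,
    Nat.sub_zero, true_and, and_true]
  split_ifs with h1 h2 h2
  · have h1' : s.a ptr (s.v c) ≠ 0 := by omega
    have := hpot h1'
    refine ⟨by omega, ?_, ?_⟩
    · exact hI.skip h1' h2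
    · omega
  · have h1' : s.a ptr (s.v c) ≠ 0 := by omega
    have := hpot h1'
    refine ⟨by omega, ?_, ?_⟩
    · exact hI.take hc h1' (by omega)
    · omega
  · have := Net.pot_raise (ptr := s.a ptr) he1 he2 (he3 ▸ hlK) (G.hd (s.v c))
    rw [he3] at this
    refine ⟨by omega, by omega, ?_, ?_⟩
    · exact hI.raise hc (by omega) (Or.inl ⟨rfl, h2⟩)
    · omega
  · have := Net.pot_raise (ptr := s.a ptr) he1 he2 (he3 ▸ hlK) (G.hd (s.v c))
    rw [he3] at this
    refine ⟨by omega, by omega, ?_, ?_⟩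
    · exact hI.raise hc (by omega) (Or.inr ⟨rfl, by omega⟩)
    · omega

theorem auctionLoop_spec (hB : K + 1 ≤ E.B) {b : ℕ} {s : St} (hI : AuctionState G K b s) :
    wp E (loop zero c auctionStep) (fun s' t => AuctionState G K b s' ∧ s'.v e = s.v e ∧
      s'.v c = 0 ∧ t + 30 * G.pot K (s'.a lvl) (s'.a ptr) ≤
        30 * G.pot K (s.a lvl) (s.a ptr) + 1) s := by
  refine wp_loop (fun s' => AuctionState G K b s' ∧ s'.v e = s.v e)
    (fun s' => 30 * G.pot K (s'.a lvl) (s'.a ptr)) ⟨hI, rfl⟩ (fun s₁ h₁ hc => ?_)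
    fun s₁ t h₁ hc ht => ⟨h₁.1, h₁.2, ?_, ht⟩
  · have hz := h₁.1.1.1
    refine wp_mono (auctionStep_spec hB h₁.1 (by omega)) fun s₂ t h₂ => ⟨⟨h₂.1.1, ?_⟩, h₂.2⟩
    rw [h₂.1.2, h₁.2]
  · have hz := h₁.1.1.1
    omega

theorem auctionPick_spec {s : St} (hS : Static G K s) (he : 1 ≤ s.v e) (he' : s.v e ≤ G.m)
    (hI : G.AuctionInv K (s.v e) 0 (s.a lvl) (s.a prc) (s.a mate) (s.a own) (s.a ptr)) :
    wp E auctionPick (fun s' t => AuctionState G K (s.v e + 1) s' ∧ s'.v e = s.v e ∧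
      s'.a lvl = s.a lvl ∧ s'.a ptr = s.a ptr ∧ t ≤ 10) s := by
  obtain ⟨hz, ho, hl, hk, ha, hob, hn, hh, hout⟩ := hS
  have hle := hI.lvl_le (G.agt (s.v e))
  simp only [auctionPick, skip, AuctionState, Static, wp_seq, wp_const, wp_load, wp_ite,
    St.setV_v, St.setV_a, St.setV_out, reduceCtorEq, if_true, if_false, hz, ho, hl, hk, ha, hob,
    hn, hh, hout, true_and, and_true]
  split_ifs with h1 h2
  · exact ⟨by omega, hI.start he he' (Or.inl ⟨rfl, Or.inl (by omega)⟩), by omega⟩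
  · exact ⟨by omega, hI.start he he' (Or.inr ⟨rfl, by omega, h2⟩), by omega⟩
  · exact ⟨by omega, hI.start he he' (Or.inl ⟨rfl, Or.inr (by omega)⟩), by omega⟩

theorem auction_spec (hB : K + 1 ≤ E.B) (hB' : G.m + 1 ≤ E.B) {s : St}
    (hS : Static G K s)
    (hI : G.AuctionInv K 1 0 (s.a lvl) (s.a prc) (s.a mate) (s.a own) (s.a ptr)) :
    wp E auction (fun s' t => Static G K s' ∧
      G.AuctionInv K (G.m + 1) 0 (s'.a lvl) (s'.a prc) (s'.a mate) (s'.a own) (s'.a ptr) ∧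
      t ≤ G.m * (60 * K + 50) + 10) s := by
  simp only [auction, wp_seq, wp_const]
  refine ⟨by omega, wp_loop (fun s => Static G K s ∧ 1 ≤ s.v e ∧ s.v e ≤ G.m + 1 ∧
      G.AuctionInv K (s.v e) 0 (s.a lvl) (s.a prc) (s.a mate) (s.a own) (s.a ptr))
    (fun s => 30 * G.pot K (s.a lvl) (s.a ptr) + 20 * (G.m + 1 - s.v e)) ?_ ?_ ?_⟩
  · obtain ⟨hz, ho, hl, hk, ha, hob, hn, hh, hout⟩ := hS
    simp only [Static, St.setV_v, St.setV_a, St.setV_out, reduceCtorEq, if_true, if_false, hz, ho,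
      hl, hk, ha, hob, hn, hh, hout, true_and, and_true]
    exact ⟨le_rfl, by omega, hI⟩
  · clear hS hI s
    rintro s ⟨hS, he, he', hI⟩ hlt
    rw [hS.2.2.1] at hlt
    simp only [wp_seq]
    refine wp_mono (auctionPick_spec hS he (by omega) hI) ?_
    rintro s₁ t₁ ⟨hI₁, he₁, hlvl, hptr, ht₁⟩
    refine wp_mono (auctionLoop_spec hB hI₁) ?_
    rintro s₂ t ⟨⟨hS₂, hI₂⟩, he₂, hc₂, ht⟩
    obtain ⟨hz, ho, hl, hk, ha, hob, hn, hh, hout⟩ := hS₂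
    rw [hlvl, hptr] at ht
    simp only [Static, wp_add, St.setV_v, St.setV_a, St.setV_out, reduceCtorEq, if_true,
      if_false, hz, ho, hl, hk, ha, hob, hn, hh, hout, true_and, and_true, he₂, he₁]
    rw [hc₂] at hI₂
    exact ⟨by omega, ⟨by omega, by omega, hI₂⟩, by omega⟩
  · rintro s' t ⟨hS', he, he', hI'⟩ hlt ht
    have := hS'.2.2.1
    have h1 : s'.v e = G.m + 1 := by omega
    rw [h1] at hI'
    refine ⟨hS', hI', ?_⟩
    have h2 := G.pot_le K (s.a lvl) (s.a ptr)
    simp only [St.setV_v, St.setV_a, if_true] at ht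
    have h3 : G.m * (60 * K + 50) = 30 * (G.m * (2 * K + 1)) + 20 * G.m := by ring
    omega

/-- The state during the search for an augmenting path of the edges before `b`, starting from a
matching with `z` edges. -/
def SearchState (G : Net) (K b z : ℕ) (s : St) : Prop :=
  Static G K s ∧
    (((s.v c = 0 → s.v fnd = 0 ∧ s.v top = 0) ∧ (s.v c ≠ 0 → s.v fnd = 1) ∧
      2 * G.pot 0 (s.a lvl) (s.a ptr) + s.v top ≤ 2 * G.m ∧ size G.n (s.a mate) = z ∧
      G.SearchInv b (s.v c) (s.v top) (s.a mate) (s.a own) (s.a ptr) (s.a mrk) (s.a stk)) ∨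
    (s.v fnd = 1 ∧ s.v c = 0 ∧ size G.n (s.a mate) = z + 1 ∧
      Matched G.Adj (s.a mate) (s.a own) ∧ G.PtrOk (s.a ptr)))

/-- Looking at an edge releases 40 units, of which at most 20 are saved in `top` for the later
backtracking; the final failure is paid for by `fnd`. So each branch has at least 20 units at its
disposal. -/
theorem searchStep_spec (hB : 2 * G.m + 1 ≤ E.B) {b z : ℕ} {s : St}
    (hI : SearchState G K b z s) (hc : s.v c ≠ 0) :
    wp E searchStep (fun s' t => (SearchState G K b z s' ∧ s'.v e = s.v e) ∧
      t + 1 + (40 * G.pot 0 (s'.a lvl) (s'.a ptr) + 20 * s'.v top + 20 * s'.v fnd) ≤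
        40 * G.pot 0 (s.a lvl) (s.a ptr) + 20 * s.v top + 20 * s.v fnd) s := by
  obtain ⟨hS, ⟨-, hf, hpt, hsz, hI⟩ | ⟨-, h0, -⟩⟩ := hI
  swap
  · exact absurd h0 hc
  replace hf := hf hc
  obtain ⟨hz, ho, hl, hk, ha, hob, hn, hh, hout⟩ := hS
  -- With `K = 0` the level terms vanish, and the potential counts the edges at or below the
  -- pointers of their agents.
  have hpot := fun hp => Net.pot_advance hI.ptr_ok (c := s.v c) hp 0 (s.a lvl)
  obtain ⟨hm, hcn⟩ := hI.cur hc
  have hM := hI.matched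
  have hsize := fun o ho => hM.size_take (o := o) hc hcn hm ho fun c o h => h.all.bounds.2.1
  simp only [searchStep, takeObj, skip, SearchState, Static, wp_seq, wp_const, wp_add, wp_sub,
    wp_load, wp_store, wp_ite, St.setV_v, St.setV_a, St.setV_out, St.setA_v, St.setA_a,
    St.setA_out, reduceCtorEq, if_true, if_false, hz, ho, hl, hk, ha, hob, hn, hh, hout, hf,
    Nat.sub_zero, true_and, and_true]
  by_cases h1 : 0 < s.a ptr (s.v c)
  · have h1' : s.a ptr (s.v c) ≠ 0 := by omega
    have hadj := hI.ptr_ok.adj h1'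
    have hpo := hpot h1'
    simp only [if_pos h1]
    split_ifs with h2
    · refine ⟨by omega, Or.inl ⟨fun h => absurd h hc, fun _ => trivial, by omega, hsz, ?_⟩,
        by omega⟩
      exact hI.skip h1' (by omega)
    · have ho0 : G.obj (s.a ptr (s.v c)) ≠ 0 := by have := hadj.all.bounds; omega
      have hs := hsize _ ho0
      refine ⟨by omega, ?_, by omega⟩
      by_cases h3 : s.a own (G.obj (s.a ptr (s.v c))) = 0
      · rw [if_pos h3, hsz] at hs
        exact Or.inr ⟨h3, hs, hM.take hc hm ho0 hadj, hI.ptr_ok.advance h1'⟩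
      · rw [if_neg h3, hsz] at hs
        refine Or.inl ⟨fun h => absurd h h3, fun _ => trivial, by omega, hs, ?_⟩
        exact hI.push hc h1' (by omega) h3
  · have h1' : s.a ptr (s.v c) = 0 := by omega
    simp only [if_neg h1]
    split_ifs with h2
    · obtain ⟨h3, h4⟩ := hI.pop hc h1' h2
      have ho0 : s.a stk (s.v top - 1) ≠ 0 := by have := (hI.stk_adj h2).all.bounds; omega
      have hs := hsize _ ho0
      rw [if_neg h3, hsz] at hs
      exact ⟨Or.inl ⟨fun h => absurd h h3, fun _ => trivial, by omega, hs, h4⟩, by omega⟩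
    · have h3 : s.v top = 0 := by omega
      rw [h3] at hI
      refine ⟨by omega, by omega, Or.inl ⟨fun _ => h3, by omega, by omega, hsz, ?_⟩, by omega⟩
      rw [h3]
      exact hI.fail h1'

theorem searchLoop_spec (hB : 2 * G.m + 1 ≤ E.B) {b z : ℕ} {s : St}
    (hI : SearchState G K b z s) :
    wp E (loop zero c searchStep) (fun s' t => SearchState G K b z s' ∧ s'.v e = s.v e ∧
      s'.v c = 0 ∧ t + 40 * G.pot 0 (s'.a lvl) (s'.a ptr) ≤
        40 * G.pot 0 (s.a lvl) (s.a ptr) + 20 * s.v top + 20 * s.v fnd + 1) s := by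
  refine wp_loop (fun s' => SearchState G K b z s' ∧ s'.v e = s.v e)
    (fun s' => 40 * G.pot 0 (s'.a lvl) (s'.a ptr) + 20 * s'.v top + 20 * s'.v fnd) ⟨hI, rfl⟩
    (fun s₁ h₁ hc => ?_) fun s₁ t h₁ hc ht => ⟨h₁.1, h₁.2, ?_, by omega⟩
  · have hz := h₁.1.1.1
    refine wp_mono (searchStep_spec hB h₁.1 (by omega)) fun s₂ t h₂ => ⟨⟨h₂.1.1, ?_⟩, h₂.2⟩
    rw [h₂.1.2, h₁.2]
  · have hz := h₁.1.1.1
    omega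

theorem searchPick_spec (hB : 1 ≤ E.B) {z : ℕ} {s : St} (hS : Static G K s) (he : 1 ≤ s.v e)
    (he' : s.v e ≤ G.m) (hf : s.v fnd = 0) (htop : s.v top = 0)
    (hsz : size G.n (s.a mate) = z)
    (hI : G.SearchInv (s.v e) 0 0 (s.a mate) (s.a own) (s.a ptr) (s.a mrk) (s.a stk)) :
    wp E searchPick (fun s' t => SearchState G K (s.v e + 1) z s' ∧ s'.v e = s.v e ∧
      s'.v top = 0 ∧ s'.v fnd ≤ 1 ∧ s'.a lvl = s.a lvl ∧ s'.a ptr = s.a ptr ∧ t ≤ 10) s := by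
  obtain ⟨hz, ho, hl, hk, ha, hob, hn, hh, hout⟩ := hS
  have hag := (G.agt_mem _ he he').1
  have hpt := G.pot_le 0 (s.a lvl) (s.a ptr)
  simp only [searchPick, SearchState, Static, wp_seq, wp_const, wp_load, wp_ite,
    St.setV_v, St.setV_a, St.setV_out, reduceCtorEq, if_true, if_false, hz, ho, hl, hk, ha, hob,
    hn, hh, hout, true_and, and_true, hf, htop, hsz]
  split_ifs with h1
  · exact ⟨by omega, Or.inl ⟨fun _ => trivial, by omega, by omega,
      hI.start he he' (Or.inl ⟨rfl, by omega⟩)⟩, by omega, by omega⟩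
  · refine ⟨by omega, Or.inl ⟨by omega, fun _ => trivial, by omega,
      hI.start he he' (Or.inr ⟨rfl, by omega⟩)⟩, by omega, by omega⟩

end RAMCode

namespace RAMCode

open Cmd Var Arr

variable {E : Env} {G : Net} {K : ℕ}

/-- Marks and pointers survive from one starting agent to the next, so a whole pass, with all its
failed searches, costs `O(m)`. -/
theorem search_spec (hB : 2 * G.m + 1 ≤ E.B) {z : ℕ} {s : St}
    (hS : Static G K s) (hsz : size G.n (s.a mate) = z)
    (hI : G.SearchInv 1 0 0 (s.a mate) (s.a own) (s.a ptr) (s.a mrk) (s.a stk)) :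
    wp E search (fun s' t => Static G K s' ∧ Matched G.Adj (s'.a mate) (s'.a own) ∧
      G.PtrOk (s'.a ptr) ∧ t ≤ 100 * G.m + 10 ∧
      ((s'.v fnd = 0 ∧ ∀ A f, G.Matchable A f → A.card ≤ size G.n (s'.a mate)) ∨
        (s'.v fnd = 1 ∧ size G.n (s'.a mate) = z + 1))) s := by
  simp only [search, wp_seq, wp_const]
  refine ⟨by omega, by omega, by omega, wp_loop (fun s => Static G K s ∧ 1 ≤ s.v e ∧
      s.v e ≤ G.m + 1 ∧
      ((s.v fnd = 0 ∧ s.v top = 0 ∧ size G.n (s.a mate) = z ∧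
        G.SearchInv (s.v e) 0 0 (s.a mate) (s.a own) (s.a ptr) (s.a mrk) (s.a stk)) ∨
      (s.v fnd = 1 ∧ s.v e = G.m + 1 ∧ size G.n (s.a mate) = z + 1 ∧
        Matched G.Adj (s.a mate) (s.a own) ∧ G.PtrOk (s.a ptr))))
    (fun s => 40 * G.pot 0 (s.a lvl) (s.a ptr) + 50 * (G.m + 1 - s.v e)) ?_ ?_ ?_⟩
  · obtain ⟨hz, ho, hl, hk, ha, hob, hn, hh, hout⟩ := hS
    simp only [Static, St.setV_v, St.setV_a, St.setV_out, reduceCtorEq, if_true, if_false, hz, ho,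
      hl, hk, ha, hob, hn, hh, hout, hsz, true_and, and_true]
    exact ⟨le_rfl, by omega, Or.inl hI⟩
  · clear hS hI hsz s
    rintro s ⟨hS, he, he', hI⟩ hlt
    rw [hS.2.2.1] at hlt
    obtain ⟨hf, htop, hsz, hI⟩ | ⟨-, h, -⟩ := hI
    swap
    · omega
    simp only [wp_seq]
    refine wp_mono (searchPick_spec (by omega) hS he (by omega) hf htop hsz hI) ?_
    rintro s₁ t₁ ⟨hI₁, he₁, htop₁, hf₁, hlvl, hptr, ht₁⟩
    refine wp_mono (searchLoop_spec hB hI₁) ?_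
    rintro s₂ t ⟨⟨hS₂, hI₂⟩, he₂, hc₂, ht⟩
    obtain ⟨hz, ho, hl, hk, ha, hob, hn, hh, hout⟩ := hS₂
    rw [hlvl, hptr] at ht
    obtain ⟨h1, -, -, hsz₂, hI₂⟩ | ⟨h1, -, hsz₂, hM, hP⟩ := hI₂
    · obtain ⟨hf₂, htop₂⟩ := h1 hc₂
      simp only [Static, skip, wp_ite, wp_add, wp_sub, wp_const, St.setV_v, St.setV_a, St.setV_out,
        reduceCtorEq, if_true, if_false, hz, ho, hl, hk, ha, hob, hn, hh, hout, true_and,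
        and_true, he₂, he₁, hf₂, htop₂, hsz₂, lt_irrefl, zero_le]
      rw [hc₂, htop₂] at hI₂
      exact ⟨by omega, ⟨by omega, by omega, Or.inl hI₂⟩, by omega⟩
    · simp only [Static, skip, wp_ite, wp_add, wp_sub, wp_const, St.setV_v, St.setV_a, St.setV_out,
        reduceCtorEq, if_true, if_false, hz, ho, hl, hk, ha, hob, hn, hh, hout, true_and,
        and_true, he₂, he₁, h1, hsz₂, Nat.lt_one_iff, Nat.sub_zero]
      exact ⟨by omega, ⟨by omega, by omega, Or.inr ⟨hM, hP⟩⟩, by omega⟩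
  · rintro s' t ⟨hS', he, he', hI'⟩ hlt ht
    have h1 := hS'.2.2.1
    have h2 := G.pot_le 0 (s.a lvl) (s.a ptr)
    simp only [St.setV_v, St.setV_a, if_true] at ht
    obtain ⟨hf, htop, hsz, hI⟩ | ⟨hf, he, hsz, hM, hP⟩ := hI'
    · have h3 : s'.v e = G.m + 1 := by omega
      rw [h3] at hI
      exact ⟨hS', hI.matched, hI.ptr_ok, by omega, Or.inl ⟨hf, fun A f => hI.card_le⟩⟩
    · exact ⟨hS', hM, hP, by omega, Or.inr ⟨hf, hsz⟩⟩

theorem clear_spec (hB : G.m + 1 ≤ E.B) {s : St} (hS : Static G K s) (hP : G.PtrOk (s.a ptr)) :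
    wp E clear (fun s' t => Static G K s' ∧ s'.a mate = s.a mate ∧ s'.a own = s.a own ∧
      G.PtrOk (s'.a ptr) ∧
      (∀ f, 1 ≤ f → f ≤ G.m → s'.a ptr (G.agt f) = G.hd (G.agt f)) ∧
      (∀ f, 1 ≤ f → f ≤ G.m → s'.a mrk (G.obj f) = 0) ∧ t ≤ 10 * G.m + 10) s := by
  simp only [clear, wp_seq, wp_const]
  refine ⟨by omega, wp_loop (fun s' => Static G K s' ∧ s'.a mate = s.a mate ∧
      s'.a own = s.a own ∧ G.PtrOk (s'.a ptr) ∧ 1 ≤ s'.v e ∧ s'.v e ≤ G.m + 1 ∧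
      (∀ f, 1 ≤ f → f < s'.v e → s'.a ptr (G.agt f) = G.hd (G.agt f)) ∧
      (∀ f, 1 ≤ f → f < s'.v e → s'.a mrk (G.obj f) = 0))
    (fun s => 10 * (G.m + 1 - s.v e)) ?_ ?_ ?_⟩
  · obtain ⟨hz, ho, hl, hk, ha, hob, hn, hh, hout⟩ := hS
    simp only [Static, St.setV_v, St.setV_a, St.setV_out, reduceCtorEq, if_true, if_false, hz, ho,
      hl, hk, ha, hob, hn, hh, hout, true_and, and_true]
    exact ⟨hP, le_rfl, by omega, fun f _ _ => by omega, fun f _ _ => by omega⟩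
  · clear hS hP
    rintro s₁ ⟨hS, hm, hw, hP, he, he', hptr, hmrk⟩ hlt
    obtain ⟨hz, ho, hl, hk, ha, hob, hn, hh, hout⟩ := hS
    simp only [Static, wp_seq, wp_load, wp_store, wp_add, St.setV_v, St.setV_a, St.setV_out,
      St.setA_v, St.setA_a, St.setA_out, reduceCtorEq, if_true, if_false, hz, ho, hl, hk, ha,
      hob, hn, hh, hout, true_and, and_true]
    refine ⟨by omega, ⟨hm, hw, hP.reset _, by omega, by omega, fun f h1 h2 => ?_,
      fun f h1 h2 => ?_⟩, by omega⟩
    · rw [Function.update_apply]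
      split_ifs with h3
      · rw [h3]
      · refine hptr f h1 ?_
        by_contra h4
        exact h3 (by rw [show f = s₁.v e by omega])
    · rw [Function.update_apply]
      split_ifs with h3
      · rfl
      · refine hmrk f h1 ?_
        by_contra h4
        exact h3 (by rw [show f = s₁.v e by omega])
  · rintro s' t ⟨hS', hm, hw, hP, he, he', hptr, hmrk⟩ hlt ht
    have h1 := hS'.2.2.1
    simp only [St.setV_v, if_true] at ht
    exact ⟨hS', hm, hw, hP, fun f h2 h3 => hptr f h2 (by omega),
      fun f h2 h3 => hmrk f h2 (by omega), by omega⟩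

/-- Each pass enlarges the matching by one or is the last, so a deficit of at most `d` allows at
most `d + 1` passes. -/
theorem augment_spec (hB : 2 * G.m + 1 ≤ E.B) {s : St} (hS : Static G K s)
    (hM : Matched G.Adj (s.a mate) (s.a own)) (hP : G.PtrOk (s.a ptr)) {d : ℕ}
    (hd : ∀ A f, G.Matchable A f → A.card ≤ size G.n (s.a mate) + d) :
    wp E augment (fun s' t => Static G K s' ∧ Matched G.Adj (s'.a mate) (s'.a own) ∧
      (∀ A f, G.Matchable A f → A.card ≤ size G.n (s'.a mate)) ∧
      t ≤ (d + 1) * (110 * G.m + 30) + 2) s := by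
  simp only [augment, wp_seq, wp_const]
  set W := size G.n (s.a mate) + d with hW
  refine ⟨by omega, wp_loop (fun s' => Static G K s' ∧ Matched G.Adj (s'.a mate) (s'.a own) ∧
      G.PtrOk (s'.a ptr) ∧
      ((s'.v fnd = 0 ∧ ∀ A f, G.Matchable A f → A.card ≤ size G.n (s'.a mate)) ∨ s'.v fnd = 1))
    (fun s' => (W - size G.n (s'.a mate) + s'.v fnd) * (110 * G.m + 30)) ?_ ?_ ?_⟩
  · obtain ⟨hz, ho, hl, hk, ha, hob, hn, hh, hout⟩ := hS
    simp only [Static, St.setV_v, St.setV_a, St.setV_out, reduceCtorEq, if_true, if_false, hz, ho,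
      hl, hk, ha, hob, hn, hh, hout, true_and, and_true]
    exact ⟨hM, hP, Or.inr trivial⟩
  · clear hS hM hP
    rintro s₁ ⟨hS, hM, hP, hI⟩ hlt
    rw [hS.1] at hlt
    obtain ⟨h0, -⟩ | hf := hI
    · omega
    rw [wp_seq]
    refine wp_mono (clear_spec (by omega) hS hP) ?_
    rintro s₂ t₂ ⟨hS₂, hm, hw, hP₂, hptr, hmrk, ht₂⟩
    refine wp_mono (search_spec hB hS₂ rfl
      (Net.SearchInv.of_unmarked (by rw [hm, hw]; exact hM) hP₂ hptr hmrk)) ?_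
    rintro s₃ t₃ ⟨hS₃, hM₃, hP₃, ht₃, hI₃⟩
    have hle := Net.size_le_of_matched hM₃ hd
    rw [hm] at hI₃
    refine ⟨⟨hS₃, hM₃, hP₃, hI₃.imp_right fun h => h.1⟩, ?_⟩
    have key : W - size G.n (s₃.a mate) + s₃.v fnd + 1 ≤
        W - size G.n (s₁.a mate) + s₁.v fnd := by
      rcases hI₃ with ⟨h1, h2⟩ | ⟨h1, h2⟩
      -- After a failure the new matching is maximum, hence not smaller than the old one, while
      -- `fnd` drops to `0`.
      · have := Net.size_le_of_matched hM h2
        omega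
      · omega
    have := Nat.mul_le_mul_right (110 * G.m + 30) key
    rw [add_mul _ 1] at this
    omega
  · rintro s' t ⟨hS', hM', hP', hI'⟩ hlt ht
    rw [hS'.1] at hlt
    obtain ⟨-, h⟩ | h := hI'
    · refine ⟨hS', hM', h, ?_⟩
      simp only [St.setV_v, St.setV_a, if_true, hW, Nat.add_sub_cancel_left] at ht
      omega
    · omega

/-! ### Greedy completion and output -/

theorem Matched.mono {adj adj' : ℕ → ℕ → Prop} {mate own : ℕ → ℕ} (h : Matched adj mate own)
    (hadj : ∀ a b, adj a b → adj' a b) : Matched adj' mate own :=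
  ⟨fun c hc => hadj _ _ (h.adj_mate c hc), h.own_mate, h.mate_own, h.mate_zero, h.own_zero⟩

theorem Matched.add {adj : ℕ → ℕ → Prop} {mate own : ℕ → ℕ} (h : Matched adj mate own) {c o : ℕ}
    (hc : c ≠ 0) (hm : mate c = 0) (ho : o ≠ 0) (hown : own o = 0) (ha : adj c o) :
    Matched adj (Function.update mate c o) (Function.update own o c) := by
  convert h.take hc hm ho ha using 1
  rw [takeMate, hown, eq_comm, Function.update_eq_self_iff, Function.update_of_ne hc.symm,
    h.mate_zero]

/-- The invariant of the completion of a matching `F`. -/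
structure CompleteInv (G : Net) (F : ℕ → ℕ) (b : ℕ) (mate own out : ℕ → ℕ) : Prop where
  matched : Matched G.AdjAll mate own
  extends_ : ∀ c, F c ≠ 0 → mate c = F c
  maximal : ∀ f, 1 ≤ f → f < b → mate (G.agt f) ≠ 0 ∨ own (G.obj f) ≠ 0
  out_eq : ∀ f, 1 ≤ f → f < b → out (G.agt f - 1) = mate (G.agt f)
  out_zero : ∀ x, (∀ f, 1 ≤ f → f ≤ G.m → G.agt f ≠ x + 1) → out x = 0

theorem CompleteInv.write {F : ℕ → ℕ} {b : ℕ} {mate own out : ℕ → ℕ}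
    (h : CompleteInv G F b mate own out) (hb : 1 ≤ b) (hb' : b ≤ G.m)
    (hm : mate (G.agt b) ≠ 0 ∨ own (G.obj b) ≠ 0) :
    CompleteInv G F (b + 1) mate own (Function.update out (G.agt b - 1) (mate (G.agt b))) := by
  have h0 := (G.agt_mem b hb hb').1
  refine ⟨h.matched, h.extends_, fun f h1 h2 => ?_, fun f h1 h2 => ?_, fun x hx => ?_⟩
  · rcases Nat.lt_succ_iff_lt_or_eq.1 h2 with h2 | rfl
    · exact h.maximal f h1 h2
    · exact hm
  · have h3 := (G.agt_mem f h1 (by omega)).1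
    rw [Function.update_apply]
    split_ifs with h4
    · rw [show G.agt f = G.agt b by omega]
    · refine h.out_eq f h1 ?_
      by_contra h5
      exact h4 (by rw [show f = b by omega])
  · rw [Function.update_of_ne, h.out_zero x hx]
    have := hx b hb hb'
    omega

/-- Mates and owners are never removed, so earlier edges remain blocked and one pass suffices.
Earlier edges of the same agent share the output cell that is rewritten here. -/
theorem CompleteInv.add {F : ℕ → ℕ} {b : ℕ} {mate own out : ℕ → ℕ}
    (h : CompleteInv G F b mate own out) (hb : 1 ≤ b) (hb' : b ≤ G.m)
    (hm : mate (G.agt b) = 0) (hown : own (G.obj b) = 0) :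
    CompleteInv G F (b + 1) (Function.update mate (G.agt b) (G.obj b))
      (Function.update own (G.obj b) (G.agt b))
      (Function.update out (G.agt b - 1) (G.obj b)) := by
  have h0 := (G.agt_mem b hb hb').1
  have h0' := G.obj_pos b hb hb'
  have hmono : ∀ x, mate x ≠ 0 → Function.update mate (G.agt b) (G.obj b) x = mate x := by
    intro x hx
    rw [Function.update_of_ne]
    rintro rfl
    exact hx hm
  refine ⟨h.matched.add (by omega) hm (by omega) hown ⟨b, hb, hb', rfl, rfl⟩, fun c hc => ?_,
    fun f h1 h2 => ?_, fun f h1 h2 => ?_, fun x hx => ?_⟩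
  · have := h.extends_ c hc
    rw [hmono c (by rwa [this]), this]
  · rcases Nat.lt_succ_iff_lt_or_eq.1 h2 with h2 | rfl
    · refine (h.maximal f h1 h2).imp (fun h3 => by rwa [hmono _ h3]) fun h3 => ?_
      rw [Function.update_apply]
      split_ifs
      · omega
      · exact h3
    · rw [Function.update_self]
      exact Or.inl (by omega)
  · have h3 := (G.agt_mem f h1 (by omega)).1
    rw [Function.update_apply, Function.update_apply]
    by_cases h4 : G.agt f = G.agt b
    · rw [if_pos h4, if_pos (by rw [h4])]
    · rw [if_neg h4, if_neg (by omega)]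
      refine h.out_eq f h1 ?_
      by_contra h5
      exact h4 (by rw [show f = b by omega])
  · rw [Function.update_of_ne, h.out_zero x hx]
    have := hx b hb hb'
    omega

/-- An agent without edges is never written to the output; it is unmatched, and its cell still holds
the initial zero. -/
theorem CompleteInv.out_eq_mate {F : ℕ → ℕ} {mate own out : ℕ → ℕ}
    (h : CompleteInv G F (G.m + 1) mate own out) (x : ℕ) : out x = mate (x + 1) := by
  by_cases hx : ∃ f, 1 ≤ f ∧ f ≤ G.m ∧ G.agt f = x + 1
  · obtain ⟨f, h1, h2, h3⟩ := hx
    have := h.out_eq f h1 (by omega)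
    rwa [h3, Nat.add_sub_cancel] at this
  · push Not at hx
    rw [h.out_zero x hx]
    by_contra hne
    obtain ⟨f, h1, h2, h3, -⟩ := h.matched.adj_mate (x + 1) (Ne.symm hne)
    exact hx f h1 h2 h3

theorem complete_spec (hB : G.m + 1 ≤ E.B) (hn : G.n = E.n) {s : St} (hS : Static G K s)
    (hM : Matched G.Adj (s.a mate) (s.a own)) :
    wp E complete (fun s' t => CompleteInv G (s.a mate) (G.m + 1) (s'.a mate) (s'.a own) s'.out ∧
      t ≤ 20 * G.m + 10) s := by
  simp only [complete, wp_seq, wp_const]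
  refine ⟨by omega, wp_loop (fun s' => (s'.v zero = 0 ∧ s'.v one = 1 ∧ s'.v lim = G.m + 1 ∧
      s'.a agt = G.agt ∧ s'.a obj = G.obj) ∧ 1 ≤ s'.v e ∧ s'.v e ≤ G.m + 1 ∧
      CompleteInv G (s.a mate) (s'.v e) (s'.a mate) (s'.a own) s'.out)
    (fun s => 20 * (G.m + 1 - s.v e)) ?_ ?_ ?_⟩
  · obtain ⟨hz, ho, hl, hk, ha, hob, -, hh, hout⟩ := hS
    simp only [St.setV_v, St.setV_a, St.setV_out, reduceCtorEq, if_true, if_false, hz, ho,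
      hl, ha, hob, hout, true_and]
    exact ⟨le_rfl, by omega, hM.mono fun a b => Net.Adj.all, fun c _ => rfl,
      fun f _ _ => by omega, fun f _ _ => by omega, fun _ _ => rfl⟩
  · rintro s₁ ⟨⟨hz, ho, hl, ha, hob⟩, he, he', hI⟩ hlt
    have h0 := G.agt_mem (s₁.v e) he (by omega)
    simp only [skip, wp_seq, wp_load, wp_store, wp_add, wp_sub, wp_out, wp_ite, wp_const,
      St.setV_v, St.setV_a, St.setV_out, St.setA_v, St.setA_a, St.setA_out, St.setOut_v,
      St.setOut_a, St.setOut_out, reduceCtorEq, if_true, if_false, hz, ho, hl, ha, hob,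
      true_and, and_true, Function.update_self]
    split_ifs with h1 h2
    · exact ⟨by omega, by omega, by omega, ⟨by omega, by omega,
        hI.write he (by omega) (Or.inl (by omega))⟩, by omega⟩
    · exact ⟨by omega, by omega, by omega, ⟨by omega, by omega,
        hI.write he (by omega) (Or.inr (by omega))⟩, by omega⟩
    · exact ⟨by omega, by omega, ⟨by omega, by omega,
        hI.add he (by omega) (by omega) (by omega)⟩, by omega⟩
  · rintro s' t ⟨⟨-, -, hl, -⟩, he, he', hI⟩ hlt ht
    simp only [St.setV_v, if_true] at ht
    have h3 : s'.v e = G.m + 1 := by omega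
    rw [h3] at hI
    exact ⟨hI, by omega⟩

/-- The lists after the edges before `b` have been read. -/
structure BuildInv (E : Env) (b : ℕ) (agt obj nxt hd : ℕ → ℕ) : Prop where
  agt_eq : ∀ e, 1 ≤ e → e < b → agt e = E.inp 0 (e - 1) + 1
  obj_eq : ∀ e, 1 ≤ e → e < b → obj e = E.inp 1 (e - 1) + 1
  nxt_lt : ∀ p, 1 ≤ p → p < b → E.inp 2 (p - 1) = 0 → nxt p < p
  nxt_good : ∀ p, 1 ≤ p → p < b → E.inp 2 (p - 1) = 0 → nxt p ≠ 0 →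
    E.inp 2 (nxt p - 1) = 0 ∧ agt (nxt p) = agt p
  nxt_gap : ∀ p, 1 ≤ p → p < b → E.inp 2 (p - 1) = 0 → ∀ f, nxt p < f → f < p →
    E.inp 2 (f - 1) = 0 → agt f ≠ agt p
  hd_lt : ∀ c, hd c < b
  hd_good : ∀ c, hd c ≠ 0 → E.inp 2 (hd c - 1) = 0 ∧ agt (hd c) = c
  hd_gap : ∀ c f, hd c < f → f < b → E.inp 2 (f - 1) = 0 → agt f ≠ c

namespace BuildInv

variable {b : ℕ} {agt obj nxt hd : ℕ → ℕ}

/-- A good edge is prepended to the list of its agent. Its number exceeds all earlier ones, so the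
lists are decreasing without any sorting. -/
theorem step (h : BuildInv E b agt obj nxt hd) (hb : 1 ≤ b) {nxt' hd' : ℕ → ℕ}
    (hcase : (E.inp 2 (b - 1) ≠ 0 ∧ nxt' = nxt ∧ hd' = hd) ∨
      (E.inp 2 (b - 1) = 0 ∧ nxt' = Function.update nxt b (hd (E.inp 0 (b - 1) + 1)) ∧
        hd' = Function.update hd (E.inp 0 (b - 1) + 1) b)) :
    BuildInv E (b + 1) (Function.update agt b (E.inp 0 (b - 1) + 1))
      (Function.update obj b (E.inp 1 (b - 1) + 1)) nxt' hd' := by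
  have hagt : ∀ e, e < b → Function.update agt b (E.inp 0 (b - 1) + 1) e = agt e :=
    fun e he => Function.update_of_ne (by omega) _ _
  have hnxt : ∀ e, e < b → nxt' e = nxt e := by
    intro e he
    rcases hcase with ⟨-, rfl, -⟩ | ⟨-, rfl, -⟩
    · rfl
    · rw [Function.update_of_ne (by omega)]
  have hnxt' : E.inp 2 (b - 1) = 0 → nxt' b = hd (E.inp 0 (b - 1) + 1) := by
    intro h0
    rcases hcase with ⟨h1, -⟩ | ⟨-, rfl, -⟩
    · exact absurd h0 h1
    · rw [Function.update_self]
  have hhd : ∀ c, (E.inp 2 (b - 1) = 0 ∧ c = E.inp 0 (b - 1) + 1 ∧ hd' c = b) ∨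
      ((E.inp 2 (b - 1) ≠ 0 ∨ c ≠ E.inp 0 (b - 1) + 1) ∧ hd' c = hd c) := by
    intro c
    rcases hcase with ⟨h1, -, rfl⟩ | ⟨h1, -, rfl⟩
    · exact Or.inr ⟨Or.inl h1, rfl⟩
    · by_cases hc : c = E.inp 0 (b - 1) + 1
      · subst hc
        exact Or.inl ⟨h1, rfl, Function.update_self _ _ _⟩
      · exact Or.inr ⟨Or.inr hc, Function.update_of_ne hc _ _⟩
  clear hcase
  refine ⟨fun e h1 h2 => ?_, fun e h1 h2 => ?_, fun p h1 h2 h3 => ?_, fun p h1 h2 h3 h4 => ?_,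
    fun p h1 h2 h3 f h4 h5 h6 => ?_, fun c => ?_, fun c hc => ?_, fun c f h1 h2 h3 => ?_⟩
  · rcases Nat.lt_succ_iff_lt_or_eq.1 h2 with h2 | rfl
    · rw [hagt e h2, h.agt_eq e h1 h2]
    · rw [Function.update_self]
  · rcases Nat.lt_succ_iff_lt_or_eq.1 h2 with h2 | rfl
    · rw [Function.update_of_ne (by omega), h.obj_eq e h1 h2]
    · rw [Function.update_self]
  · rcases Nat.lt_succ_iff_lt_or_eq.1 h2 with h2 | rfl
    · rw [hnxt p h2]
      exact h.nxt_lt p h1 h2 h3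
    · rw [hnxt' h3]
      exact h.hd_lt _
  · rcases Nat.lt_succ_iff_lt_or_eq.1 h2 with h2 | rfl
    · rw [hnxt p h2] at h4 ⊢
      have := h.nxt_lt p h1 h2 h3
      rw [hagt _ (by omega), hagt p h2]
      exact h.nxt_good p h1 h2 h3 h4
    · rw [hnxt' h3] at h4 ⊢
      rw [hagt _ (h.hd_lt _), Function.update_self]
      exact h.hd_good _ h4
  · rcases Nat.lt_succ_iff_lt_or_eq.1 h2 with h2 | rfl
    · rw [hnxt p h2] at h4
      rw [hagt f (by omega), hagt p h2]
      exact h.nxt_gap p h1 h2 h3 f h4 h5 h6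
    · rw [hnxt' h3] at h4
      rw [hagt _ h5, Function.update_self]
      exact h.hd_gap _ f h4 h5 h6
  · have := h.hd_lt c
    rcases hhd c with ⟨-, -, h1⟩ | ⟨-, h1⟩ <;> omega
  · rcases hhd c with ⟨h1, h2, h3⟩ | ⟨-, h1⟩
    · rw [h3, Function.update_self]
      exact ⟨h1, h2.symm⟩
    · rw [h1] at hc ⊢
      rw [hagt _ (h.hd_lt c)]
      exact h.hd_good c hc
  · rcases hhd c with ⟨-, -, h4⟩ | ⟨h4, h5⟩
    · omega
    · rw [h5] at h1
      rcases Nat.lt_succ_iff_lt_or_eq.1 h2 with h2 | rfl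
      · rw [hagt f h2]
        exact h.hd_gap c f h1 h2 h3
      · rw [Function.update_self]
        exact (h4.resolve_left fun h => h h3).symm

/-- The lists of all edges. -/
def net (h : BuildInv E (E.m + 1) agt obj nxt hd) (hn : ∀ j < E.m, E.inp 0 j < E.n) : Net where
  n := E.n
  m := E.m
  agt := agt
  obj := obj
  good e := E.inp 2 (e - 1) = 0
  nxt := nxt
  hd := hd
  agt_mem e h1 h2 := by
    rw [h.agt_eq e h1 (by omega)]
    have := hn (e - 1) (by omega)
    omega
  obj_pos e h1 h2 := by
    rw [h.obj_eq e h1 (by omega)]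
    omega
  nxt_lt p h1 h2 := h.nxt_lt p h1 (by omega)
  nxt_good p h1 h2 := h.nxt_good p h1 (by omega)
  nxt_gap p h1 h2 := h.nxt_gap p h1 (by omega)
  hd_le c := by have := h.hd_lt c; omega
  hd_good := h.hd_good
  hd_gap c f h1 h2 := h.hd_gap c f h1 (by omega)

end BuildInv

/-- The initial state. -/
def initState (n q m : ℕ) : St where
  v x := match x with
    | .n => n
    | .q => q
    | .m => m
    | _ => 0
  a _ _ := 0
  out _ := 0

theorem build_spec (hB : E.m + 1 ≤ E.B) (hB' : ∀ j < E.m, E.inp 0 j + 1 ≤ E.B)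
    (hB'' : ∀ j < E.m, E.inp 1 j + 1 ≤ E.B) (hm : 0 < E.m) (n q : ℕ) :
    wp E build (fun s' t => BuildInv E (E.m + 1) (s'.a agt) (s'.a obj) (s'.a nxt) (s'.a hd) ∧
      s'.v zero = 0 ∧ s'.v one = 1 ∧ s'.v lim = E.m + 1 ∧ s'.v cap = 0 ∧ s'.v sq = 0 ∧
      s'.v .n = n ∧ s'.out = (fun _ => 0) ∧ s'.a ptr = s'.a hd ∧ s'.a lvl = (fun _ => 0) ∧
      s'.a prc = (fun _ => 0) ∧ s'.a mate = (fun _ => 0) ∧ s'.a own = (fun _ => 0) ∧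
      t ≤ 20 * E.m + 10) (initState n q E.m) := by
  simp only [build, initState, wp_seq, wp_const, wp_add, St.setV_v, reduceCtorEq, if_true,
    if_false]
  refine ⟨by omega, by omega, by omega, wp_loop (fun s => (s.v zero = 0 ∧ s.v one = 1 ∧
      s.v lim = E.m + 1 ∧ s.v cap = 0 ∧ s.v sq = 0 ∧ s.v .n = n ∧ s.out = (fun _ => 0) ∧
      s.a ptr = s.a hd ∧ s.a lvl = (fun _ => 0) ∧ s.a prc = (fun _ => 0) ∧
      s.a mate = (fun _ => 0) ∧ s.a own = (fun _ => 0)) ∧ 1 ≤ s.v e ∧ s.v e ≤ E.m + 1 ∧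
      BuildInv E (s.v e) (s.a agt) (s.a obj) (s.a nxt) (s.a hd))
    (fun s => 20 * (E.m + 1 - s.v e)) ?_ ?_ ?_⟩
  · simp only [St.setV_v, St.setV_a, St.setV_out, reduceCtorEq, if_true, if_false, true_and]
    refine ⟨le_rfl, by omega, ?_⟩
    constructor <;> intros <;> omega
  · rintro s ⟨⟨hz, ho, hl, hk, hs, hn, hout, hp, h1, h2, h3, h4⟩, he, he', hI⟩ hlt
    have hj : s.v e - 1 < E.m := by omega
    have := hB' _ hj
    have := hB'' _ hj
    simp only [skip, wp_seq, wp_load, wp_store, wp_add, wp_sub, wp_inp, wp_ite, wp_const,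
      St.setV_v, St.setV_a, St.setV_out, St.setA_v, St.setA_a, St.setA_out,
      reduceCtorEq, if_true, if_false, hz, ho, hl, hk, hs, hn, hout, hp, h1, h2, h3, h4,
      true_and, and_true]
    split_ifs with h5
    · exact ⟨hj, by omega, hj, by omega, hj, by omega, by omega, ⟨by omega, by omega,
        hI.step he (Or.inl ⟨by omega, rfl, rfl⟩)⟩, by omega⟩
    · exact ⟨hj, by omega, hj, by omega, hj, by omega, ⟨by omega, by omega,
        hI.step he (Or.inr ⟨by omega, rfl, rfl⟩)⟩, by omega⟩
  · rintro s' t ⟨⟨hz, ho, hl, hk, hs, hn, hout, hp, h1, h2, h3, h4⟩, he, he', hI⟩ hlt ht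
    have h5 : s'.v e = E.m + 1 := by omega
    rw [h5] at hI ht
    simp only [St.setV_v, if_true] at ht
    exact ⟨hI, hz, ho, hl, hk, hs, hn, hout, hp, h1, h2, h3, h4, by omega⟩

theorem squareRoot_spec {s : St} (hB : 4 * s.v .n + 4 ≤ E.B) (ho : s.v one = 1)
    (hk : s.v cap = 0) (hs : s.v sq = 0) :
    wp E squareRoot (fun s' t => s'.a = s.a ∧ s'.out = s.out ∧
      (∀ x, x ≠ sq → x ≠ cap → s'.v x = s.v x) ∧ s.v .n ≤ s'.v cap * s'.v cap ∧
      s'.v cap ≤ Nat.sqrt (s.v .n) + 1 ∧ t ≤ 5 * Nat.sqrt (s.v .n) + 10) s := by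
  refine wp_loop (fun s' => s'.a = s.a ∧ s'.out = s.out ∧
      (∀ x, x ≠ sq → x ≠ cap → s'.v x = s.v x) ∧ s'.v sq = s'.v cap * s'.v cap ∧
      s'.v cap ≤ Nat.sqrt (s.v .n) + 1)
    (fun s' => 5 * (Nat.sqrt (s.v .n) + 1 - s'.v cap)) ?_ ?_ ?_
  · exact ⟨rfl, rfl, fun _ _ _ => rfl, by rw [hs, hk], by omega⟩
  · rintro s₁ ⟨ha, hout, hv, hsq, hle⟩ hlt
    rw [hv .n (by simp) (by simp), hsq] at hlt
    -- The loop test says `cap² < n`, so the root is exceeded by at most one after the increment.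
    have h1 : s₁.v cap ≤ Nat.sqrt (s.v .n) := Nat.le_sqrt.2 hlt.le
    have h2 : s₁.v cap ≤ s₁.v cap * s₁.v cap := Nat.le_mul_self _
    have h3 := hv one (by simp) (by simp)
    rw [ho] at h3
    simp only [wp_seq, wp_add, St.setV_v, St.setV_out, reduceCtorEq, if_true, if_false, h3,
      hsq]
    refine ⟨by omega, by omega, by omega, ⟨ha, hout, fun x hx hx' => ?_, by ring, by omega⟩,
      by omega⟩
    rw [if_neg hx, if_neg hx', if_neg hx]
    exact hv x hx hx'
  · rintro s₁ t ⟨ha, hout, hv, hsq, hle⟩ hlt ht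
    rw [hv .n (by simp) (by simp), hsq] at hlt
    exact ⟨ha, hout, hv, by omega, hle, by omega⟩

theorem Net.AuctionInv.of_zero {ptr : ℕ → ℕ} (hptr : ptr = G.hd) :
    G.AuctionInv K 1 0 (fun _ => 0) (fun _ => 0) (fun _ => 0) (fun _ => 0) ptr where
  matched := ⟨fun _ h => absurd rfl h, fun _ h => absurd rfl h, fun _ h => absurd rfl h, rfl, rfl⟩
  ptr_ok := hptr ▸ Net.ptrOk_hd
  lvl_le _ := Nat.zero_le _
  lvl_le_prc _ _ _ _ := le_rfl
  scanned e h1 h2 h3 h4 := by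
    rw [hptr] at h4
    exact absurd rfl (G.hd_gap _ e h4 h2 h3)
  prc_mate _ h := absurd rfl h
  own_of_prc _ h := absurd rfl h
  cur h := absurd rfl h
  done _ _ _ _ := by omega

/-- The arrays `F`, `mate` hold a maximum matching of the good edges and an extension that cannot
be extended further, and the latter is written to the output. -/
def Solved (E : Env) (out : ℕ → ℕ) : Prop :=
  ∃ (G : Net) (F F' mate own : ℕ → ℕ), G.n = E.n ∧ G.m = E.m ∧
    (∀ e, 1 ≤ e → e ≤ E.m → G.agt e = E.inp 0 (e - 1) + 1 ∧ G.obj e = E.inp 1 (e - 1) + 1 ∧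
      (G.good e ↔ E.inp 2 (e - 1) = 0)) ∧
    Matched G.Adj F F' ∧ (∀ A f, G.Matchable A f → A.card ≤ size G.n F) ∧
    CompleteInv G F (G.m + 1) mate own out

theorem solved_of_empty (hm : E.m = 0) : Solved E fun _ => 0 := by
  have hB : BuildInv E (E.m + 1) (fun _ => 0) (fun _ => 0) (fun _ => 0) (fun _ => 0) := by
    constructor <;> intros <;> omega
  have hM : ∀ adj, Matched adj (fun _ => 0) (fun _ => 0) := fun adj =>
    ⟨fun _ h => absurd rfl h, fun _ h => absurd rfl h, fun _ h => absurd rfl h, rfl, rfl⟩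
  refine ⟨hB.net fun j hj => by omega, fun _ => 0, fun _ => 0, fun _ => 0, fun _ => 0, rfl, rfl,
    fun e h1 h2 => by omega, hM _, fun A f hA => ?_, hM _, fun _ _ => rfl, ?_, fun _ _ _ => rfl,
    fun _ _ => rfl⟩
  · rw [Finset.card_eq_zero.2]
    · exact Nat.zero_le _
    · refine Finset.eq_empty_of_forall_notMem fun a ha => ?_
      obtain ⟨e, h1, h2, -⟩ := hA.adj a ha
      have : e ≤ E.m := h2
      omega
  · intro f h1 h2
    have : f < E.m + 1 := h2
    omega

/-- With `K ≤ √n + 1`, the auction and the at most `K + 1` search passes cost `O(K m + K)`, the root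
`O(√n)`, and reading and completing `O(m)`. -/
theorem main_spec {q : ℕ} (hB : 4 * E.n + 2 * E.m + q + 4 ≤ E.B)
    (hn : ∀ j < E.m, E.inp 0 j < E.n) (hq : ∀ j < E.m, E.inp 1 j < q) :
    wp E main (fun s' t => t ≤ 1000 * (Nat.sqrt E.n * E.m + 1) ∧ Solved E s'.out)
      (initState E.n q E.m) := by
  simp only [main, skip, wp_ite, wp_const]
  have hz₀ : (initState E.n q E.m).v zero = 0 := rfl
  have hm₀ : (initState E.n q E.m).v .m = E.m := rfl
  rw [hz₀, hm₀]
  by_cases hm : 0 < E.m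
  swap
  · rw [if_neg hm]
    exact ⟨by omega, by omega, solved_of_empty (by omega)⟩
  rw [if_pos hm]
  simp only [wp_seq]
  refine wp_mono (build_spec (by omega) (fun j hj => by have := hn j hj; omega)
    (fun j hj => by have := hq j hj; omega) hm E.n q) ?_
  rintro s₁ t₁ ⟨hI, hz, ho, hl, hk, hs, hn₁, hout, hptr, h1, h2, h3, h4, ht₁⟩
  refine wp_mono (squareRoot_spec (by rw [hn₁]; omega) ho hk hs) ?_
  rintro s₂ t₂ ⟨ha₂, hout₂, hv₂, hK, hK', ht₂⟩
  rw [hn₁] at hK hK' ht₂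
  set G := hI.net hn with hG
  set K := s₂.v cap
  -- A pair exists, so there is an agent. Thus the integer root is at least one, and the terms `m`
  -- and `√n` are both at most `√n m`.
  have hn0 : 0 < E.n := (Nat.zero_le _).trans_lt (hn 0 hm)
  have hS₂ : Static G K s₂ := by
    refine ⟨?_, ?_, ?_, rfl, ?_, ?_, ?_, ?_, ?_⟩
    · rw [hv₂ _ (by simp) (by simp), hz]
    · rw [hv₂ _ (by simp) (by simp), ho]
    · rw [hv₂ _ (by simp) (by simp), hl]; rfl
    · rw [ha₂]; rfl
    · rw [ha₂]; rfl
    · rw [ha₂]; rfl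
    · rw [ha₂]; rfl
    · rw [hout₂, hout]
  have hsq := Nat.sqrt_le_self E.n
  have hGm : G.m = E.m := rfl
  have hGn : G.n = E.n := rfl
  have hK0 : 0 < K := by
    by_contra h0
    have : K = 0 := by omega
    rw [this] at hK
    omega
  refine wp_mono (auction_spec (by omega) (by omega) hS₂ ?_) ?_
  · rw [ha₂, h1, h2, h3, h4]
    exact Net.AuctionInv.of_zero (by rw [hptr]; rfl)
  rintro s₃ t₃ ⟨hS₃, hI₃, ht₃⟩
  refine wp_mono (augment_spec (by omega) hS₃ hI₃.matched hI₃.ptr_ok (d := K)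
    fun A f => hI₃.card_le (by rw [hGn]; exact hK) hK0) ?_
  rintro s₄ t₄ ⟨hS₄, hM₄, hmax, ht₄⟩
  refine wp_mono (complete_spec (by omega) hGn hS₄ hM₄) ?_
  rintro s₅ t₅ ⟨hI₅, ht₅⟩
  refine ⟨?_, G, _, _, _, _, rfl, rfl, fun e he he' => ⟨hI.agt_eq e he (by omega),
    hI.obj_eq e he (by omega), Iff.rfl⟩, hM₄, hmax, hI₅⟩
  have hS0 : 1 ≤ Nat.sqrt E.n := Nat.le_sqrt.2 (by omega)
  rw [hGm] at ht₃ ht₄ ht₅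
  generalize Nat.sqrt E.n = S at *
  have hSm : E.m ≤ S * E.m := Nat.le_mul_of_pos_left _ hS0
  have hSm' : S ≤ S * E.m := Nat.le_mul_of_pos_right _ hm
  have hKm : E.m * (60 * K + 50) ≤ 60 * (S * E.m) + 110 * E.m := by
    calc E.m * (60 * K + 50) ≤ E.m * (60 * (S + 1) + 50) := by gcongr
      _ = _ := by ring
  have hKm' : (K + 1) * (110 * E.m + 30) ≤ 110 * (S * E.m) + 220 * E.m + 30 * S + 60 := by
    calc (K + 1) * (110 * E.m + 30) ≤ (S + 1 + 1) * (110 * E.m + 30) := by gcongr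
      _ = _ := by ring
  omega

end RAMCode

/-! ### The result of the program -/

namespace HAInstance

open RAMCode

variable {n q : ℕ} (I : HAInstance (Fin n) (Fin q)) {e : List (Fin n × Fin q)}

theorem IsListing.length_eq (he : I.IsListing e) : e.length = I.numPairs := by
  classical
  have h1 : e.toFinset.card = e.length := List.toFinset_card_of_nodup he.1
  rw [← h1, Finset.card_eq_sum_card_fiberwise (f := Prod.fst) (t := Finset.univ)
    fun _ _ => Finset.mem_coe.2 (Finset.mem_univ _)]
  refine Finset.sum_congr rfl fun i _ => ?_
  rw [← Finset.card_map (s := I.acc i) ⟨fun o => (i, o), fun a b h => (Prod.mk.inj h).2⟩]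
  refine congrArg Finset.card (Finset.ext fun ⟨j, o⟩ => ?_)
  simp only [Finset.mem_filter, List.mem_toFinset, he.2, Finset.mem_map]
  constructor
  · rintro ⟨h, rfl⟩
    exact ⟨o, h, rfl⟩
  · rintro ⟨o', h, h'⟩
    obtain ⟨rfl, rfl⟩ := Prod.mk.inj h'
    exact ⟨h, rfl⟩

/-- Below an object of rank `r` all `r` positions are occupied, so the ranks in the input respect
the word size. -/
theorem rank_le_numPairs {i : Fin n} {o : Fin q} (ho : o ∈ I.acc i) :
    I.rank i o ≤ I.numPairs := by
  classical
  have h1 : (Finset.range (I.rank i o)).card ≤ (I.acc i).card := by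
    refine (Finset.card_le_card ?_).trans (Finset.card_image_le (f := I.rank i))
    intro r hr
    obtain ⟨o', h, h'⟩ := I.rank_dense i o ho r (Finset.mem_range.1 hr)
    exact Finset.mem_image.2 ⟨o', h, h'⟩
  rw [Finset.card_range] at h1
  exact h1.trans (Finset.single_le_sum (f := fun i => (I.acc i).card)
    (fun _ _ => Nat.zero_le _) (Finset.mem_univ i))

/-- The data of the run on a listing of an instance. -/
def env (he : I.IsListing e) : Env where
  n := n
  m := I.numPairs
  B := 16 * (n + q + I.numPairs + 1)
  inp col j := (I.initialConfig e).mem (3 * j + col)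
  sixteen_le := by omega
  base_le := by omega
  inp_le col j hj := by
    rw [← he.length_eq] at hj
    have h1 : (3 * j + (col : ℕ)) / 3 = j := by omega
    have h2 : e[j]? = some e[j] := List.getElem?_eq_getElem hj
    have h3 := I.rank_le_numPairs ((he.2 e[j]).1 (List.getElem_mem hj))
    simp only [initialConfig, h1, h2]
    split_ifs <;> omega

variable {I}

theorem env_inp (he : I.IsListing e) {j : ℕ} (hj : j < e.length) :
    (I.env he).inp 0 j = e[j].1 ∧ (I.env he).inp 1 j = e[j].2 ∧
      (I.env he).inp 2 j = I.rank e[j].1 e[j].2 := by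
  have h2 : e[j]? = some e[j] := List.getElem?_eq_getElem hj
  refine ⟨?_, ?_, ?_⟩
  · simp [env, initialConfig, h2]
  · have h1 : (3 * j + 1) / 3 = j := by omega
    simp [env, initialConfig, h1, h2, Nat.add_mod]
  · have h1 : (3 * j + 2) / 3 = j := by omega
    simp [env, initialConfig, h1, h2, Nat.add_mod]

/-- The matching that an array holds. -/
def toMatching (n q : ℕ) (mate : ℕ → ℕ) (i : Fin n) : Option (Fin q) :=
  if h : 0 < mate (i + 1) ∧ mate (i + 1) ≤ q then some ⟨mate (i + 1) - 1, by omega⟩ else none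

theorem toMatching_eq_some {mate : ℕ → ℕ} {i : Fin n} {o : Fin q} :
    toMatching n q mate i = some o ↔ mate (i + 1) = o + 1 := by
  have := o.isLt
  unfold toMatching
  split_ifs with h
  · rw [Option.some_inj, Fin.ext_iff]
    simp only
    omega
  · simp only [false_iff]
    omega

/-- The goals of all three parts are met by a maximal extension of a maximum matching of the
first-choice edges. -/
def IsSolution (I : HAInstance (Fin n) (Fin q)) (M : Fin n → Option (Fin q)) : Prop :=
  ∃ F, I.IsMaximumFirstChoiceMatching F ∧ I.IsMatching M ∧ (∀ i o, F i = some o → M i = some o) ∧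
    ∀ i, ∀ o ∈ I.acc i, M i ≠ none ∨ ∃ j, M j = some o

theorem isMatching_toMatching {adj : ℕ → ℕ → Prop} {mate own : ℕ → ℕ} (h : Matched adj mate own)
    (hadj : ∀ (i : Fin n) (o : Fin q), adj (i + 1) (o + 1) → o ∈ I.acc i) :
    I.IsMatching (toMatching n q mate) := by
  refine ⟨fun i o ho => ?_, fun i j o hi hj => ?_⟩
  · rw [toMatching_eq_some] at ho
    refine hadj i o ?_
    rw [← ho]
    exact h.adj_mate _ (by omega)
  · rw [toMatching_eq_some] at hi hj
    have h1 := h.own_mate _ (show mate (i + 1) ≠ 0 by omega)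
    have h2 := h.own_mate _ (show mate (j + 1) ≠ 0 by omega)
    rw [hi] at h1
    rw [hj] at h2
    exact Fin.ext (by omega)

theorem exists_solution_of_solved (he : I.IsListing e) {out : ℕ → ℕ}
    (h : Solved (I.env he) out) :
    ∃ M, I.IsSolution M ∧ ∀ i : Fin n, out i = match M i with
      | none => 0
      | some o => (o : ℕ) + 1 := by
  classical
  obtain ⟨G, F, F', mate, own, hn, hm, hG, hF, hmax, hI⟩ := h
  have hlen : e.length = (I.env he).m := he.length_eq
  have hnn : (I.env he).n = n := rfl
  have hall : ∀ a b, G.AdjAll a b ↔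
      ∃ (i : Fin n) (o : Fin q), o ∈ I.acc i ∧ a = i + 1 ∧ b = o + 1 := by
    intro a b
    constructor
    · rintro ⟨f, h1, h2, rfl, rfl⟩
      obtain ⟨h3, h4, -⟩ := hG f h1 (by omega)
      obtain ⟨h5, h6, -⟩ := env_inp he (j := f - 1) (by omega)
      exact ⟨_, _, (he.2 _).1 (List.getElem_mem (show f - 1 < e.length by omega)),
        by rw [h3, h5], by rw [h4, h6]⟩
    · rintro ⟨i, o, ho, rfl, rfl⟩
      obtain ⟨j, hj, hj'⟩ := List.getElem_of_mem ((he.2 (i, o)).2 ho)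
      obtain ⟨h3, h4, -⟩ := hG (j + 1) (by omega) (by omega)
      obtain ⟨h5, h6, -⟩ := env_inp he hj
      rw [Nat.add_sub_cancel] at h3 h4
      exact ⟨j + 1, by omega, by omega, by rw [h3, h5, hj'], by rw [h4, h6, hj']⟩
  have hgood : ∀ a b, G.Adj a b ↔
      ∃ (i : Fin n) (o : Fin q), I.IsFirstChoice i o ∧ a = i + 1 ∧ b = o + 1 := by
    intro a b
    constructor
    · rintro ⟨f, h1, h2, hg, rfl, rfl⟩
      obtain ⟨h3, h4, h7⟩ := hG f h1 (by omega)
      obtain ⟨h5, h6, h8⟩ := env_inp he (j := f - 1) (by omega)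
      refine ⟨_, _, I.isFirstChoice_iff.2
        ⟨(he.2 _).1 (List.getElem_mem (show f - 1 < e.length by omega)), ?_⟩,
        by rw [h3, h5], by rw [h4, h6]⟩
      rw [← h8]
      exact h7.1 hg
    · rintro ⟨i, o, ho, rfl, rfl⟩
      obtain ⟨ho, hr⟩ := I.isFirstChoice_iff.1 ho
      obtain ⟨j, hj, hj'⟩ := List.getElem_of_mem ((he.2 (i, o)).2 ho)
      obtain ⟨h3, h4, h7⟩ := hG (j + 1) (by omega) (by omega)
      obtain ⟨h5, h6, h8⟩ := env_inp he hj
      rw [Nat.add_sub_cancel] at h3 h4 h7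
      refine ⟨j + 1, by omega, by omega, h7.2 ?_, by rw [h3, h5, hj'], by rw [h4, h6, hj']⟩
      rw [h8, hj', hr]
  have hacc : ∀ (i : Fin n) (o : Fin q), G.AdjAll (i + 1) (o + 1) → o ∈ I.acc i := by
    intro i o h
    obtain ⟨i', o', h, h1, h2⟩ := (hall _ _).1 h
    obtain rfl : i = i' := Fin.ext (by omega)
    obtain rfl : o = o' := Fin.ext (by omega)
    exact h
  have hfirst : ∀ (i : Fin n) (o : Fin q), G.Adj (i + 1) (o + 1) → I.IsFirstChoice i o := by
    intro i o h
    obtain ⟨i', o', h, h1, h2⟩ := (hgood _ _).1 h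
    obtain rfl : i = i' := Fin.ext (by omega)
    obtain rfl : o = o' := Fin.ext (by omega)
    exact h
  refine ⟨toMatching n q mate, ⟨toMatching n q F, ⟨⟨?_, ?_⟩, ?_⟩, ?_, ?_, ?_⟩, ?_⟩
  · exact isMatching_toMatching hF fun i o h => (hfirst i o h).1
  · intro i o ho
    rw [toMatching_eq_some] at ho
    refine hfirst i o ?_
    rw [← ho]
    exact hF.adj_mate _ (by omega)
  · intro M' hM'
    -- The rival matching is written with agents and objects shifted by one, in order to apply
    -- `hmax`. The value at `0` plays no role, because `A` contains only successors.
    let f : ℕ → ℕ := fun c => if h : c - 1 < n then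
      (match M' ⟨c - 1, h⟩ with | none => 0 | some o => (o : ℕ) + 1) else 0
    have hf : ∀ (i : Fin n) (o : Fin q), M' i = some o → f (i + 1) = o + 1 := by
      intro i o ho
      simp [f, ho]
    let A := (Finset.univ.filter fun i => (M' i).isSome = true).image fun i : Fin n => (i : ℕ) + 1
    have hA : G.Matchable A f := by
      refine ⟨fun a ha => ?_, fun a ha b hb hab => ?_⟩
      · obtain ⟨i, hi, rfl⟩ := Finset.mem_image.1 ha
        obtain ⟨o, ho⟩ := Option.isSome_iff_exists.1 (Finset.mem_filter.1 hi).2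
        rw [hf i o ho]
        exact (hgood _ _).2 ⟨i, o, hM'.2 i o ho, rfl, rfl⟩
      · obtain ⟨i, hi, rfl⟩ := Finset.mem_image.1 ha
        obtain ⟨j, hj, rfl⟩ := Finset.mem_image.1 hb
        obtain ⟨o, ho⟩ := Option.isSome_iff_exists.1 (Finset.mem_filter.1 hi).2
        obtain ⟨o', ho'⟩ := Option.isSome_iff_exists.1 (Finset.mem_filter.1 hj).2
        rw [hf i o ho, hf j o' ho'] at hab
        obtain rfl : o = o' := Fin.ext (by omega)
        rw [hM'.1.2 i j o ho ho']
    have h1 := hmax A f hA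
    rw [Finset.card_image_of_injective _ fun i j h => Fin.ext (Nat.succ_injective h)] at h1
    refine h1.trans ((Finset.card_le_card ?_).trans
      (Finset.card_image_le (s := Finset.univ.filter fun i => (toMatching n q F i).isSome = true)
        (f := fun i : Fin n => (i : ℕ) + 1)))
    intro c hc
    obtain ⟨-, hc⟩ := Finset.mem_filter.1 hc
    obtain ⟨i, o, -, rfl, ho⟩ := (hgood _ _).1 (hF.adj_mate c hc)
    refine Finset.mem_image.2 ⟨i, Finset.mem_filter.2 ⟨Finset.mem_univ _, ?_⟩, rfl⟩
    rw [toMatching_eq_some.2 ho]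
    rfl
  · exact isMatching_toMatching hI.matched hacc
  · intro i o ho
    rw [toMatching_eq_some] at ho ⊢
    rw [hI.extends_ _ (by omega), ho]
  · intro i o ho
    obtain ⟨f, h1, h2, h3, h4⟩ := (hall _ _).2 ⟨i, o, ho, rfl, rfl⟩
    have := hI.maximal f h1 (by omega)
    rw [h3, h4] at this
    refine this.imp (fun h => ?_) fun h => ?_
    · obtain ⟨i', o', -, h5, h6⟩ := (hall _ _).1 (hI.matched.adj_mate _ h)
      rw [toMatching_eq_some.2 h6]
      simp
    · have h5 := hI.matched.mate_own _ h
      obtain ⟨j, o', -, h6, -⟩ := (hall _ _).1 (hI.matched.adj_mate _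
        (show mate (own (o + 1)) ≠ 0 by omega))
      exact ⟨j, toMatching_eq_some.2 (by rw [← h6, h5])⟩
  · intro i
    rw [hI.out_eq_mate]
    cases hM : toMatching n q mate i with
    | some o => exact toMatching_eq_some.1 hM
    | none =>
      by_contra hne
      obtain ⟨i', o', -, -, h6⟩ := (hall _ _).1 (hI.matched.adj_mate _ hne)
      rw [toMatching_eq_some.2 h6] at hM
      simp at hM

/-! ### The running time -/

open RAMInstr RAMConfig

/-- Code that computes the base addresses of the output and the arrays. -/
def setup : RAMProgram := [add 6 2 2, add 6 6 2, add 5 6 0]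

def program : RAMProgram := setup ++ compile 3 main

theorem initialConfig_boundedBy (he : I.IsListing e) :
    (I.initialConfig e).BoundedBy (32 * (I.env he).B) := by
  have hB : (I.env he).B = 16 * (n + q + I.numPairs + 1) := rfl
  have hlen := he.length_eq
  refine ⟨fun r => ?_, fun a => ?_⟩
  · simp only [initialConfig]
    split_ifs <;> omega
  · by_cases ha : a / 3 < I.numPairs
    · have := (I.env he).inp_le ⟨a % 3, Nat.mod_lt _ (by omega)⟩ (a / 3) ha
      simp only [env, Nat.div_add_mod] at this
      rw [hB]
      omega
    · have : e[a / 3]? = none := List.getElem?_eq_none (by omega)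
      simp [initialConfig, this]

theorem sim_setup (he : I.IsListing e) :
    Sim (I.env he) (initState n q I.numPairs) (setup.foldl exec (I.initialConfig e)) := by
  have hB : (I.env he).B = 16 * (n + q + I.numPairs + 1) := rfl
  have hlen := he.length_eq
  have hzero : ∀ a, 3 * I.numPairs ≤ a → (I.initialConfig e).mem a = 0 := by
    intro a ha
    have : e[a / 3]? = none := List.getElem?_eq_none (by omega)
    simp [initialConfig, this]
  constructor
  · intro x
    cases x <;> simp [setup, RAMConfig.exec, initialConfig, initState, Var.reg, hlen]
  · simp [setup, RAMConfig.exec, initialConfig, hlen, env]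
    omega
  · simp [setup, RAMConfig.exec, initialConfig, hlen, env]
    omega
  · intro col j hj
    rfl
  · intro i hi
    exact hzero _ (by simp only [env]; omega)
  · intro k i
    exact hzero _ (by simp only [env]; omega)
  · intro x
    cases x <;> simp only [initState] <;> omega
  · intro k i
    exact Nat.zero_le _

/-- The factor 10 is the overhead of compilation, and the 3 counts the setup instructions. -/
theorem program_spec (he : I.IsListing e) :
    ∃ (t : ℕ) (M : Fin n → Option (Fin q)),
      t ≤ 10 * (1000 * (Nat.sqrt n * I.numPairs + 1)) + 3 ∧
      program.length ≤ ((RAMConfig.step program)^[t] (I.initialConfig e)).pc ∧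
      (∀ s ≤ t, ((RAMConfig.step program)^[s] (I.initialConfig e)).BoundedBy
        (32 * (16 * (n + q + I.numPairs + 1)))) ∧
      Outputs ((RAMConfig.step program)^[t] (I.initialConfig e)) I.numPairs M ∧
      I.IsSolution M := by
  have hB : (I.env he).B = 16 * (n + q + I.numPairs + 1) := rfl
  have hn : (I.env he).n = n := rfl
  have hm : (I.env he).m = I.numPairs := rfl
  have hlen := he.length_eq
  have hb := initialConfig_boundedBy he
  obtain ⟨s', t, hr, ht, hsol⟩ := main_spec (E := I.env he) (q := q) (by omega)
    (fun j hj => by rw [(env_inp he (by omega)).1]; exact Fin.isLt _)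
    (fun j hj => by rw [(env_inp he (by omega)).2.1]; exact Fin.isLt _)
  obtain ⟨M, hM, hout⟩ := exists_solution_of_solved he hsol
  have hP : CodeAt program 0 (setup ++ compile 3 main) := fun j ins h => by
    rw [Nat.zero_add]; exact h
  obtain ⟨hP₁, hP₂⟩ := hP.append
  have hsafe : Safe (32 * (I.env he).B) setup (I.initialConfig e) := by
    simp [setup, Safe, RAMConfig.exec, initialConfig, hlen]
    omega
  have h1 := Reach.of_safe (P := program) setup (I.initialConfig e) hb hsafe hP₁
  have hpc : (setup.foldl exec (I.initialConfig e)).pc = 3 := rfl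
  obtain ⟨t₂, c₂, ht₂, h2, hS₂, hpc₂⟩ := simulation hr _ (sim_setup he) h1.bounded
    (by rw [hpc]; exact hP₂)
  have h3 := h1.trans h2
  rw [hpc] at hpc₂
  have hlen' : setup.length = 3 := rfl
  refine ⟨_, M, ?_, ?_, h3.2, ?_, hM⟩
  · rw [hn, hm] at ht
    omega
  · rw [h3.1, hpc₂, program, List.length_append, hlen']
  · intro i
    rw [h3.1]
    exact (hS₂.out i i.isLt).trans (hout i)

theorem foundInSqrtTime_of_isSolution
    {Restriction : ∀ {n q : ℕ}, HAInstance (Fin n) (Fin q) → Prop}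
    {Goal : ∀ {n q : ℕ}, HAInstance (Fin n) (Fin q) → (Fin n → Option (Fin q)) → Prop}
    (h : ∀ {n q : ℕ} (I : HAInstance (Fin n) (Fin q)) (M), Restriction I → I.IsSolution M →
      Goal I M) : FoundInSqrtTime Restriction Goal := by
  -- The constant covers the time, `10000 (√n m + 1) + 3`, and the word size, `512 (n + q + m + 1)`.
  refine ⟨program, 20000, fun n q I e he hR => ?_⟩
  obtain ⟨t, M, ht, hpc, hb, hO, hM⟩ := program_spec he
  refine ⟨t, M, ?_, hpc, fun s hs => ?_, hO, h I M hR hM⟩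
  · have h1 : (t : ℝ) ≤ 10 * (1000 * (Nat.sqrt n * I.numPairs + 1)) + 3 := by exact_mod_cast ht
    have h2 : (Nat.sqrt n : ℝ) * I.numPairs ≤ Real.sqrt n * I.numPairs :=
      mul_le_mul_of_nonneg_right Real.nat_sqrt_le_real_sqrt (Nat.cast_nonneg _)
    have h3 : 0 ≤ Real.sqrt n * I.numPairs := by positivity
    push_cast
    linarith
  · have h1 := hb s hs
    exact ⟨fun r => (h1.1 r).trans (by omega), fun a => (h1.2 a).trans (by omega)⟩

end HAInstance

/-! ### The three parts of the theorem -/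

open HAInstance

theorem mainTheorem7 :
    -- every list is a single tie
    ((∀ (N : Type u) (O : Type v) [Fintype N] [Fintype O] (I : HAInstance N O), I.SingleTie →
        (∃ M, I.MajorityStable M) ∧
        ∀ M, I.IsMaximumMatching M → I.MajorityStable M) ∧
      HAInstance.FoundInSqrtTime
        (fun I => I.SingleTie)
        (fun I M => I.MajorityStable M)) ∧
    -- dichotomous and complete lists, `|O| ≥ |N|`
    ((∀ (N : Type u) (O : Type v) [Fintype N] [Fintype O] (I : HAInstance N O),
        I.Dichotomous → I.CompleteLists → Fintype.card N ≤ Fintype.card O →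
        (∃ M, I.MajorityStable M) ∧
        ∀ F, I.IsMaximumFirstChoiceMatching F →
          (∃ M, I.IsCompletionOf M F) ∧
          ∀ M, I.IsCompletionOf M F → I.MajorityStable M) ∧
      HAInstance.FoundInSqrtTime
        (fun {n q} I => I.Dichotomous ∧ I.CompleteLists ∧ n ≤ q)
        (fun I M => I.MajorityStable M)) ∧
    -- dichotomous and complete lists, `|O| < |N|`
    ((∀ (N : Type u) (O : Type v) [Fintype N] [Fintype O] (I : HAInstance N O),
        I.Dichotomous → I.CompleteLists → Fintype.card O < Fintype.card N →
        ∃ M, I.KStable (2 * (Fintype.card N : ℝ) / 3 + 1) M) ∧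
      HAInstance.FoundInSqrtTime
        (fun {n q} I => I.Dichotomous ∧ I.CompleteLists ∧ q < n)
        (fun {n _} I M => I.KStable (2 * (n : ℝ) / 3 + 1) M)) := by
  refine ⟨⟨fun N O _ _ I h => ?_, foundInSqrtTime_of_isSolution ?_⟩,
    ⟨fun N O _ _ I hd hc hcard => ?_, foundInSqrtTime_of_isSolution ?_⟩,
    ⟨fun N O _ _ I hd hc hcard => ?_, foundInSqrtTime_of_isSolution ?_⟩⟩
  · obtain ⟨F, hF⟩ := I.exists_isMaximumFirstChoiceMatching
    exact ⟨⟨F, h.majorityStable I hF⟩, fun M hM =>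
      h.majorityStable I ((h.isMaximumFirstChoiceMatching_iff I).2 hM)⟩
  · rintro n q I M h ⟨F, hF, hM, hext, -⟩
    exact h.majorityStable I (h.isMaximumFirstChoiceMatching_of_extension I hF hM hext)
  · have hcomp : ∀ F, I.IsMaximumFirstChoiceMatching F → ∃ M, I.IsCompletionOf M F := by
      intro F hF
      obtain ⟨M, hM, hext, hmax⟩ := I.exists_maximal_extension hF.1.1
      exact ⟨M, I.isCompletionOf_of_maximal hc hcard hM hext hmax⟩
    obtain ⟨F, hF⟩ := I.exists_isMaximumFirstChoiceMatching
    obtain ⟨M, hM⟩ := hcomp F hF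
    exact ⟨⟨M, hM.majorityStable I hd hF⟩, fun F hF =>
      ⟨hcomp F hF, fun M hM => hM.majorityStable I hd hF⟩⟩
  · rintro n q I M ⟨hd, hc, hnq⟩ ⟨F, hF, hM, hext, hmax⟩
    exact IsCompletionOf.majorityStable I hd hF
      (I.isCompletionOf_of_maximal hc (by simpa using hnq) hM hext hmax)
  · obtain ⟨F, hF⟩ := I.exists_isMaximumFirstChoiceMatching
    obtain ⟨M, hM, hext, hmax⟩ := I.exists_maximal_extension hF.1.1
    exact ⟨M, I.kStable_of_saturating hd hF hM hext (I.saturating_of_maximal hc hcard hM hmax)⟩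
  · rintro n q I M ⟨hd, hc, hnq⟩ ⟨F, hF, hM, hext, hmax⟩
    have := I.kStable_of_saturating hd hF hM hext
      (I.saturating_of_maximal hc (by simpa using hnq) hM hmax)
    simpa using this
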